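/- Let $K$ be a differential field ($\partial$-field) of characteristic zero, and let $\mathcal U/K$ be an extension of $\partial$-fields into which every $\partial$-finitely generated extension $L/K$ of $\partial$-fields embeds. (All rings and Hopf algebras are commutative. A $\partial$-$K$-algebra, $\partial$-$K$-Hopf algebra or $\partial$-$K$-Lie algebra is a $K$-algebra, $K$-Hopf algebra or $K$-Lie algebra with an additive operator $\partial$ satisfying the Leibniz rule over $K$ and compatible with all structure maps.) For a group-valued functor $\mathsf F$ on $\partial$-$K$-algebras let $H^1_\partial(K,\mathsf F):=H^1_\partial(\mathcal U/K,\mathsf F)$ be the first Amitsur cohomology set: the set of cocycles $\gamma\in\mathsf F(\mathcal U\otimes_K\mathcal U)$, i.e. $e_{13}\gamma=e_{23}\gamma\cdot e_{12}\gamma$ in $\mathsf F(\mathcal U\otimes_K\mathcal U\otimes_K\mathcal U)$, where $e_{12},e_{23},e_{13}$ are induced by $x\otimes y\mapsto x\otimes y\otimes1,\ 1\otimes x\otimes y,\ x\otimes1\otimes y$, modulo $\gamma\sim (d_1x)^{-1}\,\gamma\, (d_2x)$ for $x\in\mathsf F(\mathcal U)$, where $d_1,d_2$ are induced by $b\mapsto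 1\otimes b$ and $b\mapsto b\otimes1$. Let $\mathsf G=\operatorname{Spec}_\partial(H)$ be an affine algebraic $\partial$-$K$-group: the functor $T\mapsto\mathsf G(T)$ of $\partial$-$K$-algebra maps $H\to T$, where $H$ is a $\partial$-$K$-Hopf algebra that is finitely generated as a $K$-algebra. Let $\mathfrak g=\operatorname{Lie}(\mathsf G)=\operatorname{Der}_\epsilon(H,K)$, with $(\partial D)(a)=\partial(Da)-D(\partial a)$, and let $\mathsf{Aut}_\partial(\mathfrak g)$ be the functor sending a $\partial$-$K$-algebra $T$ to the group of automorphisms of the $\partial$-$T$-Lie algebra $T\otimes_K\mathfrak g$. The left adjoint action $\mathsf{Ad}:\mathsf G\to\mathsf{Aut}_\partial(\mathfrak g)$ induces $\mathsf{Ad}_*:H^1_\partial(K,\mathsf G)\to H^1_\partial(K,\mathsf{Aut}_\partial(\mathfrak g))$. A right $\partial$-$K$-torsor $\mathsf X=\operatorname{Spec}_\partial(B)$ for $\mathsf G$ is a right $H$-comodule $\partial$-$K$-algebra $B=(B,\rho)$ such that $R\otimes_KB\simeq R\otimes_KH$ as right comodule $\partial$-$R$-algebras for some non-zero $\partial$-$K$-algebra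 $R$; a twisted form of $\mathfrak g$ is a $\partial$-$K$-Lie algebra $\mathfrak f$ with $R\otimes_K\mathfrak g\simeq R\otimes_K\mathfrak f$ as $\partial$-$R$-Lie algebras for some such $R$. There are bijections $$\{\text{right }\partial\text{-}K\text{-torsors for }\mathsf G\}/\!\simeq\ \longrightarrow\ H^1_\partial(K,\mathsf G),\qquad \{\text{twisted forms of }\mathfrak g\}/\!\simeq\ \longrightarrow\ H^1_\partial(K,\mathsf{Aut}_\partial(\mathfrak g)),$$ characterized as follows. The class of $\mathsf X$ goes to the class of $\gamma$ if and only if $d_2\varphi=\ell_\gamma\circ d_1\varphi$ for some isomorphism $\varphi:\mathcal U\otimes_KB\simeq\mathcal U\otimes_KH$ of right comodule $\partial$-$\mathcal U$-algebras, where $d_i\varphi$ denotes base extension along $d_i$ and $\ell_\gamma(t\otimes h)=t\,\gamma(h_{(1)})\otimes h_{(2)}$. The class of $\mathfrak f$ goes to the class of $\sigma$ if and only if $d_2\Psi=d_1\Psi\circ\sigma$ for some isomorphism $\Psi:\mathcal U\otimes_K\mathfrak g\simeq\mathcal U\otimes_K\mathfrak f$ of $\partial$-$\mathcal U$-Lie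 algebras. For every right $\partial$-$K$-torsor $\mathsf X=\operatorname{Spec}_\partial(B)$ for $\mathsf G$ there is a pair $(H',\lambda)$ of a $\partial$-$K$-Hopf algebra $H'$ and a left $H'$-comodule $\partial$-$K$-algebra structure $\lambda:B\to H'\otimes_KB$ which commutes with $\rho$, that is $(\lambda\otimes\mathrm{id})\rho=(\mathrm{id}\otimes\rho)\lambda$, and is left $H'$-Galois, that is, $B\otimes_KB\to H'\otimes_KB$, $b\otimes c\mapsto\lambda(b)(1\otimes c)$, is bijective. For every such pair, put $\mathsf G^{\mathsf X}=\operatorname{Spec}_\partial(H')$ and $\mathfrak g^{\mathsf X}=\operatorname{Lie}(\mathsf G^{\mathsf X})$; then $\mathfrak g^{\mathsf X}$ is a twisted form of $\mathfrak g$ and, under the two bijections, $\mathsf{Ad}_*$ sends the isomorphism class of $\mathsf X$ to the isomorphism class of $\mathfrak g^{\mathsf X}$: $$\mathsf{Ad}_*([\mathsf X])=[\mathfrak g^{\mathsf X}].$$ -/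

import Mathlib

open scoped TensorProduct Differential
open WithConv

universe u

noncomputable section

namespace DiffForms

/-! ### Differential modules, algebras, and their tensor products -/

/-- A `∂`-`R`-module: an `R`-module with an additive operator satisfying the Leibniz rule. -/
class DiffModule (R M : Type*) [CommRing R] [Differential R] [AddCommGroup M] [Module R M] where
  /-- the operator `∂` -/
  del : M →+ M
  /-- the Leibniz rule -/
  del_smul : ∀ (r : R) (m : M), del (r • m) = r′ • m + r • del m

/-- A `∂`-`R`-Lie algebra. -/
class DiffLieAlgebra (R L : Type*) [CommRing R] [Differential R] [LieRing L] [LieAlgebra R L]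
    extends DiffModule R L where
  /-- `∂` is a derivation for the bracket -/
  del_lie : ∀ x y : L, del ⁅x, y⁆ = ⁅del x, y⁆ + ⁅x, del y⁆

section Tensor

variable {K : Type*} [CommRing K] [Differential K]

/-- The operator `∂ (m ⊗ n) = ∂ m ⊗ n + m ⊗ ∂ n` on a tensor product over a `∂`-ring. -/
def tensorDel {M N : Type*} [AddCommGroup M] [Module K M] [AddCommGroup N] [Module K N]
    (d₁ : M →+ M) (d₂ : N →+ N) (h₁ : ∀ (k : K) (m : M), d₁ (k • m) = k′ • m + k • d₁ m)
    (h₂ : ∀ (k : K) (n : N), d₂ (k • n) = k′ • n + k • d₂ n) :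
    M ⊗[K] N →+ M ⊗[K] N :=
  TensorProduct.liftAddHom
    (AddMonoidHom.mk' (fun m => AddMonoidHom.mk' (fun n => d₁ m ⊗ₜ[K] n + m ⊗ₜ[K] d₂ n)
        (fun a b => by simp only [map_add, TensorProduct.tmul_add]; abel))
      (fun a b => by
        ext n
        simp only [map_add, TensorProduct.add_tmul, AddMonoidHom.mk'_apply,
          AddMonoidHom.add_apply]
        abel))
    (fun k m n => by
      simp only [AddMonoidHom.mk'_apply, h₁, h₂, TensorProduct.add_tmul, TensorProduct.tmul_add,
        TensorProduct.smul_tmul]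
      abel)

@[simp]
theorem tensorDel_tmul {M N : Type*} [AddCommGroup M] [Module K M] [AddCommGroup N] [Module K N]
    (d₁ : M →+ M) (d₂ : N →+ N) (h₁ : ∀ (k : K) (m : M), d₁ (k • m) = k′ • m + k • d₁ m)
    (h₂ : ∀ (k : K) (n : N), d₂ (k • n) = k′ • n + k • d₂ n) (m : M) (n : N) :
    tensorDel d₁ d₂ h₁ h₂ (m ⊗ₜ[K] n) = d₁ m ⊗ₜ[K] n + m ⊗ₜ[K] d₂ n := rfl

/-- The derivation of a `∂`-ring, as an additive map. -/
def derivAdd (A : Type*) [CommRing A] [Differential A] : A →+ A :=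
  (Differential.deriv : Derivation ℤ A A).toLinearMap.toAddMonoidHom

@[simp] theorem derivAdd_apply {A : Type*} [CommRing A] [Differential A] (a : A) :
    derivAdd A a = a′ := rfl

theorem derivAdd_smul {A : Type*} [CommRing A] [Differential A] [Algebra K A]
    [DifferentialAlgebra K A] (k : K) (a : A) :
    derivAdd A (k • a) = k′ • a + k • derivAdd A a := by
  simp only [derivAdd_apply, Algebra.smul_def k, Algebra.smul_def k′, Derivation.leibniz,
    smul_eq_mul, deriv_algebraMap]
  ring

variable {A : Type*} [CommRing A] [Differential A] [Algebra K A] [DifferentialAlgebra K A]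
  {B : Type*} [CommRing B] [Differential B] [Algebra K B] [DifferentialAlgebra K B]

/-- The tensor product of two `∂`-`K`-algebras is a `∂`-ring. -/
instance tensorDifferential : Differential (A ⊗[K] B) where
  deriv := Derivation.mk'
    (tensorDel (derivAdd A) (derivAdd B) derivAdd_smul derivAdd_smul).toIntLinearMap
    (fun x y => by
      simp only [AddMonoidHom.coe_toIntLinearMap, smul_eq_mul]
      induction x using TensorProduct.induction_on with
      | zero => simp
      | add x₁ x₂ h₁ h₂ => rw [add_mul, map_add, h₁, h₂, map_add]; ring
      | tmul a b =>
        induction y using TensorProduct.induction_on with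
        | zero => simp
        | add y₁ y₂ h₁ h₂ => rw [mul_add, map_add, h₁, h₂, map_add]; ring
        | tmul c d =>
          simp only [Algebra.TensorProduct.tmul_mul_tmul, tensorDel_tmul, derivAdd_apply,
            Derivation.leibniz, smul_eq_mul, TensorProduct.add_tmul, TensorProduct.tmul_add,
            mul_add]
          rw [mul_comm c a′, mul_comm d b′, mul_comm c a, mul_comm d b]
          abel)

theorem deriv_tmul (a : A) (b : B) :
    ((a ⊗ₜ[K] b : A ⊗[K] B))′ = a′ ⊗ₜ[K] b + a ⊗ₜ[K] b′ := rfl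

instance tensorDifferentialAlgebraLeft : DifferentialAlgebra A (A ⊗[K] B) where
  deriv_algebraMap a := by
    simp [Algebra.TensorProduct.algebraMap_apply, deriv_tmul]

instance tensorDifferentialAlgebra : DifferentialAlgebra K (A ⊗[K] B) where
  deriv_algebraMap k := by
    simp [Algebra.TensorProduct.algebraMap_apply, deriv_tmul, deriv_algebraMap]

/-- The base extension of a `∂`-`K`-module along a `∂`-`K`-algebra `A` is a `∂`-`A`-module. -/
instance tensorDiffModule {M : Type*} [AddCommGroup M] [Module K M] [DiffModule K M] :
    DiffModule A (A ⊗[K] M) where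
  del := tensorDel (derivAdd A) (DiffModule.del K) derivAdd_smul DiffModule.del_smul
  del_smul a x := by
    induction x using TensorProduct.induction_on with
    | zero => simp
    | add x₁ x₂ h₁ h₂ => rw [smul_add, map_add, h₁, h₂, map_add, smul_add, smul_add]; abel
    | tmul b m =>
      simp only [TensorProduct.smul_tmul', tensorDel_tmul, derivAdd_apply, smul_eq_mul,
        Derivation.leibniz, TensorProduct.add_tmul, smul_add]
      rw [mul_comm b a′]
      abel

theorem del_tmul {M : Type*} [AddCommGroup M] [Module K M] [DiffModule K M] (a : A) (m : M) :
    DiffModule.del A (a ⊗ₜ[K] m) = a′ ⊗ₜ[K] m + a ⊗ₜ[K] DiffModule.del K m := rfl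

/-- The base extension of a `∂`-`K`-Lie algebra along `A` is a `∂`-`A`-Lie algebra. -/
instance tensorDiffLieAlgebra {L : Type*} [LieRing L] [LieAlgebra K L] [DiffLieAlgebra K L] :
    DiffLieAlgebra A (A ⊗[K] L) where
  toDiffModule := tensorDiffModule
  del_lie x y := by
    induction x using TensorProduct.induction_on with
    | zero => simp
    | add x₁ x₂ h₁ h₂ => rw [add_lie, map_add, h₁, h₂, map_add, add_lie, add_lie]; abel
    | tmul a m =>
      induction y using TensorProduct.induction_on with
      | zero => simp
      | add x₁ x₂ h₁ h₂ => rw [lie_add, map_add, h₁, h₂, map_add, lie_add, lie_add]; abel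
      | tmul b n =>
        simp only [LieAlgebra.ExtendScalars.bracket_tmul, del_tmul, DiffLieAlgebra.del_lie,
          Derivation.leibniz, smul_eq_mul, TensorProduct.add_tmul, TensorProduct.tmul_add,
          add_lie, lie_add]
        rw [mul_comm b a′]
        abel

end Tensor

/-! ### Morphisms of `∂`-`K`-algebras -/

/-- A morphism of `∂`-`K`-algebras. -/
structure DAlgHom (K A B : Type*) [CommRing K] [CommRing A] [Differential A] [Algebra K A]
    [CommRing B] [Differential B] [Algebra K B] extends A →ₐ[K] B where
  /-- compatibility with `∂` -/
  map_deriv : ∀ a : A, toAlgHom a′ = (toAlgHom a)′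

namespace DAlgHom

section

variable {K A B C : Type*} [CommRing K] [CommRing A] [Differential A] [Algebra K A]
  [CommRing B] [Differential B] [Algebra K B] [CommRing C] [Differential C] [Algebra K C]

/-- The identity. -/
protected def id : DAlgHom K A A := ⟨AlgHom.id K A, fun _ => rfl⟩

/-- Composition. -/
def comp (g : DAlgHom K B C) (f : DAlgHom K A B) : DAlgHom K A C :=
  ⟨g.toAlgHom.comp f.toAlgHom, fun a => by simp [f.map_deriv, g.map_deriv]⟩

end

variable {K : Type*} [CommRing K] [Differential K]
  {A : Type*} [CommRing A] [Differential A] [Algebra K A] [DifferentialAlgebra K A]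
  {B : Type*} [CommRing B] [Differential B] [Algebra K B] [DifferentialAlgebra K B]
  {A' : Type*} [CommRing A'] [Differential A'] [Algebra K A'] [DifferentialAlgebra K A']
  {B' : Type*} [CommRing B'] [Differential B'] [Algebra K B'] [DifferentialAlgebra K B']

/-- `a ↦ a ⊗ 1`. -/
def inl (K A B : Type*) [CommRing K] [Differential K]
    [CommRing A] [Differential A] [Algebra K A] [DifferentialAlgebra K A]
    [CommRing B] [Differential B] [Algebra K B] [DifferentialAlgebra K B] :
    DAlgHom K A (A ⊗[K] B) :=
  ⟨Algebra.TensorProduct.includeLeft, fun a => by simp [deriv_tmul]⟩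

/-- `b ↦ 1 ⊗ b`. -/
def inr (K A B : Type*) [CommRing K] [Differential K]
    [CommRing A] [Differential A] [Algebra K A] [DifferentialAlgebra K A]
    [CommRing B] [Differential B] [Algebra K B] [DifferentialAlgebra K B] :
    DAlgHom K B (A ⊗[K] B) :=
  ⟨Algebra.TensorProduct.includeRight, fun a => by simp [deriv_tmul]⟩

/-- `a ⊗ b ↦ f a ⊗ g b`. -/
def tensor (f : DAlgHom K A A') (g : DAlgHom K B B') : DAlgHom K (A ⊗[K] B) (A' ⊗[K] B') :=
  ⟨Algebra.TensorProduct.map f.toAlgHom g.toAlgHom, fun x => by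
    induction x using TensorProduct.induction_on with
    | zero => simp
    | add x₁ x₂ h₁ h₂ => simp only [map_add, h₁, h₂]
    | tmul a b => simp [deriv_tmul, f.map_deriv, g.map_deriv]⟩

end DAlgHom

/-! ### Group-valued functors on `∂`-`K`-algebras and first Amitsur cohomology -/

/-- A functor from `∂`-`K`-algebras to groups. -/
structure DGroupFunctor (K : Type u) [CommRing K] [Differential K] where
  /-- the group of `T`-points -/
  obj : ∀ (T : Type u) [CommRing T] [Differential T] [Algebra K T] [DifferentialAlgebra K T],
    Type u
  /-- the group structure -/
  [group : ∀ (T : Type u) [CommRing T] [Differential T] [Algebra K T] [DifferentialAlgebra K T],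
    Group (obj T)]
  /-- functoriality -/
  map : ∀ {T T' : Type u} [CommRing T] [Differential T] [Algebra K T] [DifferentialAlgebra K T]
    [CommRing T'] [Differential T'] [Algebra K T'] [DifferentialAlgebra K T'],
    DAlgHom K T T' → (obj T →* obj T')
  map_id : ∀ (T : Type u) [CommRing T] [Differential T] [Algebra K T] [DifferentialAlgebra K T]
    (x : obj T), map DAlgHom.id x = x
  map_comp : ∀ {T T' T'' : Type u} [CommRing T] [Differential T] [Algebra K T]
    [DifferentialAlgebra K T] [CommRing T'] [Differential T'] [Algebra K T']
    [DifferentialAlgebra K T'] [CommRing T''] [Differential T''] [Algebra K T'']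
    [DifferentialAlgebra K T''] (g : DAlgHom K T' T'') (f : DAlgHom K T T') (x : obj T),
    map (g.comp f) x = map g (map f x)

attribute [instance] DGroupFunctor.group

/-- A morphism (natural transformation) of group-valued functors. -/
structure DGroupFunctor.Hom {K : Type u} [CommRing K] [Differential K]
    (F G : DGroupFunctor K) where
  /-- the component at `T` -/
  app : ∀ (T : Type u) [CommRing T] [Differential T] [Algebra K T] [DifferentialAlgebra K T],
    F.obj T →* G.obj T
  naturality : ∀ {T T' : Type u} [CommRing T] [Differential T] [Algebra K T]
    [DifferentialAlgebra K T] [CommRing T'] [Differential T'] [Algebra K T']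
    [DifferentialAlgebra K T'] (f : DAlgHom K T T') (x : F.obj T),
    app T' (F.map f x) = G.map f (app T x)

section Amitsur

variable {K : Type u} [CommRing K] [Differential K]
  (S : Type u) [CommRing S] [Differential S] [Algebra K S] [DifferentialAlgebra K S]

/-- Amitsur 1-cocycles of `S/K` with values in `F`: the elements `γ` of `F (S ⊗ S)` with
`e₁₃ γ = e₂₃ γ * e₁₂ γ` in `F (S ⊗ S ⊗ S)`, where `e₁₂ (x ⊗ y) = x ⊗ y ⊗ 1`,
`e₂₃ (x ⊗ y) = 1 ⊗ x ⊗ y` and `e₁₃ (x ⊗ y) = x ⊗ 1 ⊗ y`. -/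
def Cocycle (F : DGroupFunctor K) : Type u :=
  {γ : F.obj (S ⊗[K] S) //
    F.map (DAlgHom.tensor DAlgHom.id (DAlgHom.inr K S S)) γ =
      F.map (DAlgHom.inr K S (S ⊗[K] S)) γ *
        F.map (DAlgHom.tensor DAlgHom.id (DAlgHom.inl K S S)) γ}

/-- Two cocycles are cohomologous if `γ' = (d₁ x)⁻¹ * γ * d₂ x` for some `x` in `F S`, where `d₁`
and `d₂` are induced by `s ↦ 1 ⊗ s` and by `s ↦ s ⊗ 1`. -/
def cocycleSetoid (F : DGroupFunctor K) : Setoid (Cocycle S F) where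
  r γ γ' := ∃ x : F.obj S,
    γ'.1 = (F.map (DAlgHom.inr K S S) x)⁻¹ * γ.1 * F.map (DAlgHom.inl K S S) x
  iseqv :=
    { refl := fun γ => ⟨1, by simp⟩
      symm := by
        rintro γ γ' ⟨x, hx⟩
        exact ⟨x⁻¹, by rw [hx, map_inv, map_inv]; group⟩
      trans := by
        rintro γ γ' γ'' ⟨x, hx⟩ ⟨y, hy⟩
        exact ⟨x * y, by rw [hy, hx, map_mul, map_mul]; group⟩ }

/-- The first Amitsur cohomology set `H¹_∂(S/K, F)`. -/
def H1 (F : DGroupFunctor K) : Type u := Quotient (cocycleSetoid S F)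

variable {S} in
/-- The cohomology class of a cocycle. -/
def H1.mk {F : DGroupFunctor K} (γ : Cocycle S F) : H1 S F := Quotient.mk (cocycleSetoid S F) γ

/-- The map on cohomology sets induced by a morphism of group-valued functors. -/
def H1.map {F G : DGroupFunctor K} (α : F.Hom G) : H1 S F → H1 S G :=
  Quotient.map
    (fun γ => (⟨α.app _ γ.1, by
      rw [← α.naturality, ← α.naturality, ← α.naturality, γ.2, map_mul]⟩ : Cocycle S G))
    (by
      rintro γ γ' ⟨x, hx⟩
      refine ⟨α.app S x, ?_⟩
      change α.app _ γ'.1 = _ * α.app _ γ.1 * _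
      rw [hx, map_mul, map_mul, map_inv, α.naturality, α.naturality])

end Amitsur

/-! ### Base change of linear maps, and the automorphism functor of a `∂`-`K`-Lie algebra -/

section BaseChange

variable {K : Type*} [CommRing K]
  {T : Type*} [CommRing T] [Differential T] [Algebra K T]
  {T' : Type*} [CommRing T'] [Differential T'] [Algebra K T']
  {T'' : Type*} [CommRing T''] [Differential T''] [Algebra K T'']
  {M N P : Type*} [AddCommGroup M] [Module K M] [AddCommGroup N] [Module K N]
  [AddCommGroup P] [Module K P]

/-- The base extension `T' ⊗ M → T' ⊗ N` of a `T`-linear map `φ : T ⊗ M → T ⊗ N` along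
`f : T → T'`: the `T'`-linear map with `1 ⊗ m ↦ (f ⊗ id) (φ (1 ⊗ m))`. -/
def extendAlong (f : DAlgHom K T T') (φ : T ⊗[K] M →ₗ[T] T ⊗[K] N) :
    T' ⊗[K] M →ₗ[T'] T' ⊗[K] N :=
  LinearMap.liftBaseChange T'
    (f.toAlgHom.toLinearMap.rTensor N ∘ₗ φ.restrictScalars K ∘ₗ TensorProduct.mk K T M 1)

theorem extendAlong_tmul (f : DAlgHom K T T') (φ : T ⊗[K] M →ₗ[T] T ⊗[K] N) (t : T') (m : M) :
    extendAlong f φ (t ⊗ₜ[K] m) =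
      t • f.toAlgHom.toLinearMap.rTensor N (φ (1 ⊗ₜ[K] m)) := by
  simp [extendAlong]

theorem rTensor_smul (f : DAlgHom K T T') (t : T) (x : T ⊗[K] N) :
    f.toAlgHom.toLinearMap.rTensor N (t • x) =
      f.toAlgHom t • f.toAlgHom.toLinearMap.rTensor N x := by
  induction x using TensorProduct.induction_on with
  | zero => simp
  | add x y hx hy => rw [smul_add, map_add, hx, hy, map_add, smul_add]
  | tmul a n => simp [TensorProduct.smul_tmul']

theorem rTensor_comp (g : DAlgHom K T' T'') (f : DAlgHom K T T') (x : T ⊗[K] N) :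
    (g.comp f).toAlgHom.toLinearMap.rTensor N x =
      g.toAlgHom.toLinearMap.rTensor N (f.toAlgHom.toLinearMap.rTensor N x) := by
  rw [← LinearMap.comp_apply, ← LinearMap.rTensor_comp]
  rfl

theorem extendAlong_rTensor (f : DAlgHom K T T') (φ : T ⊗[K] M →ₗ[T] T ⊗[K] N)
    (z : T ⊗[K] M) :
    extendAlong f φ (f.toAlgHom.toLinearMap.rTensor M z) =
      f.toAlgHom.toLinearMap.rTensor N (φ z) := by
  induction z using TensorProduct.induction_on with
  | zero => simp
  | add x y hx hy => simp only [map_add, hx, hy]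
  | tmul a m =>
    rw [LinearMap.rTensor_tmul, extendAlong_tmul]
    have : a ⊗ₜ[K] m = a • (1 ⊗ₜ[K] m : T ⊗[K] M) := by simp [TensorProduct.smul_tmul']
    rw [this, map_smul, rTensor_smul]
    rfl

theorem extendAlong_unique (f : DAlgHom K T T') {ψ ψ' : T' ⊗[K] M →ₗ[T'] T' ⊗[K] N}
    (h : ∀ z : T ⊗[K] M, ψ (f.toAlgHom.toLinearMap.rTensor M z) =
      ψ' (f.toAlgHom.toLinearMap.rTensor M z)) : ψ = ψ' := by
  ext m
  simpa using h (1 ⊗ₜ m)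

theorem extendAlong_comp (f : DAlgHom K T T') (ψ : T ⊗[K] N →ₗ[T] T ⊗[K] P)
    (φ : T ⊗[K] M →ₗ[T] T ⊗[K] N) :
    extendAlong f (ψ ∘ₗ φ) = extendAlong f ψ ∘ₗ extendAlong f φ :=
  extendAlong_unique f fun z => by simp only [extendAlong_rTensor, LinearMap.comp_apply]

theorem extendAlong_id (f : DAlgHom K T T') :
    extendAlong f (LinearMap.id : T ⊗[K] M →ₗ[T] T ⊗[K] M) = LinearMap.id :=
  extendAlong_unique f fun z => by simp only [extendAlong_rTensor, LinearMap.id_apply]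

theorem extendAlong_refl (φ : T ⊗[K] M →ₗ[T] T ⊗[K] N) :
    extendAlong (DAlgHom.id : DAlgHom K T T) φ = φ :=
  extendAlong_unique DAlgHom.id fun z => by
    rw [extendAlong_rTensor]; simp [DAlgHom.id]

theorem extendAlong_trans (g : DAlgHom K T' T'') (f : DAlgHom K T T')
    (φ : T ⊗[K] M →ₗ[T] T ⊗[K] N) :
    extendAlong (g.comp f) φ = extendAlong g (extendAlong f φ) :=
  extendAlong_unique (g.comp f) fun z => by
    rw [extendAlong_rTensor, rTensor_comp g f z, extendAlong_rTensor, extendAlong_rTensor,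
      rTensor_comp]

/-- The base extension of a linear automorphism, as a group homomorphism. -/
def extendEquiv (f : DAlgHom K T T') :
    (T ⊗[K] M ≃ₗ[T] T ⊗[K] M) →* (T' ⊗[K] M ≃ₗ[T'] T' ⊗[K] M) where
  toFun e := LinearEquiv.ofLinearMap (extendAlong f e.toLinearMap) (extendAlong f e.symm.toLinearMap)
    (by rw [← extendAlong_comp]; simp [extendAlong_id])
    (by rw [← extendAlong_comp]; simp [extendAlong_id])
  map_one' := by
    apply LinearEquiv.toLinearMap_injective
    exact extendAlong_id f
  map_mul' e₁ e₂ := by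
    apply LinearEquiv.toLinearMap_injective
    exact extendAlong_comp f e₁.toLinearMap e₂.toLinearMap

theorem extendEquiv_toLinearMap (f : DAlgHom K T T') (e : T ⊗[K] M ≃ₗ[T] T ⊗[K] M) :
    (extendEquiv f e).toLinearMap = extendAlong f e.toLinearMap := rfl

section Lie

variable {L L' : Type*} [LieRing L] [LieAlgebra K L] [LieRing L'] [LieAlgebra K L']

theorem rTensor_lie (f : DAlgHom K T T') (x y : T ⊗[K] L) :
    f.toAlgHom.toLinearMap.rTensor L ⁅x, y⁆ =
      ⁅f.toAlgHom.toLinearMap.rTensor L x, f.toAlgHom.toLinearMap.rTensor L y⁆ := by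
  induction x using TensorProduct.induction_on with
  | zero => simp
  | add x x' hx hy => simp only [map_add, hx, hy, add_lie]
  | tmul a m =>
    induction y using TensorProduct.induction_on with
    | zero => simp
    | add x x' hx hy => simp only [map_add, hx, hy, lie_add]
    | tmul b n => simp

theorem extendAlong_lie (f : DAlgHom K T T') (φ : T ⊗[K] L →ₗ[T] T ⊗[K] L')
    (h : ∀ x y, φ ⁅x, y⁆ = ⁅φ x, φ y⁆) (x y : T' ⊗[K] L) :
    extendAlong f φ ⁅x, y⁆ = ⁅extendAlong f φ x, extendAlong f φ y⁆ := by
  induction x using TensorProduct.induction_on with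
  | zero => simp
  | add x x' hx hy => simp only [map_add, hx, hy, add_lie]
  | tmul a m =>
    induction y using TensorProduct.induction_on with
    | zero => simp
    | add x x' hx hy => simp only [map_add, hx, hy, lie_add]
    | tmul b n =>
      have h1 := h (1 ⊗ₜ[K] m) (1 ⊗ₜ[K] n)
      rw [LieAlgebra.ExtendScalars.bracket_tmul, one_mul] at h1
      rw [LieAlgebra.ExtendScalars.bracket_tmul, extendAlong_tmul, extendAlong_tmul,
        extendAlong_tmul, h1, rTensor_lie, smul_lie, lie_smul, smul_smul]

end Lie

end BaseChange

section Aut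

variable {K : Type*} [CommRing K] [Differential K]
  {T : Type*} [CommRing T] [Differential T] [Algebra K T] [DifferentialAlgebra K T]
  {T' : Type*} [CommRing T'] [Differential T'] [Algebra K T'] [DifferentialAlgebra K T']
  {M N : Type*} [AddCommGroup M] [Module K M] [DiffModule K M]
  [AddCommGroup N] [Module K N] [DiffModule K N]

theorem rTensor_del (f : DAlgHom K T T') (x : T ⊗[K] M) :
    f.toAlgHom.toLinearMap.rTensor M (DiffModule.del T x) =
      DiffModule.del T' (f.toAlgHom.toLinearMap.rTensor M x) := by
  induction x using TensorProduct.induction_on with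
  | zero => simp
  | add x y hx hy => simp only [map_add, hx, hy]
  | tmul a m => simp [del_tmul, f.map_deriv]

theorem extendAlong_del (f : DAlgHom K T T') (φ : T ⊗[K] M →ₗ[T] T ⊗[K] N)
    (h : ∀ x, φ (DiffModule.del T x) = DiffModule.del T (φ x)) (x : T' ⊗[K] M) :
    extendAlong f φ (DiffModule.del T' x) = DiffModule.del T' (extendAlong f φ x) := by
  induction x using TensorProduct.induction_on with
  | zero => simp
  | add x x' hx hy => simp only [map_add, hx, hy]
  | tmul a m =>
    have h1 := h (1 ⊗ₜ[K] m)
    rw [del_tmul] at h1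
    simp only [Derivation.map_one_eq_zero, TensorProduct.zero_tmul, zero_add] at h1
    rw [del_tmul, map_add, extendAlong_tmul, extendAlong_tmul, extendAlong_tmul, h1, rTensor_del,
      DiffModule.del_smul]

/-- `Aut_{∂-T}(T ⊗ L)`: the `T`-linear automorphisms of `T ⊗ L` preserving the bracket and
commuting with `∂`. -/
def lieAut (K L T : Type*) [CommRing K] [Differential K] [LieRing L] [LieAlgebra K L]
    [DiffLieAlgebra K L] [CommRing T] [Differential T] [Algebra K T] [DifferentialAlgebra K T] :
    Subgroup (T ⊗[K] L ≃ₗ[T] T ⊗[K] L) where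
  carrier := {e | (∀ x y, e ⁅x, y⁆ = ⁅e x, e y⁆) ∧
    ∀ x, e (DiffModule.del T x) = DiffModule.del T (e x)}
  one_mem' := ⟨fun _ _ => rfl, fun _ => rfl⟩
  mul_mem' := by
    rintro a b ⟨ha, ha'⟩ ⟨hb, hb'⟩
    exact ⟨fun x y => by simp only [LinearEquiv.mul_apply, ha, hb],
      fun x => by simp only [LinearEquiv.mul_apply, ha', hb']⟩
  inv_mem' := by
    rintro a ⟨ha, ha'⟩
    refine ⟨fun x y => a.injective ?_, fun x => a.injective ?_⟩
    · rw [ha]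
      change a (a.symm _) = ⁅a (a.symm x), a (a.symm y)⁆
      simp
    · rw [ha']
      change a (a.symm _) = DiffModule.del T (a (a.symm x))
      simp

end Aut

/-- The `∂`-automorphism-group functor `Aut_∂(L)` of a `∂`-`K`-Lie algebra `L`. -/
def autFunctor (K L : Type u) [CommRing K] [Differential K] [LieRing L] [LieAlgebra K L]
    [DiffLieAlgebra K L] : DGroupFunctor K where
  obj T := lieAut K L T
  map f :=
    { toFun := fun e => ⟨extendEquiv f e.1,
        extendAlong_lie f e.1.toLinearMap e.2.1, extendAlong_del f e.1.toLinearMap e.2.2⟩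
      map_one' := Subtype.ext (map_one (extendEquiv f))
      map_mul' := fun a b => Subtype.ext (map_mul (extendEquiv f) a.1 b.1) }
  map_id _ _ _ _ _ e := Subtype.ext (LinearEquiv.toLinearMap_injective
    (extendAlong_refl e.1.toLinearMap))
  map_comp g f e := Subtype.ext (LinearEquiv.toLinearMap_injective
    (extendAlong_trans g f e.1.toLinearMap))

/-! ### The convolution algebra, the Lie algebra of a Hopf algebra, and conjugation -/

section Conv

variable {K : Type*} [CommRing K]
  {H : Type*} [CommRing H] [HopfAlgebra K H]
  {T : Type*} [CommRing T] [Algebra K T]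

theorem conv_key {f g : WithConv (H →ₗ[K] T)}
    {ι : Type} [Fintype ι] {f₁ f₂ g₁ g₂ : ι → WithConv (H →ₗ[K] T)}
    (h : ∀ a b c d, f (a * b) * g (c * d) = ∑ i, f₁ i a * f₂ i b * (g₁ i c * g₂ i d)) (a b : H) :
    (f * g) (a * b) = ∑ i, (f₁ i * g₁ i) a * (f₂ i * g₂ i) b := by
  have key : ∀ x y : H ⊗[K] H,
      LinearMap.mul' K T (TensorProduct.map f.ofConv g.ofConv (x * y)) =
        ∑ i, LinearMap.mul' K T (TensorProduct.map (f₁ i).ofConv (g₁ i).ofConv x) *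
          LinearMap.mul' K T (TensorProduct.map (f₂ i).ofConv (g₂ i).ofConv y) := by
    intro x y
    induction x using TensorProduct.induction_on with
    | zero => simp
    | add x x' hx hx' => simp only [add_mul, map_add, hx, hx', Finset.sum_add_distrib]
    | tmul a c =>
      induction y using TensorProduct.induction_on with
      | zero => simp
      | add x x' hx hx' => simp only [mul_add, map_add, hx, hx', Finset.sum_add_distrib]
      | tmul b d =>
        simp only [Algebra.TensorProduct.tmul_mul_tmul, TensorProduct.map_tmul,
          LinearMap.mul'_apply, h]
        exact Finset.sum_congr rfl fun i _ => by ring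
  simp only [LinearMap.convMul_apply, Bialgebra.comul_mul]
  exact key _ _

theorem conv_derivation_mul {f p q : WithConv (H →ₗ[K] T)}
    (hf : ∀ a b, f (a * b) = f a * p b + p a * f b)
    (hq : ∀ a b, q (a * b) = q a * q b) (a b : H) :
    (f * q) (a * b) = (f * q) a * (p * q) b + (p * q) a * (f * q) b := by
  have := conv_key (f := f) (g := q) (f₁ := ![f, p]) (f₂ := ![p, f]) (g₁ := ![q, q])
    (g₂ := ![q, q]) (fun a b c d => by simp [Fin.sum_univ_two, hf, hq]; ring) a b
  simpa [Fin.sum_univ_two] using this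

theorem conv_mul_derivation {f p q : WithConv (H →ₗ[K] T)}
    (hf : ∀ a b, f (a * b) = f a * p b + p a * f b)
    (hq : ∀ a b, q (a * b) = q a * q b) (a b : H) :
    (q * f) (a * b) = (q * f) a * (q * p) b + (q * p) a * (q * f) b := by
  have := conv_key (f := q) (g := f) (f₁ := ![q, q]) (f₂ := ![q, q]) (g₁ := ![f, p])
    (g₂ := ![p, f]) (fun a b c d => by simp [Fin.sum_univ_two, hf, hq]; ring) a b
  simpa [Fin.sum_univ_two] using this

theorem conv_derivation_derivation {f g p : WithConv (H →ₗ[K] T)}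
    (hf : ∀ a b, f (a * b) = f a * p b + p a * f b)
    (hg : ∀ a b, g (a * b) = g a * p b + p a * g b) (a b : H) :
    (f * g) (a * b) = (f * g) a * (p * p) b + (f * p) a * (p * g) b +
      (p * g) a * (f * p) b + (p * p) a * (f * g) b := by
  have := conv_key (f := f) (g := g) (f₁ := ![f, f, p, p]) (f₂ := ![p, p, f, f])
    (g₁ := ![g, p, g, p]) (g₂ := ![p, g, p, g])
    (fun a b c d => by simp [Fin.sum_univ_four, hf, hg]; ring) a b
  simpa [Fin.sum_univ_four] using this

/-- The commutator bracket of the convolution algebra. -/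
instance convLieRing : LieRing (WithConv (H →ₗ[K] T)) := LieRing.ofAssociativeRing

theorem conv_lie (f g : WithConv (H →ₗ[K] T)) : ⁅f, g⁆ = f * g - g * f := rfl

instance convLieAlgebra : LieAlgebra T (WithConv (H →ₗ[K] T)) where
  lie_smul t f g := by rw [conv_lie, conv_lie, mul_smul_comm, smul_mul_assoc, smul_sub]

/-- The `T`-Lie algebra `Der_ε(H, T)` of `ε`-derivations of `H` with values in `T`, under the
commutator of the convolution product `(D * E) h = D h₍₁₎ * E h₍₂₎`. -/
def derLie (K H T : Type*) [CommRing K] [CommRing H] [HopfAlgebra K H] [CommRing T]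
    [Algebra K T] : LieSubalgebra T (WithConv (H →ₗ[K] T)) where
  carrier := {D | ∀ a b : H, D (a * b) = D a * algebraMap K T (Coalgebra.counit b) +
    algebraMap K T (Coalgebra.counit a) * D b}
  zero_mem' := fun a b => by simp
  add_mem' := by
    intro D E hD hE a b
    change D (a * b) + E (a * b) = (D a + E a) * _ + _ * (D b + E b)
    rw [hD, hE]
    ring
  smul_mem' := by
    intro t D hD a b
    change t * D (a * b) = (t * D a) * _ + _ * (t * D b)
    rw [hD]
    ring
  lie_mem' := by
    intro D E hD hE a b
    have h1 := conv_derivation_derivation (p := 1) hD hE a b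
    have h2 := conv_derivation_derivation (p := 1) hE hD a b
    simp only [mul_one, one_mul] at h1 h2
    change (D * E) (a * b) - (E * D) (a * b) = ((D * E) a - (E * D) a) * _ +
      _ * ((D * E) b - (E * D) b)
    rw [h1, h2]
    simp only [LinearMap.convOne_apply]
    ring

theorem mem_derLie {D : WithConv (H →ₗ[K] T)} : D ∈ derLie K H T ↔
    ∀ a b : H, D (a * b) = D a * algebraMap K T (Coalgebra.counit b) +
      algebraMap K T (Coalgebra.counit a) * D b := Iff.rfl

/-- The Lie algebra `Lie(G) = Der_ε(H, K)` of the affine `∂`-`K`-group `G` represented by `H`. -/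
def HopfLie (K H : Type*) [CommRing K] [CommRing H] [HopfAlgebra K H] : Type _ :=
  derLie K H K

instance (K H : Type*) [CommRing K] [CommRing H] [HopfAlgebra K H] : LieRing (HopfLie K H) :=
  inferInstanceAs (LieRing (derLie K H K))

instance (K H : Type*) [CommRing K] [CommRing H] [HopfAlgebra K H] : LieAlgebra K (HopfLie K H) :=
  inferInstanceAs (LieAlgebra K (derLie K H K))

/-- The value `D h` of an element `D` of `Lie(G)`. -/
def HopfLie.eval {K H : Type*} [CommRing K] [CommRing H] [HopfAlgebra K H] (h : H) :
    HopfLie K H →ₗ[K] K where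
  toFun D := (id D : derLie K H K).1 h
  map_add' _ _ := rfl
  map_smul' _ _ := rfl

/-! #### Algebra maps and conjugation -/

/-- Algebra maps from a commutative Hopf algebra to a commutative algebra form a group under
convolution; the inverse is composition with the antipode. -/
instance (priority := low) algHomConvGroup : Group (WithConv (H →ₐ[K] T)) where
  inv γ := toConv (γ.ofConv.comp (HopfAlgebra.antipodeAlgHom K H))
  inv_mul_cancel γ := by
    apply WithConv.ofConv_injective
    apply AlgHom.toLinearMap_injective
    apply WithConv.toConv_injective
    have h1 : toConv (γ.ofConv.comp (HopfAlgebra.antipodeAlgHom K H)).toLinearMap *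
        toConv γ.ofConv.toLinearMap =
        toConv (γ.ofConv.toLinearMap ∘ₗ (toConv (HopfAlgebra.antipode K (A := H)) *
          toConv LinearMap.id).ofConv) := by
      rw [LinearMap.algHom_comp_convMul_distrib]
      rfl
    rw [AlgHom.toLinearMap_convMul]
    refine h1.trans ?_
    rw [LinearMap.antipode_mul_id]
    ext h
    simp

/-- The inclusion of algebra maps in the convolution algebra of linear maps. -/
def toLin : WithConv (H →ₐ[K] T) →* WithConv (H →ₗ[K] T) where
  toFun γ := toConv γ.ofConv.toLinearMap
  map_one' := rfl
  map_mul' _ _ := rfl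

theorem toLin_apply (γ : WithConv (H →ₐ[K] T)) (h : H) : toLin γ h = γ h := rfl

theorem conj_mem (γ : WithConv (H →ₐ[K] T)) {D : WithConv (H →ₗ[K] T)} (hD : D ∈ derLie K H T) :
    toLin γ * D * toLin γ⁻¹ ∈ derLie K H T := by
  intro a b
  have h : ∀ (δ : WithConv (H →ₐ[K] T)) (a b : H),
      toLin δ (a * b) = toLin δ a * toLin δ b := fun δ a b => map_mul δ.ofConv a b
  have h1 := conv_mul_derivation (p := 1) (f := D) (q := toLin γ) hD (h γ)
  rw [mul_one] at h1
  have h2 := conv_derivation_mul (q := toLin γ⁻¹) h1 (h γ⁻¹) a b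
  rw [← map_mul, mul_inv_cancel, map_one] at h2
  exact h2

/-- The adjoint action `D ↦ γ * D * γ⁻¹` of an algebra map `γ : H → T` on `Der_ε(H, T)`, that is
`h ↦ γ h₍₁₎ * D h₍₂₎ * γ⁻¹ h₍₃₎`. -/
def conj (γ : WithConv (H →ₐ[K] T)) : derLie K H T →ₗ[T] derLie K H T where
  toFun D := ⟨toLin γ * D.1 * toLin γ⁻¹, conj_mem γ D.2⟩
  map_add' D E := Subtype.ext (by
    change _ * (D.1 + E.1) * _ = _ * D.1 * _ + _ * E.1 * _
    rw [mul_add, add_mul])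
  map_smul' t D := Subtype.ext (by
    change _ * (t • D.1) * _ = t • (_ * D.1 * _)
    rw [mul_smul_comm, smul_mul_assoc])

theorem conj_mul (γ γ' : WithConv (H →ₐ[K] T)) (D : derLie K H T) :
    conj (γ * γ') D = conj γ (conj γ' D) := Subtype.ext (by
  change toLin (γ * γ') * D.1 * toLin (γ * γ')⁻¹ =
    toLin γ * (toLin γ' * D.1 * toLin γ'⁻¹) * toLin γ⁻¹
  rw [mul_inv_rev, map_mul, map_mul]
  simp only [mul_assoc])

theorem conj_one (D : derLie K H T) : conj 1 D = D := Subtype.ext (by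
  change toLin 1 * D.1 * toLin 1⁻¹ = D.1
  rw [inv_one, map_one, one_mul, mul_one])

theorem conj_lie (γ : WithConv (H →ₐ[K] T)) (D E : derLie K H T) :
    conj γ ⁅D, E⁆ = ⁅conj γ D, conj γ E⁆ := Subtype.ext (by
  have h : toLin γ⁻¹ * toLin γ = 1 := by rw [← map_mul, inv_mul_cancel, map_one]
  have h' : ∀ D E : WithConv (H →ₗ[K] T), toLin γ * D * toLin γ⁻¹ * (toLin γ * E * toLin γ⁻¹) =
      toLin γ * (D * E) * toLin γ⁻¹ := by
    intro D E
    rw [mul_assoc (toLin γ * D), ← mul_assoc (toLin γ⁻¹), ← mul_assoc (toLin γ⁻¹), h, one_mul]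
    simp only [mul_assoc]
  change toLin γ * (D.1 * E.1 - E.1 * D.1) * toLin γ⁻¹ =
    toLin γ * D.1 * toLin γ⁻¹ * (toLin γ * E.1 * toLin γ⁻¹) -
      toLin γ * E.1 * toLin γ⁻¹ * (toLin γ * D.1 * toLin γ⁻¹)
  rw [h', h', mul_sub, sub_mul])

/-! #### Base change of the Lie algebra and the adjoint representation -/

instance convScalarTower : IsScalarTower K T (WithConv (H →ₗ[K] T)) where
  smul_assoc k t f := by
    ext h
    exact smul_assoc k t (f h)

/-- `D ↦ (h ↦ D h)`, from `Der_ε(H, K)` to `Der_ε(H, T)`. -/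
def derIncl (K H T : Type*) [CommRing K] [CommRing H] [HopfAlgebra K H] [CommRing T]
    [Algebra K T] : HopfLie K H →ₗ[K] derLie K H T where
  toFun D := ⟨toConv (Algebra.linearMap K T ∘ₗ D.1.ofConv), fun a b => by
    change algebraMap K T (D.1 (a * b)) = algebraMap K T (D.1 a) * _ + _ * algebraMap K T (D.1 b)
    rw [mem_derLie.1 D.2 a b]
    simp⟩
  map_add' D E := Subtype.ext (by ext h; exact map_add (algebraMap K T) (D.1 h) (E.1 h))
  map_smul' k D := Subtype.ext (by
    ext h
    exact (map_mul (algebraMap K T) k (D.1 h)).trans (Algebra.smul_def k _).symm)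

/-- The canonical map `T ⊗ Der_ε(H, K) → Der_ε(H, T)`, `t ⊗ D ↦ (h ↦ t * D h)`. -/
def derBaseChange (K H T : Type*) [CommRing K] [CommRing H] [HopfAlgebra K H] [CommRing T]
    [Algebra K T] : T ⊗[K] HopfLie K H →ₗ[T] derLie K H T :=
  LinearMap.liftBaseChange T (derIncl K H T)

theorem derBaseChange_tmul (t : T) (D : HopfLie K H) (h : H) :
    (derBaseChange K H T (t ⊗ₜ D)).1 h = t * algebraMap K T (HopfLie.eval h D) := by
  simp only [derBaseChange, LinearMap.liftBaseChange_tmul]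
  rfl

theorem derBaseChange_lie (x y : T ⊗[K] HopfLie K H) :
    derBaseChange K H T ⁅x, y⁆ = ⁅derBaseChange K H T x, derBaseChange K H T y⁆ := by
  induction x using TensorProduct.induction_on with
  | zero => simp
  | add x x' hx hx' => simp only [add_lie, map_add, hx, hx']
  | tmul a D =>
    induction y using TensorProduct.induction_on with
    | zero => simp
    | add x x' hx hx' => simp only [lie_add, map_add, hx, hx']
    | tmul b E =>
      have hI : derIncl K H T ⁅D, E⁆ = ⁅derIncl K H T D, derIncl K H T E⁆ := by
        apply Subtype.ext
        have hm : ∀ D E : WithConv (H →ₗ[K] K),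
            toConv (Algebra.linearMap K T ∘ₗ (D * E).ofConv) =
              toConv (Algebra.linearMap K T ∘ₗ D.ofConv) *
                toConv (Algebra.linearMap K T ∘ₗ E.ofConv) := fun D E =>
          WithConv.ofConv_injective (LinearMap.algHom_comp_convMul_distrib (Algebra.ofId K T) D E)
        change toConv (Algebra.linearMap K T ∘ₗ (D.1 * E.1 - E.1 * D.1).ofConv) =
          toConv (Algebra.linearMap K T ∘ₗ D.1.ofConv) *
            toConv (Algebra.linearMap K T ∘ₗ E.1.ofConv) -
          toConv (Algebra.linearMap K T ∘ₗ E.1.ofConv) *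
            toConv (Algebra.linearMap K T ∘ₗ D.1.ofConv)
        rw [← hm, ← hm, ofConv_sub, LinearMap.comp_sub, toConv_sub]
      rw [LieAlgebra.ExtendScalars.bracket_tmul]
      simp only [derBaseChange, LinearMap.liftBaseChange_tmul]
      rw [hI, smul_lie, lie_smul, smul_smul]

theorem derBaseChange_rTensor {T' : Type*} [CommRing T'] [Algebra K T'] [Differential T]
    [Differential T'] (f : DAlgHom K T T')
    (x : T ⊗[K] HopfLie K H) (h : H) :
    (derBaseChange K H T' (f.toAlgHom.toLinearMap.rTensor _ x)).1 h =
      f.toAlgHom ((derBaseChange K H T x).1 h) := by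
  induction x using TensorProduct.induction_on with
  | zero => simp
  | add x y hx hy =>
    rw [map_add, map_add, map_add]
    change (derBaseChange K H T' _).1 h + (derBaseChange K H T' _).1 h =
      f.toAlgHom ((derBaseChange K H T _).1 h + (derBaseChange K H T _).1 h)
    rw [hx, hy, map_add]
  | tmul a D =>
    rw [LinearMap.rTensor_tmul, derBaseChange_tmul, derBaseChange_tmul]
    simp

end Conv

section Adjoint

variable {K : Type*} [Field K]
  {H : Type*} [CommRing H] [HopfAlgebra K H]
  {T : Type*} [CommRing T] [Algebra K T]

theorem derLie_eq_zero {D : WithConv (H →ₗ[K] T)} (hD : D ∈ derLie K H T) {s : Set H}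
    (hs : Algebra.adjoin K s = ⊤) (h : ∀ a ∈ s, D a = 0) : D = 0 := by
  have h1 : D 1 = 0 := by
    have := mem_derLie.1 hD 1 1
    simpa using this
  ext a
  change D a = 0
  have ha : a ∈ Algebra.adjoin K s := hs ▸ Algebra.mem_top
  induction ha using Algebra.adjoin_induction with
  | mem x hx => exact h x hx
  | algebraMap r =>
    rw [Algebra.algebraMap_eq_smul_one]
    change D.ofConv _ = 0
    rw [map_smul]
    exact (congrArg (r • ·) h1).trans (smul_zero r)
  | add x y _ _ hx hy =>
    change D.ofConv _ = 0
    rw [map_add]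
    exact (congrArg₂ (· + ·) hx hy).trans (add_zero 0)
  | mul x y _ _ hx hy => rw [mem_derLie.1 hD, hx, hy]; simp

/-- If `H` is a finitely generated algebra, the canonical map `T ⊗ Der_ε(H, K) → Der_ε(H, T)` is
bijective. -/
theorem derBaseChange_bijective [Algebra.FiniteType K H] :
    Function.Bijective (derBaseChange K H T) := by
  classical
  obtain ⟨s, hs⟩ := (Algebra.FiniteType.out : (⊤ : Subalgebra K H).FG)
  let e := Module.Free.chooseBasis K T
  let ε := TensorProduct.equivFinsuppOfBasisLeft (N := HopfLie K H) e
  have hval : ∀ (c : Module.Free.ChooseBasisIndex K T →₀ HopfLie K H) (h : H),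
      (derBaseChange K H T (ε.symm c)).1 h =
        c.sum fun i D => algebraMap K T (HopfLie.eval h D) * e i := by
    intro c h
    induction c using Finsupp.induction_linear with
    | zero => simp
    | add f g hf hg =>
      rw [map_add, map_add]
      change (derBaseChange K H T _).1 h + (derBaseChange K H T _).1 h = _
      rw [hf, hg, Finsupp.sum_add_index']
      · simp
      · intro i D E
        rw [map_add, map_add, add_mul]
    | single i D =>
      rw [TensorProduct.equivFinsuppOfBasisLeft_symm_apply, Finsupp.sum_single_index,
        derBaseChange_tmul, Finsupp.sum_single_index, mul_comm]
      · simp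
      · simp
  constructor
  · rw [injective_iff_map_eq_zero]
    intro x hx
    obtain ⟨c, rfl⟩ := ε.symm.surjective x
    have hc : c = 0 := by
      ext i : 1
      apply Subtype.ext
      ext h
      have h1 := hval c h
      rw [hx] at h1
      have h2 : (c.sum fun i D => algebraMap K T (HopfLie.eval h D) * e i) =
          Finsupp.linearCombination K e (c.mapRange (HopfLie.eval h) (map_zero _)) := by
        rw [Finsupp.linearCombination_apply, Finsupp.sum_mapRange_index (fun _ => by simp)]
        simp [Algebra.smul_def]
      rw [h2] at h1
      have h3 := (linearIndependent_iff.1 e.linearIndependent) _ h1.symm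
      exact DFunLike.congr_fun h3 i
    rw [hc, map_zero]
  · intro D
    let Di : Module.Free.ChooseBasisIndex K T → HopfLie K H := fun i =>
      ⟨toConv (e.coord i ∘ₗ D.1.ofConv), fun a b => by
        change e.coord i (D.1 (a * b)) = e.coord i (D.1 a) * _ + _ * e.coord i (D.1 b)
        rw [mem_derLie.1 D.2, mul_comm (D.1 a), ← Algebra.smul_def, ← Algebra.smul_def, map_add,
          map_smul, map_smul]
        simp [mul_comm]⟩
    have hDi : ∀ i h, (Di i).1 h = e.repr (D.1 h) i := fun _ _ => rfl
    let S : Finset (Module.Free.ChooseBasisIndex K T) := s.biUnion fun a => (e.repr (D.1 a)).support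
    let c : Module.Free.ChooseBasisIndex K T →₀ HopfLie K H :=
      Finsupp.onFinset S Di (fun i hi => by
        by_contra hS
        apply hi
        apply Subtype.ext
        refine derLie_eq_zero (Di i).2 hs fun a ha => ?_
        rw [hDi]
        by_contra hne
        exact hS (Finset.mem_biUnion.2 ⟨a, ha, Finsupp.mem_support_iff.2 hne⟩))
    refine ⟨ε.symm c, Subtype.ext ?_⟩
    ext h
    refine (hval c h).trans ?_
    have h2 : (c.sum fun i D => algebraMap K T (HopfLie.eval h D) * e i) =
        Finsupp.linearCombination K e (c.mapRange (HopfLie.eval h) (map_zero _)) := by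
      rw [Finsupp.linearCombination_apply, Finsupp.sum_mapRange_index (fun _ => by simp)]
      simp [Algebra.smul_def]
    have h3 : c.mapRange (HopfLie.eval h) (map_zero _) = e.repr (D.1 h) := by
      ext i
      rfl
    rw [h2, h3]
    exact e.linearCombination_repr _

/-- The isomorphism `T ⊗ Lie(G) ≃ Der_ε(H, T)`. -/
def derEquiv (K H T : Type*) [Field K] [CommRing H] [HopfAlgebra K H] [CommRing T]
    [Algebra K T] [Algebra.FiniteType K H] : T ⊗[K] HopfLie K H ≃ₗ[T] derLie K H T :=
  LinearEquiv.ofBijective (derBaseChange K H T) derBaseChange_bijective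

variable [Algebra.FiniteType K H]

/-- `conj γ` as a linear automorphism of `Der_ε(H, T)`. -/
def conjEquiv (γ : WithConv (H →ₐ[K] T)) : derLie K H T ≃ₗ[T] derLie K H T :=
  LinearEquiv.ofLinearMap (conj γ) (conj γ⁻¹)
    (LinearMap.ext fun D => by
      rw [LinearMap.comp_apply, ← conj_mul, mul_inv_cancel, conj_one, LinearMap.id_apply])
    (LinearMap.ext fun D => by
      rw [LinearMap.comp_apply, ← conj_mul, inv_mul_cancel, conj_one, LinearMap.id_apply])

/-- The left adjoint action of `γ ∈ G(T)` on `T ⊗ Lie(G) = Der_ε(H, T)`. -/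
def adEquiv (γ : WithConv (H →ₐ[K] T)) : T ⊗[K] HopfLie K H ≃ₗ[T] T ⊗[K] HopfLie K H :=
  (derEquiv K H T).trans ((conjEquiv γ).trans (derEquiv K H T).symm)

theorem derBaseChange_adEquiv (γ : WithConv (H →ₐ[K] T)) (x : T ⊗[K] HopfLie K H) :
    derBaseChange K H T (adEquiv γ x) = conj γ (derBaseChange K H T x) :=
  (derEquiv K H T).apply_symm_apply _

end Adjoint

/-! ### Affine `∂`-`K`-groups, their Lie algebras, and the adjoint action -/

/-- A commutative `∂`-`K`-Hopf algebra: a Hopf algebra with a derivation extending that of `K`,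
such that all structure maps commute with `∂`. -/
class DiffHopfAlgebra (K H : Type*) [CommRing K] [Differential K] [CommRing H] [Differential H]
    [HopfAlgebra K H] : Prop extends DifferentialAlgebra K H where
  comul_deriv : ∀ h : H, Coalgebra.comul (R := K) (h′) = ((Coalgebra.comul (R := K) h)′)
  counit_deriv : ∀ h : H, Coalgebra.counit (R := K) (h′) = ((Coalgebra.counit (R := K) h)′)
  antipode_deriv : ∀ h : H, HopfAlgebra.antipode K (h′) = ((HopfAlgebra.antipode K h)′)

section Hopf

variable {K : Type*} [CommRing K] [Differential K]
  {H : Type*} [CommRing H] [Differential H] [HopfAlgebra K H] [DiffHopfAlgebra K H]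
  {T : Type*} [CommRing T] [Differential T] [Algebra K T] [DifferentialAlgebra K T]

section ConvDel

variable {C : Type*} [CommRing C] [Differential C] [Algebra K C] [DifferentialAlgebra K C]

/-- `f ↦ ∂ ∘ f - f ∘ ∂` on linear maps. -/
def linDel (f : C →ₗ[K] T) : C →ₗ[K] T where
  toFun h := (f h)′ - f (h′)
  map_add' a b := by simp only [map_add]; ring
  map_smul' k a := by
    have h1 : (k • a)′ = k′ • a + k • a′ := derivAdd_smul k a
    have h2 : (k • f a)′ = k′ • f a + k • (f a)′ := derivAdd_smul k (f a)
    rw [RingHom.id_apply, map_smul, h1, h2, map_add, map_smul, map_smul, smul_sub]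
    abel

theorem linDel_apply (f : C →ₗ[K] T) (h : C) : linDel f h = (f h)′ - f (h′) := rfl

end ConvDel

/-- The derivation `f ↦ ∂ ∘ f - f ∘ ∂` of the convolution algebra of linear maps `H → T`. -/
def convDel : WithConv (H →ₗ[K] T) →+ WithConv (H →ₗ[K] T) where
  toFun f := toConv (linDel f.ofConv)
  map_zero' := by ext; simp [linDel_apply]
  map_add' f g := by ext; simp [linDel_apply]; ring

theorem convDel_apply (f : WithConv (H →ₗ[K] T)) (h : H) :
    convDel f h = (f h)′ - f (h′) := rfl

theorem convDel_mul (f g : WithConv (H →ₗ[K] T)) :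
    convDel (f * g) = convDel f * g + f * convDel g := by
  have key : ∀ x : H ⊗[K] H,
      ((LinearMap.mul' K T (TensorProduct.map f.ofConv g.ofConv x))′) -
        LinearMap.mul' K T (TensorProduct.map f.ofConv g.ofConv (x′)) =
      LinearMap.mul' K T (TensorProduct.map (linDel f.ofConv) g.ofConv x) +
        LinearMap.mul' K T (TensorProduct.map f.ofConv (linDel g.ofConv) x) := by
    intro x
    induction x using TensorProduct.induction_on with
    | zero => simp
    | add x y hx hy =>
      simp only [map_add]
      linear_combination hx + hy
    | tmul a b =>
      simp only [deriv_tmul, map_add, TensorProduct.map_tmul, LinearMap.mul'_apply, linDel_apply,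
        Derivation.leibniz, smul_eq_mul]
      ring
  ext h
  have h1 : (f * g) (h′) = LinearMap.mul' K T (TensorProduct.map f.ofConv g.ofConv
      ((Coalgebra.comul (R := K) h)′)) := by
    rw [LinearMap.convMul_apply, DiffHopfAlgebra.comul_deriv]
  change ((f * g) h)′ - (f * g) (h′) = _
  rw [h1]
  exact key _

theorem convDel_smul (t : T) (f : WithConv (H →ₗ[K] T)) :
    convDel (t • f) = t′ • f + t • convDel f := by
  ext h
  change ((t * f h)′) - t * f (h′) = t′ * f h + t * ((f h)′ - f (h′))
  simp only [Derivation.leibniz, smul_eq_mul]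
  ring

theorem convDel_mem {D : WithConv (H →ₗ[K] T)} (hD : D ∈ derLie K H T) :
    convDel D ∈ derLie K H T := by
  intro a b
  have h1 : ∀ c : H, (algebraMap K T (Coalgebra.counit c))′ =
      algebraMap K T (Coalgebra.counit (c′)) := fun c => by
    rw [deriv_algebraMap, DiffHopfAlgebra.counit_deriv]
  rw [mem_derLie] at hD
  simp only [convDel_apply, hD, Derivation.leibniz, smul_eq_mul, map_add, h1]
  ring

/-- `Der_ε(H, T)` is a `∂`-`T`-Lie algebra under `(∂ D) h = ∂ (D h) - D (∂ h)`. -/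
instance derDiffLieAlgebra : DiffLieAlgebra T (derLie K H T) where
  del :=
    { toFun := fun D => ⟨convDel D.1, convDel_mem D.2⟩
      map_zero' := Subtype.ext (map_zero convDel)
      map_add' := fun D E => Subtype.ext (map_add convDel D.1 E.1) }
  del_smul t D := Subtype.ext (convDel_smul t D.1)
  del_lie D E := by
    apply Subtype.ext
    change convDel (D.1 * E.1 - E.1 * D.1) = (convDel D.1 * E.1 - E.1 * convDel D.1) +
      (D.1 * convDel E.1 - convDel E.1 * D.1)
    rw [map_sub, convDel_mul, convDel_mul]
    abel

/-! #### The group of points -/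

/-- The group `G(T)` of `∂`-`K`-algebra maps `H → T`, under convolution. -/
def points (K H T : Type*) [CommRing K] [Differential K] [CommRing H] [Differential H]
    [HopfAlgebra K H] [DiffHopfAlgebra K H] [CommRing T] [Differential T] [Algebra K T]
    [DifferentialAlgebra K T] : Subgroup (WithConv (H →ₐ[K] T)) where
  carrier := {γ | ∀ h : H, γ (h′) = (γ h)′}
  one_mem' h := by
    rw [AlgHom.convOne_apply, AlgHom.convOne_apply, DiffHopfAlgebra.counit_deriv, deriv_algebraMap]
  mul_mem' := by
    intro γ γ' h h' x
    have key : ∀ y : H ⊗[K] H,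
        Algebra.TensorProduct.lift γ.ofConv γ'.ofConv (fun _ _ => .all ..) (y′) =
          ((Algebra.TensorProduct.lift γ.ofConv γ'.ofConv (fun _ _ => .all ..) y)′) := by
      intro y
      induction y using TensorProduct.induction_on with
      | zero => simp
      | add x y hx hy => simp only [map_add, hx, hy]
      | tmul a b =>
        have h1 : γ.ofConv (a′) = ((γ.ofConv a)′) := h a
        have h2 : γ'.ofConv (b′) = ((γ'.ofConv b)′) := h' b
        simp only [deriv_tmul, map_add, Algebra.TensorProduct.lift_tmul, h1, h2,
          Derivation.leibniz, smul_eq_mul]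
        ring
    rw [AlgHom.convMul_apply, AlgHom.convMul_apply, DiffHopfAlgebra.comul_deriv]
    exact key _
  inv_mem' := by
    intro γ h x
    change γ (HopfAlgebra.antipode K (x′)) = ((γ (HopfAlgebra.antipode K x))′)
    rw [DiffHopfAlgebra.antipode_deriv]
    exact h _

theorem convDel_toLin {γ : WithConv (H →ₐ[K] T)} (hγ : γ ∈ points K H T) :
    convDel (toLin γ) = 0 := by
  ext h
  change ((γ h)′) - γ (h′) = 0
  rw [hγ h, sub_self]

theorem conj_del {γ : WithConv (H →ₐ[K] T)} (hγ : γ ∈ points K H T) (D : derLie K H T) :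
    conj γ (DiffModule.del T D) = DiffModule.del T (conj γ D) := Subtype.ext (by
  change toLin γ * convDel D.1 * toLin γ⁻¹ = convDel (toLin γ * D.1 * toLin γ⁻¹)
  rw [convDel_mul, convDel_mul, convDel_toLin hγ, convDel_toLin (inv_mem hγ), zero_mul, zero_add,
    mul_zero, add_zero])

instance : DiffLieAlgebra K (HopfLie K H) :=
  inferInstanceAs (DiffLieAlgebra K (derLie K H K))

theorem derBaseChange_del (x : T ⊗[K] HopfLie K H) :
    derBaseChange K H T (DiffModule.del T x) = DiffModule.del T (derBaseChange K H T x) := by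
  induction x using TensorProduct.induction_on with
  | zero => simp
  | add x y hx hy => simp only [map_add, hx, hy]
  | tmul a D =>
    apply Subtype.ext
    ext h
    rw [del_tmul, map_add]
    change (derBaseChange K H T _).1 h + (derBaseChange K H T _).1 h =
      ((derBaseChange K H T _).1 h)′ - (derBaseChange K H T _).1 (h′)
    rw [derBaseChange_tmul, derBaseChange_tmul, derBaseChange_tmul, derBaseChange_tmul]
    change _ + _ * algebraMap K T ((HopfLie.eval h D)′ - HopfLie.eval (h′) D) = _
    simp only [map_sub, Derivation.leibniz, deriv_algebraMap, smul_eq_mul]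
    ring

end Hopf

section Ad

variable {K : Type*} [Field K] [Differential K]
  {H : Type*} [CommRing H] [Differential H] [HopfAlgebra K H] [DiffHopfAlgebra K H]
  [Algebra.FiniteType K H]
  {T : Type*} [CommRing T] [Differential T] [Algebra K T] [DifferentialAlgebra K T]

theorem adEquiv_mem (γ : points K H T) : adEquiv γ.1 ∈ lieAut K (HopfLie K H) T := by
  constructor
  · intro x y
    apply (derBaseChange_bijective (K := K) (H := H) (T := T)).1
    rw [derBaseChange_adEquiv, derBaseChange_lie, derBaseChange_lie, derBaseChange_adEquiv,
      derBaseChange_adEquiv, conj_lie]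
  · intro x
    apply (derBaseChange_bijective (K := K) (H := H) (T := T)).1
    rw [derBaseChange_adEquiv, derBaseChange_del, derBaseChange_del, derBaseChange_adEquiv, conj_del γ.2]

/-- The adjoint representation `G(T) → Aut_{∂-T}(T ⊗ Lie(G))`. -/
def adHom (K H T : Type*) [Field K] [Differential K] [CommRing H] [Differential H]
    [HopfAlgebra K H] [DiffHopfAlgebra K H] [Algebra.FiniteType K H]
    [CommRing T] [Differential T] [Algebra K T] [DifferentialAlgebra K T] :
    points K H T →* lieAut K (HopfLie K H) T where
  toFun γ := ⟨adEquiv γ.1, adEquiv_mem γ⟩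
  map_one' := by
    apply Subtype.ext
    apply LinearEquiv.ext
    intro x
    apply (derBaseChange_bijective (K := K) (H := H) (T := T)).1
    change derBaseChange K H T (adEquiv 1 x) = derBaseChange K H T x
    rw [derBaseChange_adEquiv, conj_one]
  map_mul' γ γ' := by
    apply Subtype.ext
    apply LinearEquiv.ext
    intro x
    apply (derBaseChange_bijective (K := K) (H := H) (T := T)).1
    change derBaseChange K H T (adEquiv (γ.1 * γ'.1) x) =
      derBaseChange K H T (adEquiv γ.1 (adEquiv γ'.1 x))
    rw [derBaseChange_adEquiv, derBaseChange_adEquiv, derBaseChange_adEquiv, conj_mul]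

end Ad

/-- The affine `∂`-`K`-group `Spec_∂(H)`: the functor `T ↦ G(T)`. -/
def specFunctor (K H : Type u) [CommRing K] [Differential K] [CommRing H] [Differential H]
    [HopfAlgebra K H] [DiffHopfAlgebra K H] : DGroupFunctor K where
  obj T := points K H T
  map f :=
    { toFun := fun γ => ⟨toConv (f.toAlgHom.comp γ.1.ofConv), by
        intro h
        change f.toAlgHom (γ.1 (h′)) = ((f.toAlgHom (γ.1 h))′)
        rw [γ.2 h, f.map_deriv]⟩
      map_one' := Subtype.ext (by
        ext h
        exact f.toAlgHom.commutes _)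
      map_mul' := fun γ γ' => Subtype.ext (WithConv.ofConv_injective
        (AlgHom.comp_convMul_distrib f.toAlgHom γ.1 γ'.1)) }
  map_id _ _ _ _ _ _ := rfl
  map_comp _ _ _ := rfl

/-- The left adjoint action as a morphism `Ad : G → Aut_∂(Lie(G))` of group-valued functors. -/
def adNat (K H : Type u) [Field K] [Differential K] [CommRing H] [Differential H]
    [HopfAlgebra K H] [DiffHopfAlgebra K H] [Algebra.FiniteType K H] :
    (specFunctor K H).Hom (autFunctor K (HopfLie K H)) where
  app T := adHom K H T
  naturality {T T'} _ _ _ _ _ _ _ _ f γ := by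
    apply Subtype.ext
    apply LinearEquiv.toLinearMap_injective
    refine extendAlong_unique f fun z => ?_
    refine Eq.trans ?_ (extendAlong_rTensor f (adEquiv γ.1).toLinearMap z).symm
    apply (derBaseChange_bijective (K := K) (H := H) (T := T')).1
    change derBaseChange K H T' (adEquiv (toConv (f.toAlgHom.comp γ.1.ofConv)) _) =
      derBaseChange K H T' (f.toAlgHom.toLinearMap.rTensor _ (adEquiv γ.1 z))
    rw [derBaseChange_adEquiv]
    apply Subtype.ext
    apply WithConv.ofConv_injective
    ext h
    refine Eq.trans ?_ (derBaseChange_rTensor f (adEquiv γ.1 z) h).symm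
    rw [derBaseChange_adEquiv]
    have hz : (derBaseChange K H T' (f.toAlgHom.toLinearMap.rTensor _ z)).1 =
        toConv (f.toAlgHom.toLinearMap ∘ₗ (derBaseChange K H T z).1.ofConv) := by
      ext h
      exact derBaseChange_rTensor f z h
    have hc : ∀ a b : WithConv (H →ₗ[K] T),
        toConv (f.toAlgHom.toLinearMap ∘ₗ (a * b).ofConv) =
          toConv (f.toAlgHom.toLinearMap ∘ₗ a.ofConv) *
            toConv (f.toAlgHom.toLinearMap ∘ₗ b.ofConv) := fun a b =>
      WithConv.ofConv_injective (LinearMap.algHom_comp_convMul_distrib f.toAlgHom a b)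
    change (toLin (toConv (f.toAlgHom.comp γ.1.ofConv)) *
      (derBaseChange K H T' (f.toAlgHom.toLinearMap.rTensor _ z)).1 *
        toLin (toConv (f.toAlgHom.comp γ.1.ofConv))⁻¹) h =
      (toConv (f.toAlgHom.toLinearMap ∘ₗ
        (toLin γ.1 * (derBaseChange K H T z).1 * toLin γ.1⁻¹).ofConv)) h
    rw [hc, hc, hz]
    rfl

/-! ### Right torsors -/

/-- A right `H`-comodule `∂`-`K`-algebra, i.e. a right `G`-equivariant affine `∂`-`K`-scheme
`X = Spec_∂(B)` for `G = Spec_∂(H)`. -/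
structure RightComodule (K H : Type u) [CommRing K] [Differential K] [CommRing H] [Differential H]
    [HopfAlgebra K H] [DiffHopfAlgebra K H] where
  /-- the algebra `B` -/
  carrier : Type u
  [commRing : CommRing carrier]
  [differential : Differential carrier]
  [algebra : Algebra K carrier]
  [differentialAlgebra : DifferentialAlgebra K carrier]
  /-- the coaction `ρ : B → B ⊗ H` -/
  coact : carrier →ₐ[K] carrier ⊗[K] H
  coact_deriv : ∀ b : carrier, coact (b′) = ((coact b)′)
  coassoc : ∀ b : carrier, Algebra.TensorProduct.assoc K K K carrier H H
      (Algebra.TensorProduct.map coact (AlgHom.id K H) (coact b)) =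
    Algebra.TensorProduct.map (AlgHom.id K carrier) (Bialgebra.comulAlgHom K H) (coact b)
  counit : ∀ b : carrier, Algebra.TensorProduct.rid K K carrier
      (Algebra.TensorProduct.map (AlgHom.id K carrier) (Bialgebra.counitAlgHom K H) (coact b)) = b

attribute [instance] RightComodule.commRing RightComodule.differential RightComodule.algebra
  RightComodule.differentialAlgebra

section Torsor

variable {K H : Type u} [Field K] [Differential K] [CommRing H] [Differential H]
  [HopfAlgebra K H] [DiffHopfAlgebra K H]

variable (K H) in
/-- `H` itself, with its coproduct as right coaction. -/
def RightComodule.self : RightComodule K H where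
  carrier := H
  coact := Bialgebra.comulAlgHom K H
  coact_deriv := DiffHopfAlgebra.comul_deriv
  coassoc b := Coalgebra.coassoc_apply b
  counit b := by
    have := congrArg (TensorProduct.rid K H) (Coalgebra.lTensor_counit_comul (R := K) b)
    rw [TensorProduct.rid_tmul, one_smul] at this
    exact this

/-- The coaction `R ⊗ B → (R ⊗ B) ⊗ H` on a base extension `R ⊗ B`. -/
def RightComodule.extCoact (B : RightComodule K H) (R : Type u) [CommRing R] [Algebra K R] :
    R ⊗[K] B.carrier →ₐ[K] (R ⊗[K] B.carrier) ⊗[K] H :=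
  (Algebra.TensorProduct.assoc K K K R B.carrier H).symm.toAlgHom.comp
    (Algebra.TensorProduct.map (AlgHom.id K R) B.coact)

/-- `φ : R ⊗ B → R ⊗ B'` is an isomorphism of right `(R ⊗ H)`-comodule `∂`-`R`-algebras. -/
def IsComoduleIso {B B' : RightComodule K H} {R : Type u} [CommRing R] [Differential R]
    [Algebra K R] [DifferentialAlgebra K R]
    (φ : R ⊗[K] B.carrier ≃ₐ[R] R ⊗[K] B'.carrier) : Prop :=
  (∀ x, φ (x′) = ((φ x)′)) ∧
  ∀ x, B'.extCoact R (φ x) =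
    Algebra.TensorProduct.map (φ.toAlgHom.restrictScalars K) (AlgHom.id K H) (B.extCoact R x)

variable (K H) in
/-- A right `∂`-`K`-torsor for `G = Spec_∂(H)`: a twisted form of the right `G`-equivariant
`∂`-`K`-scheme `G`, i.e. a right `H`-comodule `∂`-`K`-algebra `B` with `R ⊗ B ≃ R ⊗ H` as right
`(R ⊗ H)`-comodule `∂`-`R`-algebras for some non-zero `∂`-`K`-algebra `R`. -/
structure RightTorsor extends RightComodule K H where
  isForm : ∃ (R : Type u) (_ : CommRing R) (_ : Differential R) (_ : Algebra K R)
    (_ : DifferentialAlgebra K R), Nontrivial R ∧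
      ∃ φ : R ⊗[K] carrier ≃ₐ[R] R ⊗[K] (RightComodule.self K H).carrier,
        IsComoduleIso (B := toRightComodule) φ

/-- Isomorphism of right `∂`-`K`-torsors. -/
def RightTorsor.IsIso (X Y : RightTorsor K H) : Prop :=
  ∃ φ : X.carrier ≃ₐ[K] Y.carrier, (∀ b, φ (b′) = ((φ b)′)) ∧
    ∀ b, Y.coact (φ b) = Algebra.TensorProduct.map φ.toAlgHom (AlgHom.id K H) (X.coact b)

variable (K H) in
/-- The isomorphism relation on right torsors. -/
def torsorSetoid : Setoid (RightTorsor K H) where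
  r := RightTorsor.IsIso
  iseqv :=
    { refl := fun X => ⟨AlgEquiv.refl, fun _ => rfl, fun b => by
        change X.coact b = Algebra.TensorProduct.map (AlgHom.id K X.carrier) (AlgHom.id K H) _
        rw [Algebra.TensorProduct.map_id]
        rfl⟩
      symm := by
        rintro X Y ⟨φ, h1, h2⟩
        refine ⟨φ.symm, fun b => φ.injective ?_, fun b => ?_⟩
        · rw [h1]; simp
        · obtain ⟨a, rfl⟩ := φ.surjective b
          rw [h2, ← AlgHom.comp_apply, ← Algebra.TensorProduct.map_comp]
          have : φ.symm.toAlgHom.comp φ.toAlgHom = AlgHom.id K X.carrier := by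
            ext x
            exact φ.symm_apply_apply x
          rw [this, AlgHom.comp_id, Algebra.TensorProduct.map_id, φ.symm_apply_apply]
          rfl
      trans := by
        rintro X Y Z ⟨φ, h1, h2⟩ ⟨ψ, k1, k2⟩
        refine ⟨φ.trans ψ, fun b => ?_, fun b => ?_⟩
        · rw [AlgEquiv.trans_apply, AlgEquiv.trans_apply, h1, k1]
        · rw [AlgEquiv.trans_apply, k2, h2, ← AlgHom.comp_apply,
            ← Algebra.TensorProduct.map_comp]
          rfl }

variable (K H) in
/-- The set of isomorphism classes of right `∂`-`K`-torsors for `Spec_∂(H)`. -/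
def TorsorClass : Type (u + 1) := Quotient (torsorSetoid K H)

/-- The isomorphism class of a torsor. -/
def TorsorClass.mk (X : RightTorsor K H) : TorsorClass K H := Quotient.mk (torsorSetoid K H) X

/-- The `T`-linear map `ℓ_γ : T ⊗ H → T ⊗ H`, `t ⊗ h ↦ t γ(h₍₁₎) ⊗ h₍₂₎`, for `γ ∈ G(T)`. It is
the comorphism of left multiplication by `γ` on `G_T`. -/
def leftMul {T : Type u} [CommRing T] [Differential T] [Algebra K T] [DifferentialAlgebra K T]
    (γ : points K H T) : T ⊗[K] H →ₗ[T] T ⊗[K] H :=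
  LinearMap.liftBaseChange T
    ((Algebra.TensorProduct.map γ.1.ofConv (AlgHom.id K H)).comp
      (Bialgebra.comulAlgHom K H)).toLinearMap

/-- The torsor `X = Spec_∂(B)` is given by the cocycle `γ ∈ G(S ⊗ S)`: for some trivialization
`φ : S ⊗ B ≃ S ⊗ H` over `S`, one has `d₂ φ = ℓ_γ ∘ d₁ φ`, where `d₁` and `d₂` are the base
extensions along `s ↦ 1 ⊗ s` and `s ↦ s ⊗ 1`. -/
def RightTorsor.IsGivenBy (X : RightTorsor K H) {S : Type u} [CommRing S] [Differential S]
    [Algebra K S] [DifferentialAlgebra K S] (γ : Cocycle S (specFunctor K H)) : Prop :=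
  ∃ φ : S ⊗[K] X.carrier ≃ₐ[S] S ⊗[K] (RightComodule.self K H).carrier,
    IsComoduleIso (B := X.toRightComodule) φ ∧
    extendAlong (DAlgHom.inl K S S) φ.toLinearMap =
      leftMul γ.1 ∘ₗ extendAlong (DAlgHom.inr K S S) φ.toLinearMap

/-! ### The left-acting group of a torsor -/

/-- For a right torsor `X = Spec_∂(B)`, a pair `(H', lam)` making `B` an `(H', H)`-bi-Galois
`∂`-`K`-algebra: a `∂`-`K`-Hopf algebra `H'` and a left `H'`-comodule `∂`-`K`-algebra structure
`lam : B → H' ⊗ B` which is left `H'`-Galois and commutes with the right coaction of `H`. Then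
`Spec_∂(H')` is the group `G^X`. -/
structure BiGalois (X : RightTorsor K H) where
  /-- the Hopf algebra `H'` -/
  carrier : Type u
  [commRing : CommRing carrier]
  [differential : Differential carrier]
  [hopfAlgebra : HopfAlgebra K carrier]
  [diffHopfAlgebra : DiffHopfAlgebra K carrier]
  /-- the coaction `lam : B → H' ⊗ B` -/
  lam : X.carrier →ₐ[K] carrier ⊗[K] X.carrier
  lam_deriv : ∀ b : X.carrier, lam (b′) = ((lam b)′)
  coassoc : ∀ b : X.carrier, Algebra.TensorProduct.assoc K K K carrier carrier X.carrier
      (Algebra.TensorProduct.map (Bialgebra.comulAlgHom K carrier) (AlgHom.id K X.carrier)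
        (lam b)) =
    Algebra.TensorProduct.map (AlgHom.id K carrier) lam (lam b)
  counit : ∀ b : X.carrier, Algebra.TensorProduct.lid K X.carrier
      (Algebra.TensorProduct.map (Bialgebra.counitAlgHom K carrier) (AlgHom.id K X.carrier)
        (lam b)) = b
  /-- `b ⊗ c ↦ lam(b) (1 ⊗ c)` is an isomorphism `B ⊗ B ≃ H' ⊗ B` -/
  galois : Function.Bijective
    (Algebra.TensorProduct.lift lam Algebra.TensorProduct.includeRight (fun _ _ => .all ..) :
      X.carrier ⊗[K] X.carrier →ₐ[K] carrier ⊗[K] X.carrier)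
  /-- `(lam ⊗ id) ∘ ρ = (id ⊗ ρ) ∘ lam` -/
  lam_coact : ∀ b : X.carrier, Algebra.TensorProduct.assoc K K K carrier X.carrier H
      (Algebra.TensorProduct.map lam (AlgHom.id K H) (X.coact b)) =
    Algebra.TensorProduct.map (AlgHom.id K carrier) X.coact (lam b)

attribute [instance] BiGalois.commRing BiGalois.differential BiGalois.hopfAlgebra
  BiGalois.diffHopfAlgebra

end Torsor

/-! ### Twisted forms of a `∂`-`K`-Lie algebra -/

section Forms

variable {K : Type u} [Field K] [Differential K]

/-- `Ψ : S ⊗ L → S ⊗ L'` is an isomorphism of `∂`-`S`-Lie algebras. -/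
def IsDiffLieIso {L L' S : Type u} [LieRing L] [LieAlgebra K L] [DiffLieAlgebra K L]
    [LieRing L'] [LieAlgebra K L'] [DiffLieAlgebra K L'] [CommRing S] [Differential S]
    [Algebra K S] [DifferentialAlgebra K S] (Ψ : S ⊗[K] L ≃ₗ[S] S ⊗[K] L') : Prop :=
  (∀ x y, Ψ ⁅x, y⁆ = ⁅Ψ x, Ψ y⁆) ∧ ∀ x, Ψ (DiffModule.del S x) = DiffModule.del S (Ψ x)

/-- `L'` is a twisted form of the `∂`-`K`-Lie algebra `L`: they become isomorphic over some
non-zero (hence faithfully flat, as `K` is a field) `∂`-`K`-algebra. -/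
def IsTwistedForm (K L L' : Type u) [Field K] [Differential K] [LieRing L] [LieAlgebra K L]
    [DiffLieAlgebra K L] [LieRing L'] [LieAlgebra K L'] [DiffLieAlgebra K L'] : Prop :=
  ∃ (S : Type u) (_ : CommRing S) (_ : Differential S) (_ : Algebra K S)
    (_ : DifferentialAlgebra K S), Nontrivial S ∧
      ∃ Ψ : S ⊗[K] L ≃ₗ[S] S ⊗[K] L', IsDiffLieIso Ψ

/-- A twisted form of the `∂`-`K`-Lie algebra `L`. -/
structure LieForm (K L : Type u) [Field K] [Differential K] [LieRing L] [LieAlgebra K L]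
    [DiffLieAlgebra K L] where
  /-- the underlying Lie algebra -/
  carrier : Type u
  [lieRing : LieRing carrier]
  [lieAlgebra : LieAlgebra K carrier]
  [diffLieAlgebra : DiffLieAlgebra K carrier]
  isForm : IsTwistedForm K L carrier

attribute [instance] LieForm.lieRing LieForm.lieAlgebra LieForm.diffLieAlgebra

variable {L : Type u} [LieRing L] [LieAlgebra K L] [DiffLieAlgebra K L]

/-- Isomorphism of `∂`-`K`-Lie algebras. -/
def LieForm.IsIso (F F' : LieForm K L) : Prop :=
  ∃ e : F.carrier ≃ₗ⁅K⁆ F'.carrier, ∀ x, e (DiffModule.del K x) = DiffModule.del K (e x)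

variable (K L) in
/-- The isomorphism relation on twisted forms. -/
def formSetoid : Setoid (LieForm K L) where
  r := LieForm.IsIso
  iseqv :=
    { refl := fun _ => ⟨LieEquiv.refl, fun _ => rfl⟩
      symm := by
        rintro F F' ⟨e, h⟩
        refine ⟨e.symm, fun x => ?_⟩
        rw [LieEquiv.symm_apply_eq, h, LieEquiv.apply_symm_apply]
      trans := by
        rintro F F' F'' ⟨e, h⟩ ⟨e', h'⟩
        exact ⟨e.trans e', fun x => by
          rw [LieEquiv.trans_apply, LieEquiv.trans_apply, h, h']⟩ }

variable (K L) in
/-- The set of isomorphism classes of twisted forms of `L`. -/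
def FormClass : Type (u + 1) := Quotient (formSetoid K L)

/-- The isomorphism class of a twisted form. -/
def FormClass.mk (F : LieForm K L) : FormClass K L := Quotient.mk (formSetoid K L) F

/-- The twisted form `F` of `L` is given by the cocycle `σ ∈ Aut_∂(L)(S ⊗ S)`: for some
isomorphism `Ψ : S ⊗ L ≃ S ⊗ F` of `∂`-`S`-Lie algebras, `d₂ Ψ = d₁ Ψ ∘ σ`. -/
def LieForm.IsGivenBy (F : LieForm K L) {S : Type u} [CommRing S] [Differential S]
    [Algebra K S] [DifferentialAlgebra K S] (σ : Cocycle S (autFunctor K L)) : Prop :=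
  ∃ Ψ : S ⊗[K] L ≃ₗ[S] S ⊗[K] F.carrier, IsDiffLieIso Ψ ∧
    extendAlong (DAlgHom.inl K S S) Ψ.toLinearMap =
      extendAlong (DAlgHom.inr K S S) Ψ.toLinearMap ∘ₗ LinearEquiv.toLinearMap σ.1.1

end Forms

/-! ### The extension `𝒰/K` -/

/-- The extension `L/K` of `∂`-fields is `∂`-finitely generated: `L` is the quotient field of the
`∂`-`K`-subalgebra generated by finitely many elements and their iterated derivatives. -/
def IsDiffFinGen (K L : Type u) [Field K] [Field L] [Differential L] [Algebra K L] : Prop :=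
  ∃ s : Finset L,
    IsFractionRing (Algebra.adjoin K {x : L | ∃ a ∈ s, ∃ r : ℕ, x = (fun y : L => y′)^[r] a}) L

/-- Every `∂`-finitely generated extension of `∂`-fields `L/K` embeds in `U/K`. -/
def IsDiffUniversal (K U : Type u) [Field K] [Differential K] [Field U] [Differential U]
    [Algebra K U] : Prop :=
  ∀ (L : Type u) [Field L] [Differential L] [Algebra K L] [DifferentialAlgebra K L],
    IsDiffFinGen K L → Nonempty (DAlgHom K L U)
end DiffForms
end

noncomputable section

namespace DiffForms

/-! ### Points of finitely generated `∂`-algebras in `∂`-fields -/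

/-! The argument is carried out on points. A point `x` of a torsor `X` over `T` has the orbit map `g
↦ x * g`, with comorphism `triv x`. For a torsor this is always an isomorphism, and every comodule
trivialization is of this kind (`IsComoduleIso.exists_point`). Hence `X` is given by the cocycle `γ`
exactly when `d₂ x = d₁ x * γ` for some `∂`-point `x` (`RightTorsor.isGivenBy_iff`).

If a second group `G^X` acts on `X` simply transitively from the left and commutes with `G`, a point
identifies the two groups by `c_x(g) * x = x * g`; the comorphism of `c_x` is `BiGalois.compare x`.
Transporting `ε`-derivations along it gives an isomorphism `lieIso x` from `T ⊗ 𝔤` to `T ⊗ 𝔤^X`.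
Translating the point changes it in a controlled way: `c_{xγ}(g) xγ = xγg = x(γgγ⁻¹)γ = c_x(γgγ⁻¹)
xγ`, so `lieIso (x * γ) = lieIso x ∘ Ad γ` (`BiGalois.transport_pmul`, `BiGalois.lieIso_pmul`). Put
`Ψ = lieIso x`. Since `lieIso` commutes with base extension, `d₂ Ψ = lieIso (d₂ x) = lieIso (d₁ x *
γ) = d₁ Ψ ∘ Ad γ`. This is the relation saying that `𝔤^X` is given by the cocycle `Ad γ`
(`BiGalois.isGivenBy`).

Three things support this computation. Points over `𝒰` exist because a finitely generated non-zero
`∂`-algebra in characteristic zero has a prime `∂`-ideal, and the fraction field of the quotient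
embeds in `𝒰` (`exists_diffPoint`); for Lie algebras the matrix entries of a trivialization generate
such an algebra (`IsTwistedForm.exists_finiteType`). The two bijections come from descent over a
field: isomorphisms descend by `exists_descent_equiv`, objects by `descent_bijective`. Finally `G^X`
exists as the automorphism group of the torsor, with coordinate ring the functions on `X × X`
invariant under the diagonal action of `G` (`RightTorsor.twist`); its Hopf structure is forced by
its faithful action on `X`. -/

open Finset in
/-- The general Leibniz rule. -/
theorem iterate_deriv_mul {A : Type*} [CommRing A] [Differential A] (n : ℕ) (a b : A) :
    (fun y : A => y′)^[n] (a * b) = ∑ ij ∈ antidiagonal n,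
      n.choose ij.1 • ((fun y : A => y′)^[ij.1] a * (fun y : A => y′)^[ij.2] b) := by
  induction n with
  | zero => simp
  | succ n ih =>
    rw [sum_antidiagonal_choose_succ_nsmul (M := A)
      (fun i j => (fun y : A => y′)^[i] a * (fun y : A => y′)^[j] b) n]
    simp only [Function.iterate_succ_apply', ih, map_sum, map_nsmul, Derivation.leibniz, smul_add,
      sum_add_distrib, smul_eq_mul]
    rw [add_right_inj]
    refine sum_congr rfl fun ⟨i, j⟩ hij => ?_
    rw [n.choose_symm_of_eq_add (mem_antidiagonal.1 hij).symm, mul_comm]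

theorem iterate_deriv_add {A : Type*} [CommRing A] [Differential A] (n : ℕ) (a b : A) :
    (fun y : A => y′)^[n] (a + b) = (fun y : A => y′)^[n] a + (fun y : A => y′)^[n] b :=
  iterate_map_add (derivAdd A) n a b

theorem iterate_deriv_zero {A : Type*} [CommRing A] [Differential A] (n : ℕ) :
    (fun y : A => y′)^[n] (0 : A) = 0 :=
  iterate_map_zero (derivAdd A) n

/-- The largest `∂`-ideal contained in an ideal `p`. -/
def diffCore {A : Type*} [CommRing A] [Differential A] (p : Ideal A) : Ideal A where
  carrier := {a | ∀ n : ℕ, (fun y : A => y′)^[n] a ∈ p}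
  zero_mem' n := by rw [iterate_deriv_zero]; exact p.zero_mem
  add_mem' ha hb n := by rw [iterate_deriv_add]; exact p.add_mem (ha n) (hb n)
  smul_mem' c a ha n := by
    rw [smul_eq_mul, iterate_deriv_mul]
    exact p.sum_mem fun ij _ => p.nsmul_mem (p.mul_mem_left _ (ha _)) _

theorem mem_diffCore {A : Type*} [CommRing A] [Differential A] {p : Ideal A} {a : A} :
    a ∈ diffCore p ↔ ∀ n : ℕ, (fun y : A => y′)^[n] a ∈ p := Iff.rfl

theorem deriv_mem_diffCore {A : Type*} [CommRing A] [Differential A] {p : Ideal A} {a : A}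
    (ha : a ∈ diffCore p) : a′ ∈ diffCore p := fun n => by
  rw [← Function.iterate_succ_apply (fun y : A => y′)]
  exact ha (n + 1)

/-- In characteristic zero the largest `∂`-ideal contained in a prime ideal is prime. -/
theorem diffCore_isPrime {A : Type*} [CommRing A] [Algebra ℚ A] [Differential A] (p : Ideal A)
    [hp : p.IsPrime] : (diffCore p).IsPrime := by
  classical
  refine ⟨fun h => hp.ne_top ((Ideal.eq_top_iff_one _).2
    ((Ideal.eq_top_iff_one _).1 h 0)), fun {a b} hab => ?_⟩
  by_contra hcon
  simp only [not_or, mem_diffCore, not_forall] at hcon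
  obtain ⟨ha, hb⟩ := hcon
  -- Let `m` and `n` be the least orders of derivatives of `a` and `b` outside `p`. In the Leibniz
  -- expansion of the derivative of `a * b` of order `m + n`, every term other than the one with
  -- orders `(m, n)` has a factor of smaller order, hence in `p`.
  have h := hab (Nat.find ha + Nat.find hb)
  rw [iterate_deriv_mul,
    ← Finset.add_sum_erase _ _ (Finset.HasAntidiagonal.mem_antidiagonal.2
    (rfl : (Nat.find ha, Nat.find hb).1 + (Nat.find ha, Nat.find hb).2 = _))] at h
  have h2 := (Ideal.add_mem_iff_left _ (p.sum_mem fun ij hij => p.nsmul_mem (by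
    obtain ⟨hne, hij⟩ := Finset.mem_erase.1 hij
    have hsum := Finset.HasAntidiagonal.mem_antidiagonal.1 hij
    rcases lt_trichotomy ij.1 (Nat.find ha) with h1 | h1 | h1
    · exact p.mul_mem_right _ (not_not.1 (Nat.find_min ha h1))
    · exact absurd (Prod.ext h1 (by simp only; omega)) hne
    · exact p.mul_mem_left _ (not_not.1 (Nat.find_min hb (by omega)))) _)).1 h
  rw [nsmul_eq_mul] at h2
  rcases hp.mem_or_mem h2 with h3 | h3
  -- Characteristic zero enters here: the binomial coefficient is invertible.
  · have hu : IsUnit (((Nat.find ha + Nat.find hb).choose (Nat.find ha) : ℕ) : A) := by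
      have : IsUnit ((((Nat.find ha + Nat.find hb).choose (Nat.find ha) : ℕ)) : ℚ) :=
        isUnit_iff_ne_zero.2 (Nat.cast_ne_zero.2
          (Nat.choose_pos (Nat.le_add_right _ _)).ne')
      simpa using this.map (algebraMap ℚ A)
    exact hp.ne_top (Ideal.eq_top_of_isUnit_mem _ h3 hu)
  · rcases hp.mem_or_mem h3 with h4 | h4
    · exact Nat.find_spec ha h4
    · exact Nat.find_spec hb h4

/-- The derivation induced on the quotient by a `∂`-ideal. -/
@[reducible]
def quotientDifferential {A : Type*} [CommRing A] [Differential A] (I : Ideal A)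
    (hI : ∀ a ∈ I, a′ ∈ I) : Differential (A ⧸ I) where
  deriv := Derivation.mk'
    (QuotientAddGroup.map I.toAddSubgroup I.toAddSubgroup (derivAdd A)
      (fun a ha => hI a ha) : (A ⧸ I) →+ (A ⧸ I)).toIntLinearMap
    (fun x y => by
      obtain ⟨a, rfl⟩ := Ideal.Quotient.mk_surjective x
      obtain ⟨b, rfl⟩ := Ideal.Quotient.mk_surjective y
      change Ideal.Quotient.mk I ((a * b)′) =
        Ideal.Quotient.mk I a * Ideal.Quotient.mk I (b′) +
          Ideal.Quotient.mk I b * Ideal.Quotient.mk I (a′)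
      simp [Derivation.leibniz])

/-- `a ↦ a + ε ∂ a`, from a domain to the dual numbers over its fraction field, extended to the
fraction field. -/
def fractionDual (A L : Type*) [CommRing A] [IsDomain A] [Differential A] [Field L] [Algebra A L]
    [IsFractionRing A L] : L →+* TrivSqZeroExt L L :=
  IsLocalization.lift (M := nonZeroDivisors A) (S := L)
    (g :=
      { toFun := fun a =>
          TrivSqZeroExt.inl (algebraMap A L a) + TrivSqZeroExt.inr (algebraMap A L a′)
        map_one' := by ext <;> simp
        map_zero' := by ext <;> simp
        map_mul' := fun a b => by
          ext <;> simp only [Derivation.leibniz, TrivSqZeroExt.fst_mul, TrivSqZeroExt.snd_mul,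
            TrivSqZeroExt.fst_add, TrivSqZeroExt.snd_add, TrivSqZeroExt.fst_inl,
            TrivSqZeroExt.fst_inr, TrivSqZeroExt.snd_inl, TrivSqZeroExt.snd_inr, map_mul, map_add,
            smul_eq_mul, op_smul_eq_mul] <;> ring
        map_add' := fun a b => by
          ext <;> simp only [TrivSqZeroExt.fst_add, TrivSqZeroExt.snd_add, TrivSqZeroExt.fst_inl,
            TrivSqZeroExt.fst_inr, TrivSqZeroExt.snd_inl, TrivSqZeroExt.snd_inr, map_add] <;> ring })
    (fun y => by
      rw [TrivSqZeroExt.isUnit_iff_isUnit_fst]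
      simp)

theorem fractionDual_algebraMap (A L : Type*) [CommRing A] [IsDomain A] [Differential A] [Field L]
    [Algebra A L] [IsFractionRing A L] (a : A) : fractionDual A L (algebraMap A L a) =
      TrivSqZeroExt.inl (algebraMap A L a) + TrivSqZeroExt.inr (algebraMap A L a′) :=
  IsLocalization.lift_eq _ _

/-- A ring map to the dual numbers has a derivation as second component once its first component is
the identity; this provides that condition for the extension to the fraction field. -/
theorem fst_fractionDual (A L : Type*) [CommRing A] [IsDomain A] [Differential A] [Field L]
    [Algebra A L] [IsFractionRing A L] (x : L) : (fractionDual A L x).fst = x := by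
  have : (TrivSqZeroExt.fstHom L L L).toRingHom.comp (fractionDual A L) = RingHom.id L :=
    IsLocalization.ringHom_ext (nonZeroDivisors A) (by
      ext a
      simp [fractionDual_algebraMap])
  exact congrArg (fun f => f x) this

/-- The derivation induced on the fraction field of a domain. -/
@[reducible]
def fractionDifferential (A L : Type*) [CommRing A] [IsDomain A] [Differential A] [Field L]
    [Algebra A L] [IsFractionRing A L] : Differential L where
  deriv := Derivation.mk'
    ((TrivSqZeroExt.sndHom L L).toAddMonoidHom.comp
      (fractionDual A L).toAddMonoidHom).toIntLinearMap
    (fun x y => by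
      change (fractionDual A L (x * y)).snd =
        x * (fractionDual A L y).snd + y * (fractionDual A L x).snd
      rw [map_mul, TrivSqZeroExt.snd_mul, fst_fractionDual, fst_fractionDual]
      simp [mul_comm])

theorem isFractionRing_subalgebra {K L : Type*} [Field K] [Field L] [Algebra K L]
    {A B : Subalgebra K L} (hAB : A ≤ B) [hA : IsFractionRing A L] : IsFractionRing B L := by
  refine IsFractionRing.of_field _ _ fun z => ?_
  obtain ⟨x, y, _, rfl⟩ := IsFractionRing.div_surjective A z
  exact ⟨⟨x, hAB x.2⟩, ⟨y, hAB y.2⟩, rfl⟩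

/-- A non-zero `∂`-`K`-algebra that is finitely generated as an algebra has a point in every
extension of `K` that contains all `∂`-finitely generated extensions. -/
theorem exists_diffPoint {K U : Type u} [Field K] [CharZero K] [Differential K]
    [Field U] [Differential U] [Algebra K U] (hU : IsDiffUniversal K U)
    (A : Type u) [CommRing A] [Differential A] [Algebra K A] [DifferentialAlgebra K A]
    [Nontrivial A] [Algebra.FiniteType K A] : Nonempty (DAlgHom K A U) := by
  -- The maximal ideal need not be stable under `∂`. Its differential core is, and it remains prime,
  -- which is enough for a fraction field.
  obtain ⟨m, hm⟩ := Ideal.exists_maximal A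
  let : Algebra ℚ A := ((algebraMap K A).comp (algebraMap ℚ K)).toAlgebra
  have hp : (diffCore m).IsPrime := diffCore_isPrime m
  let Q := A ⧸ diffCore m
  let : Differential Q := quotientDifferential _ fun _ => deriv_mem_diffCore
  let L := FractionRing Q
  let : Differential L := fractionDifferential Q L
  let π : A →ₐ[K] L := (IsScalarTower.toAlgHom K Q L).comp (Ideal.Quotient.mkₐ K _)
  have hπ : ∀ a, π (a′) = ((π a)′) := fun a => by
    change algebraMap Q L _ = (fractionDual Q L (algebraMap Q L _)).snd
    rw [fractionDual_algebraMap]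
    simp only [TrivSqZeroExt.snd_add, TrivSqZeroExt.snd_inl, TrivSqZeroExt.snd_inr, zero_add]
    rfl
  have : DifferentialAlgebra K L := ⟨fun k => by
    rw [← π.commutes, ← hπ, deriv_algebraMap, π.commutes]⟩
  obtain ⟨s, hs⟩ := (Algebra.FiniteType.out : (⊤ : Subalgebra K A).FG)
  have hfin : IsDiffFinGen K L := by
    classical
    refine ⟨s.image π, ?_⟩
    have h1 : π.range ≤ Algebra.adjoin K
        {x : L | ∃ a ∈ s.image π, ∃ r : ℕ, x = (fun y : L => y′)^[r] a} := by
      rw [← Algebra.map_top, ← hs, AlgHom.map_adjoin]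
      refine Algebra.adjoin_mono ?_
      rintro _ ⟨a, ha, rfl⟩
      -- Derivatives of order `0` suffice, since `s` already generates `A` as an algebra.
      exact ⟨π a, Finset.mem_image_of_mem _ ha, 0, rfl⟩
    have : IsFractionRing π.range L := by
      have : FaithfulSMul π.range L := inferInstance
      refine IsFractionRing.of_field _ _ fun z => ?_
      obtain ⟨x, y, _, rfl⟩ := IsFractionRing.div_surjective Q z
      obtain ⟨a, rfl⟩ := Ideal.Quotient.mk_surjective x
      obtain ⟨b, rfl⟩ := Ideal.Quotient.mk_surjective y
      exact ⟨⟨π a, a, rfl⟩, ⟨π b, b, rfl⟩, rfl⟩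
    exact isFractionRing_subalgebra h1
  obtain ⟨f⟩ := hU L hfin
  exact ⟨f.comp ⟨π, hπ⟩⟩

/-! ### Descent of modules along an extension of a field -/

section Descent

variable {K : Type*} [Field K]

/-- Over a field the line spanned by `1` is a direct summand. Such a retraction makes the descent of
elements explicit. -/
theorem exists_retraction (K A : Type*) [Field K] [Ring A] [Nontrivial A] [Algebra K A] :
    ∃ s : A →ₗ[K] K, s 1 = 1 := by
  obtain ⟨s, hs⟩ := (Algebra.linearMap K A).exists_leftInverse_of_injective
    (LinearMap.ker_eq_bot.2 (algebraMap K A).injective)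
  exact ⟨s, by simpa using LinearMap.congr_fun hs 1⟩

/-- The elements of `A ⊗ N` on which the two coface maps to `A ⊗ A ⊗ N` agree come from `N`. -/
theorem exists_eq_one_tmul {A N : Type*} [CommRing A] [Nontrivial A] [Algebra K A]
    [AddCommGroup N] [Module K N] (s : A →ₗ[K] K) (hs : s 1 = 1) (z : A ⊗[K] N)
    (hz : (Algebra.TensorProduct.includeLeft : A →ₐ[K] A ⊗[K] A).toLinearMap.rTensor N z =
      (Algebra.TensorProduct.includeRight : A →ₐ[K] A ⊗[K] A).toLinearMap.rTensor N z) :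
    z = 1 ⊗ₜ TensorProduct.lid K N (s.rTensor N z) := by
  -- Apply `s` to the second factor of `A ⊗ A`: the left coface becomes the identity, while the
  -- right coface becomes `1 ⊗ (s ⊗ id)`.
  have h := congrArg (((TensorProduct.rid K A).toLinearMap ∘ₗ s.lTensor A).rTensor N) hz
  have h1 : ∀ z : A ⊗[K] N, ((TensorProduct.rid K A).toLinearMap ∘ₗ s.lTensor A).rTensor N
      ((Algebra.TensorProduct.includeLeft : A →ₐ[K] A ⊗[K] A).toLinearMap.rTensor N z) = z := by
    intro z
    rw [← LinearMap.comp_apply, ← LinearMap.rTensor_comp]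
    convert LinearMap.id_apply (R := K) z
    convert LinearMap.rTensor_id N A
    ext a
    simp [hs]
  have h2 : ∀ z : A ⊗[K] N, ((TensorProduct.rid K A).toLinearMap ∘ₗ s.lTensor A).rTensor N
      ((Algebra.TensorProduct.includeRight : A →ₐ[K] A ⊗[K] A).toLinearMap.rTensor N z) =
        1 ⊗ₜ TensorProduct.lid K N (s.rTensor N z) := by
    intro z
    induction z using TensorProduct.induction_on with
    | zero => simp
    | add x y hx hy => simp only [map_add, hx, hy, TensorProduct.tmul_add]
    | tmul a n => simp [TensorProduct.smul_tmul]
  rw [h1, h2] at h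
  exact h

theorem one_tmul_injective {A N : Type*} [CommRing A] [Nontrivial A] [Algebra K A]
    [AddCommGroup N] [Module K N] : Function.Injective fun n : N => (1 : A) ⊗ₜ[K] n := by
  obtain ⟨s, hs⟩ := exists_retraction K A
  intro m n h
  have := congrArg (fun z => TensorProduct.lid K N (s.rTensor N z)) h
  simpa [hs] using this

/-- A linear map `A ⊗ M → A ⊗ N` whose two base extensions to `A ⊗ A` agree is defined
over `K`. -/
theorem exists_descent {A M N : Type*} [CommRing A] [Differential A] [Nontrivial A] [Algebra K A]
    [Differential K] [DifferentialAlgebra K A]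
    [AddCommGroup M] [Module K M] [AddCommGroup N] [Module K N] (Φ : A ⊗[K] M →ₗ[A] A ⊗[K] N)
    (h : extendAlong (DAlgHom.inl K A A) Φ = extendAlong (DAlgHom.inr K A A) Φ) :
    ∃ e : M →ₗ[K] N, ∀ m, Φ (1 ⊗ₜ m) = 1 ⊗ₜ e m := by
  obtain ⟨s, hs⟩ := exists_retraction K A
  refine ⟨(TensorProduct.lid K N).toLinearMap ∘ₗ s.rTensor N ∘ₗ Φ.restrictScalars K ∘ₗ
    TensorProduct.mk K A M 1, fun m => exists_eq_one_tmul s hs _ ?_⟩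
  have := LinearMap.congr_fun h (1 ⊗ₜ m)
  rw [extendAlong_tmul, extendAlong_tmul, one_smul, one_smul] at this
  exact this

/-- An isomorphism `A ⊗ M ≃ A ⊗ N` whose two base extensions to `A ⊗ A` agree is defined
over `K`. -/
theorem exists_descent_equiv {A M N : Type*} [CommRing A] [Differential A] [Nontrivial A]
    [Algebra K A] [Differential K] [DifferentialAlgebra K A]
    [AddCommGroup M] [Module K M] [AddCommGroup N] [Module K N] (Φ : A ⊗[K] M ≃ₗ[A] A ⊗[K] N)
    (h : extendAlong (DAlgHom.inl K A A) Φ.toLinearMap =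
      extendAlong (DAlgHom.inr K A A) Φ.toLinearMap) :
    ∃ e : M ≃ₗ[K] N, ∀ m, Φ (1 ⊗ₜ m) = 1 ⊗ₜ e m := by
  have hinv : ∀ f : DAlgHom K A (A ⊗[K] A),
      extendAlong f Φ.symm.toLinearMap ∘ₗ extendAlong f Φ.toLinearMap = LinearMap.id ∧
      extendAlong f Φ.toLinearMap ∘ₗ extendAlong f Φ.symm.toLinearMap = LinearMap.id := fun f => by
    constructor <;> · rw [← extendAlong_comp]; simp [extendAlong_id]
  obtain ⟨e, he⟩ := exists_descent Φ.toLinearMap h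
  obtain ⟨e', he'⟩ := exists_descent Φ.symm.toLinearMap (by
    calc _ = extendAlong (DAlgHom.inl K A A) Φ.symm.toLinearMap ∘ₗ
          (extendAlong (DAlgHom.inr K A A) Φ.toLinearMap ∘ₗ
            extendAlong (DAlgHom.inr K A A) Φ.symm.toLinearMap) := by
          rw [(hinv _).2, LinearMap.comp_id]
      _ = _ := by rw [← h, ← LinearMap.comp_assoc, (hinv _).1, LinearMap.id_comp])
  refine ⟨LinearEquiv.ofLinearMap e e' ?_ ?_, he⟩
  · ext n
    apply one_tmul_injective (K := K) (A := A)
    change 1 ⊗ₜ e (e' n) = _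
    rw [← he, ← he']
    exact Φ.apply_symm_apply _
  · ext n
    apply one_tmul_injective (K := K) (A := A)
    change 1 ⊗ₜ e' (e n) = _
    rw [← he', ← he]
    exact Φ.symm_apply_apply _

/-- Effectivity of descent: if `θ : N → A ⊗ N` is a descent datum on the `A`-module `N`, then
`A ⊗ N₀ ≃ N` for `N₀ = {n | θ n = 1 ⊗ n}`. -/
theorem descent_bijective {A N : Type*} [CommRing A] [Algebra K A] [AddCommGroup N] [Module K N]
    [Module A N] [IsScalarTower K A N] (θ : N →ₗ[A] A ⊗[K] N) (N₀ : Submodule K N)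
    (hN₀ : ∀ n, n ∈ N₀ ↔ θ n = 1 ⊗ₜ n)
    (h1 : ∀ n, (LinearMap.id : N →ₗ[K] N).liftBaseChange A (θ n) = n)
    (h2 : ∀ n, (θ.restrictScalars K).lTensor A (θ n) = (TensorProduct.mk K A N 1).lTensor A (θ n)) :
    Function.Bijective (N₀.subtype.liftBaseChange A) := by
  have hker : N₀ = LinearMap.ker (θ.restrictScalars K - TensorProduct.mk K A N 1) := by
    ext n
    simp [hN₀, sub_eq_zero]
  -- `N₀` is the kernel of `θ - 1 ⊗ ·`, and flatness keeps it a kernel after tensoring with `A`.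
  have hex : Function.Exact (N₀.subtype.lTensor A)
      ((θ.restrictScalars K - TensorProduct.mk K A N 1).lTensor A) := by
    apply Module.Flat.lTensor_exact
    rw [LinearMap.exact_iff, Submodule.range_subtype, hker]
  have hinj : Function.Injective (N₀.subtype.lTensor A) :=
    Module.Flat.lTensor_preserves_injective_linearMap _ N₀.injective_subtype
  -- Following the map with `θ` gives the inclusion of `A ⊗ N₀` in `A ⊗ N`, whence injectivity.
  have hθ : ∀ z : A ⊗[K] N₀, θ (N₀.subtype.liftBaseChange A z) = N₀.subtype.lTensor A z := by
    intro z
    induction z using TensorProduct.induction_on with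
    | zero => simp
    | add x y hx hy => simp only [map_add, hx, hy]
    | tmul a n =>
      rw [LinearMap.liftBaseChange_tmul, map_smul, Submodule.subtype_apply, (hN₀ _).1 n.2]
      simp [TensorProduct.smul_tmul']
  constructor
  · intro x y hxy
    apply hinj
    rw [← hθ, ← hθ, hxy]
  · intro n
    -- By `h2` the element `θ n` lies in the kernel, so it comes from `A ⊗ N₀`; by `h1` its image in
    -- `N` is `n`.
    obtain ⟨z, hz⟩ := (hex (θ n)).1 (by
      rw [LinearMap.lTensor_sub, LinearMap.sub_apply, h2, sub_self])
    refine ⟨z, ?_⟩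
    have : N₀.subtype.liftBaseChange A z =
        (LinearMap.id : N →ₗ[K] N).liftBaseChange A (N₀.subtype.lTensor A z) := by
      clear hz
      induction z using TensorProduct.induction_on with
      | zero => simp
      | add x y hx hy => simp only [map_add, hx, hy]
      | tmul a n => simp
    rw [this, hz, h1]

end Descent

/-! ### Points of comodule algebras and torsors -/

section LiftAlg

variable {K T A B : Type*} [CommRing K] [CommRing T] [Algebra K T] [CommRing A] [Algebra K A]
  [Algebra T A] [IsScalarTower K T A] [CommRing B] [Algebra K B]

/-- The `T`-algebra map `T ⊗ B → A` with `t ⊗ b ↦ t • c b`. -/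
def liftAlg (T : Type*) [CommRing T] [Algebra K T] [Algebra T A] [IsScalarTower K T A]
    (c : B →ₐ[K] A) : T ⊗[K] B →ₐ[T] A :=
  Algebra.TensorProduct.lift (Algebra.ofId T A) c (fun _ _ => .all ..)

@[simp]
theorem liftAlg_tmul (c : B →ₐ[K] A) (t : T) (b : B) : liftAlg T c (t ⊗ₜ b) = t • c b := by
  simp [liftAlg, Algebra.smul_def, Algebra.ofId_apply]

theorem liftAlg_one_tmul (c : B →ₐ[K] A) (b : B) : liftAlg T c (1 ⊗ₜ b) = c b := by simp

theorem liftAlg_deriv [Differential K] [Differential T] [DifferentialAlgebra K T] [Differential A]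
    [DifferentialAlgebra T A] [Differential B] [DifferentialAlgebra K B] {c : B →ₐ[K] A}
    (hc : ∀ b, c (b′) = ((c b)′)) (x : T ⊗[K] B) : liftAlg T c (x′) = ((liftAlg T c x)′) := by
  induction x using TensorProduct.induction_on with
  | zero => simp
  | add x y hx hy => simp only [map_add, hx, hy]
  | tmul t b =>
    simp only [deriv_tmul, map_add, liftAlg_tmul, hc, Algebra.smul_def, Derivation.leibniz,
      deriv_algebraMap, Algebra.algebraMap_self, RingHom.id_apply]
    ring

end LiftAlg

theorem deriv_symm {K A B : Type*} [CommRing K] [CommRing A] [Differential A] [Algebra K A]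
    [CommRing B] [Differential B] [Algebra K B] {e : A ≃ₐ[K] B}
    (h : ∀ a, e (a′) = ((e a)′)) (b : B) : e.symm (b′) = ((e.symm b)′) :=
  e.injective (by rw [h, e.apply_symm_apply, e.apply_symm_apply])

section Points

variable {K H : Type u} [CommRing K] [Differential K] [CommRing H] [Differential H]
  [HopfAlgebra K H] [DiffHopfAlgebra K H] {X : RightComodule K H}
  {T T' : Type u} [CommRing T] [Algebra K T] [CommRing T'] [Algebra K T']

/-- The translate `x * g` of a point `x` of `X` by a point `g` of `G`. -/
def pmul (x : X.carrier →ₐ[K] T) (g : WithConv (H →ₐ[K] T)) : X.carrier →ₐ[K] T :=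
  (Algebra.TensorProduct.lift x g.ofConv (fun _ _ => .all ..)).comp X.coact

theorem comp_pmul (f : T →ₐ[K] T') (x : X.carrier →ₐ[K] T) (g : WithConv (H →ₐ[K] T)) :
    f.comp (pmul x g) = pmul (f.comp x) (toConv (f.comp g.ofConv)) := by
  unfold pmul
  rw [← AlgHom.comp_assoc]
  congr 1
  ext <;> simp

theorem pmul_one (x : X.carrier →ₐ[K] T) : pmul x 1 = x := by
  ext b
  have h := congrArg x (X.counit b)
  rw [← h]
  change ((Algebra.TensorProduct.lift x (1 : WithConv (H →ₐ[K] T)).ofConv (fun _ _ => .all ..)))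
    (X.coact b) = (x.comp ((Algebra.TensorProduct.rid K K X.carrier).toAlgHom.comp
      (Algebra.TensorProduct.map (AlgHom.id K X.carrier) (Bialgebra.counitAlgHom K H))))
      (X.coact b)
  congr 1
  ext h
  · simp
  · simp [Algebra.algebraMap_eq_smul_one]

theorem lift_conv_mul (x : X.carrier →ₐ[K] T) (g h : WithConv (H →ₐ[K] T)) :
    Algebra.TensorProduct.lift x (g * h).ofConv (fun _ _ => .all ..) =
      (Algebra.TensorProduct.lift x (Algebra.TensorProduct.lift g.ofConv h.ofConv
        (fun _ _ => .all ..)) (fun _ _ => .all ..)).comp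
      (Algebra.TensorProduct.map (AlgHom.id K X.carrier) (Bialgebra.comulAlgHom K H)) := by
  ext a
  · simp
  · simpa using AlgHom.convMul_apply g h a

/-- The coassociativity of the coaction, read on points. -/
theorem pmul_mul (x : X.carrier →ₐ[K] T) (g h : WithConv (H →ₐ[K] T)) :
    pmul x (g * h) = pmul (pmul x g) h := by
  ext b
  have hc := congrArg (Algebra.TensorProduct.lift x (Algebra.TensorProduct.lift g.ofConv h.ofConv
    (fun _ _ => .all ..)) (fun _ _ => .all ..)) (X.coassoc b)
  unfold pmul
  rw [lift_conv_mul]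
  refine hc.symm.trans ?_
  change ((Algebra.TensorProduct.lift x (Algebra.TensorProduct.lift g.ofConv h.ofConv
    (fun _ _ => .all ..)) (fun _ _ => .all ..)).comp
    ((Algebra.TensorProduct.assoc K K K X.carrier H H).toAlgHom.comp
      (Algebra.TensorProduct.map X.coact (AlgHom.id K H)))) (X.coact b) = _
  change _ = (Algebra.TensorProduct.lift ((Algebra.TensorProduct.lift x g.ofConv
    (fun _ _ => .all ..)).comp X.coact) h.ofConv (fun _ _ => .all ..)) (X.coact b)
  congr 1
  have key : (Algebra.TensorProduct.lift x (Algebra.TensorProduct.lift g.ofConv h.ofConv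
      (fun _ _ => .all ..)) (fun _ _ => .all ..)).comp
      (Algebra.TensorProduct.assoc K K K X.carrier H H).toAlgHom =
      Algebra.TensorProduct.lift (Algebra.TensorProduct.lift x g.ofConv
        (fun _ _ => .all ..)) h.ofConv (fun _ _ => .all ..) := by
    ext <;> simp [Algebra.TensorProduct.one_def]
  rw [← AlgHom.comp_assoc, key]
  ext <;> simp

theorem pmul_deriv [Differential T] [DifferentialAlgebra K T] {x : X.carrier →ₐ[K] T}
    (hx : ∀ b, x (b′) = ((x b)′)) (g : points K H T) (b : X.carrier) :
    pmul x g.1 (b′) = ((pmul x g.1 b)′) := by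
  have key : ∀ y : X.carrier ⊗[K] H,
      Algebra.TensorProduct.lift x g.1.ofConv (fun _ _ => .all ..) (y′) =
        ((Algebra.TensorProduct.lift x g.1.ofConv (fun _ _ => .all ..) y)′) := by
    intro y
    induction y using TensorProduct.induction_on with
    | zero => simp
    | add x y hx hy => simp only [map_add, hx, hy]
    | tmul a b =>
      have h2 : g.1.ofConv (b′) = ((g.1.ofConv b)′) := g.2 b
      simp only [deriv_tmul, map_add, Algebra.TensorProduct.lift_tmul, h2, hx,
        Derivation.leibniz, smul_eq_mul]
      ring
  unfold pmul
  rw [AlgHom.comp_apply, X.coact_deriv]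
  exact key _

/-- The trivialization `T ⊗ B → T ⊗ H`, `t ⊗ b ↦ t x(b₍₀₎) ⊗ b₍₁₎`, defined by a point `x` of
`X = Spec(B)` over `T`. -/
def triv (x : X.carrier →ₐ[K] T) : T ⊗[K] X.carrier →ₐ[T] T ⊗[K] H :=
  liftAlg T ((Algebra.TensorProduct.map x (AlgHom.id K H)).comp X.coact)

theorem triv_one_tmul (x : X.carrier →ₐ[K] T) (b : X.carrier) :
    triv x (1 ⊗ₜ b) = Algebra.TensorProduct.map x (AlgHom.id K H) (X.coact b) := by
  simp [triv]

/-- Expresses that `triv x` is the comorphism of the orbit map `g ↦ x * g` over `T`. -/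
theorem liftAlg_triv [Algebra T T'] [IsScalarTower K T T'] (x : X.carrier →ₐ[K] T)
    (g : WithConv (H →ₐ[K] T')) :
    (liftAlg T g.ofConv : T ⊗[K] H →ₐ[T] T').comp (triv x) =
      liftAlg T (pmul ((IsScalarTower.toAlgHom K T T').comp x) g) := by
  ext b
  simp only [AlgHom.comp_apply, AlgHom.coe_restrictScalars',
    Algebra.TensorProduct.includeRight_apply, triv_one_tmul]
  rw [liftAlg_one_tmul]
  have key : ((liftAlg T g.ofConv : T ⊗[K] H →ₐ[T] T').restrictScalars K).comp
      (Algebra.TensorProduct.map x (AlgHom.id K H)) =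
      Algebra.TensorProduct.lift ((IsScalarTower.toAlgHom K T T').comp x) g.ofConv
        (fun _ _ => .all ..) := by
    ext <;> simp [Algebra.smul_def]
  exact DFunLike.congr_fun key (X.coact b)

/-- The orbit map sends the identity to `x`, so a point can be recovered from its trivialization. -/
theorem counit_triv (x : X.carrier →ₐ[K] T) (b : X.carrier) :
    liftAlg T ((Algebra.ofId K T).comp (Bialgebra.counitAlgHom K H)) (triv x (1 ⊗ₜ b)) = x b := by
  have := congrArg (fun f => f (1 ⊗ₜ b)) (liftAlg_triv (T' := T) x 1)
  rw [pmul_one] at this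
  refine this.trans ?_
  rw [liftAlg_one_tmul]
  rfl

theorem triv_injective {x y : X.carrier →ₐ[K] T} (h : ∀ b, triv x (1 ⊗ₜ b) = triv y (1 ⊗ₜ b)) :
    x = y := by
  ext b
  rw [← counit_triv x, h, counit_triv]

/-- If the trivialization defined by `x` is surjective, the group acts freely on translates
of `x`. -/
theorem pmul_left_cancel [Algebra T T'] [IsScalarTower K T T'] {x : X.carrier →ₐ[K] T}
    (hx : Function.Surjective (triv x)) {g g' : WithConv (H →ₐ[K] T')}
    (h : pmul ((IsScalarTower.toAlgHom K T T').comp x) g =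
      pmul ((IsScalarTower.toAlgHom K T T').comp x) g') : g = g' := by
  apply WithConv.ofConv_injective
  have h1 := liftAlg_triv x g
  rw [h, ← liftAlg_triv] at h1
  ext a
  obtain ⟨z, hz⟩ := hx (1 ⊗ₜ a)
  have h2 := congrArg (fun f => f z) h1
  simpa [hz] using h2

theorem triv_deriv [Differential T] [DifferentialAlgebra K T] {x : X.carrier →ₐ[K] T}
    (hx : ∀ b, x (b′) = ((x b)′)) (z : T ⊗[K] X.carrier) : triv x (z′) = ((triv x z)′) := by
  refine liftAlg_deriv (fun b => ?_) z
  rw [AlgHom.comp_apply, AlgHom.comp_apply, X.coact_deriv]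
  exact (DAlgHom.tensor ⟨x, hx⟩ (DAlgHom.id : DAlgHom K H H)).map_deriv _

/-- The comodule algebra is Galois: `B ⊗ B → B ⊗ H`, `b ⊗ c ↦ b c₍₀₎ ⊗ c₍₁₎` is bijective. -/
def IsGalois (X : RightComodule K H) : Prop :=
  Function.Bijective (triv (AlgHom.id K X.carrier))

namespace IsGalois

variable (hX : IsGalois X)

/-- The Galois map as an isomorphism. -/
def equiv : X.carrier ⊗[K] X.carrier ≃ₐ[X.carrier] X.carrier ⊗[K] H :=
  AlgEquiv.ofBijective (triv (AlgHom.id K X.carrier)) hX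

theorem equiv_symm_triv (z : X.carrier ⊗[K] X.carrier) :
    hX.equiv.symm (triv (AlgHom.id K X.carrier) z) = z :=
  hX.equiv.symm_apply_apply z

theorem triv_equiv_symm (z : X.carrier ⊗[K] H) :
    triv (AlgHom.id K X.carrier) (hX.equiv.symm z) = z :=
  hX.equiv.apply_symm_apply z

theorem equiv_symm_tmul_one (b : X.carrier) : hX.equiv.symm (b ⊗ₜ 1) = b ⊗ₜ 1 := by
  have := hX.equiv.symm.commutes b
  simpa [Algebra.TensorProduct.algebraMap_apply] using this

/-- The point `x \ y` of the group, with `x * (x \ y) = y`. -/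
def div (x y : X.carrier →ₐ[K] T) : WithConv (H →ₐ[K] T) :=
  toConv ((Algebra.TensorProduct.lift x y (fun _ _ => .all ..)).comp
    ((hX.equiv.symm.toAlgHom.restrictScalars K).comp Algebra.TensorProduct.includeRight))

/-- The Galois map is the comorphism of `(x, g) ↦ (x, x * g)`; its inverse is then the comorphism of
`(x, y) ↦ (x, x \ y)`, as `lift_div` records. -/
theorem lift_triv_id (x : X.carrier →ₐ[K] T) (g : WithConv (H →ₐ[K] T)) :
    (Algebra.TensorProduct.lift x g.ofConv (fun _ _ => .all ..)).comp
      ((triv (AlgHom.id K X.carrier)).restrictScalars K) =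
      Algebra.TensorProduct.lift x (pmul x g) (fun _ _ => .all ..) := by
  ext b
  · simp [triv, Algebra.TensorProduct.one_def, TensorProduct.smul_tmul']
  · simp [triv_one_tmul, pmul]

theorem lift_div (x y : X.carrier →ₐ[K] T) :
    Algebra.TensorProduct.lift x (hX.div x y).ofConv (fun _ _ => .all ..) =
      (Algebra.TensorProduct.lift x y (fun _ _ => .all ..)).comp
        (hX.equiv.symm.toAlgHom.restrictScalars K) := by
  ext b
  · simp [hX.equiv_symm_tmul_one]
  · simp [div]

theorem pmul_div (x y : X.carrier →ₐ[K] T) : pmul x (hX.div x y) = y := by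
  have h := lift_triv_id x (hX.div x y)
  rw [lift_div] at h
  ext b
  have h1 := DFunLike.congr_fun h (1 ⊗ₜ b)
  simpa [hX.equiv_symm_triv] using h1.symm

include hX in
theorem pmul_cancel {x : X.carrier →ₐ[K] T} {g g' : WithConv (H →ₐ[K] T)}
    (h : pmul x g = pmul x g') : g = g' := by
  have h1 := lift_triv_id x g
  rw [h, ← lift_triv_id] at h1
  apply WithConv.ofConv_injective
  ext a
  obtain ⟨z, hz⟩ := hX.2 (1 ⊗ₜ a)
  simpa [hz] using DFunLike.congr_fun h1 z

theorem div_pmul (x : X.carrier →ₐ[K] T) (g : WithConv (H →ₐ[K] T)) :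
    hX.div x (pmul x g) = g :=
  hX.pmul_cancel (hX.pmul_div _ _)

theorem comp_div (f : T →ₐ[K] T') (x y : X.carrier →ₐ[K] T) :
    f.comp (hX.div x y).ofConv = (hX.div (f.comp x) (f.comp y)).ofConv := by
  have : toConv (f.comp (hX.div x y).ofConv) = hX.div (f.comp x) (f.comp y) := by
    apply hX.pmul_cancel (x := f.comp x)
    rw [← comp_pmul, pmul_div, pmul_div]
  rw [← this]

theorem div_mul_div (x y z : X.carrier →ₐ[K] T) :
    hX.div x y * hX.div y z = hX.div x z :=
  hX.pmul_cancel (x := x) (by rw [pmul_mul, pmul_div, pmul_div, pmul_div])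

theorem div_self (x : X.carrier →ₐ[K] T) : hX.div x x = 1 :=
  hX.pmul_cancel (x := x) (by rw [pmul_div, pmul_one])

/-- The Galois isomorphism commutes with `∂`, hence so does its inverse, from which the quotient `x
\ y` is built. -/
theorem div_mem_points [Differential T] [DifferentialAlgebra K T] {x y : X.carrier →ₐ[K] T}
    (hx : ∀ b, x (b′) = ((x b)′)) (hy : ∀ b, y (b′) = ((y b)′)) :
    hX.div x y ∈ points K H T := by
  intro h
  have h1 : (1 ⊗ₜ (h′) : X.carrier ⊗[K] H) = ((1 ⊗ₜ h)′) := by simp [deriv_tmul]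
  have h2 := deriv_symm (e := hX.equiv) (triv_deriv (fun _ => rfl)) (1 ⊗ₜ h)
  change (Algebra.TensorProduct.lift x y (fun _ _ => .all ..)) (hX.equiv.symm (1 ⊗ₜ (h′))) =
    (((Algebra.TensorProduct.lift x y (fun _ _ => .all ..)) (hX.equiv.symm (1 ⊗ₜ h)))′)
  rw [h1, h2]
  generalize hX.equiv.symm (1 ⊗ₜ h) = z
  induction z using TensorProduct.induction_on with
  | zero => simp
  | add x y hx hy => simp only [map_add, hx, hy]
  | tmul a b =>
    simp only [deriv_tmul, map_add, Algebra.TensorProduct.lift_tmul, hx, hy, Derivation.leibniz,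
      smul_eq_mul]
    ring

include hX in
/-- For a Galois comodule algebra, the trivialization defined by any point is bijective. -/
theorem triv_bijective (x : X.carrier →ₐ[K] T) : Function.Bijective (triv x) := by
  -- `triv x` is the base extension of the Galois map along `x : B → T`; the inverse constructed
  -- below is the base extension of the inverse.
  have h1 : ((triv x).restrictScalars K).comp
      (Algebra.TensorProduct.map x (AlgHom.id K X.carrier)) =
      (Algebra.TensorProduct.map x (AlgHom.id K H)).comp
        ((triv (AlgHom.id K X.carrier)).restrictScalars K) := by
    ext b
    · simp [triv, Algebra.TensorProduct.one_def, TensorProduct.smul_tmul']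
    · simp only [AlgHom.comp_apply, AlgHom.coe_restrictScalars',
        Algebra.TensorProduct.includeRight_apply, Algebra.TensorProduct.map_tmul, map_one,
        AlgHom.id_apply, triv_one_tmul]
      change _ = ((Algebra.TensorProduct.map x (AlgHom.id K H)).comp
        (Algebra.TensorProduct.map (AlgHom.id K X.carrier) (AlgHom.id K H))) _
      rw [Algebra.TensorProduct.map_id, AlgHom.comp_id]
  let inv : T ⊗[K] H →ₐ[T] T ⊗[K] X.carrier := liftAlg T
    ((Algebra.TensorProduct.map x (AlgHom.id K X.carrier)).comp
      ((hX.equiv.symm.toAlgHom.restrictScalars K).comp Algebra.TensorProduct.includeRight))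
  have h2 : (inv.restrictScalars K).comp (Algebra.TensorProduct.map x (AlgHom.id K H)) =
      (Algebra.TensorProduct.map x (AlgHom.id K X.carrier)).comp
        (hX.equiv.symm.toAlgHom.restrictScalars K) := by
    ext b
    · have := hX.equiv_symm_tmul_one b
      simp [inv, this, ← Algebra.TensorProduct.one_def]
      simp [Algebra.TensorProduct.one_def, TensorProduct.smul_tmul']
    · simp [inv]
  have h3 : (triv x).comp inv = AlgHom.id T _ := by
    ext h
    have := DFunLike.congr_fun h1 (hX.equiv.symm (1 ⊗ₜ h))
    simpa [inv, hX.triv_equiv_symm] using this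
  have h4 : inv.comp (triv x) = AlgHom.id T _ := by
    ext b
    have := DFunLike.congr_fun h2 (triv (AlgHom.id K X.carrier) (1 ⊗ₜ b))
    have h5 := DFunLike.congr_fun h1 (1 ⊗ₜ b)
    simp only [AlgHom.comp_apply, AlgHom.coe_restrictScalars', Algebra.TensorProduct.map_tmul,
      map_one, AlgHom.id_apply] at h5
    simp only [AlgHom.comp_apply, AlgHom.coe_restrictScalars',
      Algebra.TensorProduct.includeRight_apply, h5, AlgHom.id_apply]
    refine this.trans ?_
    change Algebra.TensorProduct.map x (AlgHom.id K X.carrier) (hX.equiv.symm _) = _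
    rw [hX.equiv_symm_triv]
    simp
  exact ⟨fun a b h => by
    rw [← AlgHom.id_apply (R := T) a, ← h4, AlgHom.comp_apply, h, ← AlgHom.comp_apply, h4]; rfl,
    fun b => ⟨inv b, DFunLike.congr_fun h3 b⟩⟩

end IsGalois

end Points

/-! ### Trivializations as points; torsors are Galois -/

section Trivialization

variable {K H : Type u} [Field K] [Differential K] [CommRing H] [Differential H]
  [HopfAlgebra K H] [DiffHopfAlgebra K H] {X : RightComodule K H}
  {R : Type u} [CommRing R] [Differential R] [Algebra K R] [DifferentialAlgebra K R]

theorem counit_deriv_liftAlg (z : R ⊗[K] H) :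
    liftAlg R ((Algebra.ofId K R).comp (Bialgebra.counitAlgHom K H)) (z′) =
      ((liftAlg R ((Algebra.ofId K R).comp (Bialgebra.counitAlgHom K H)) z)′) :=
  liftAlg_deriv (fun b => by
    change algebraMap K R (Coalgebra.counit (b′)) = ((algebraMap K R (Coalgebra.counit b))′)
    rw [DiffHopfAlgebra.counit_deriv, deriv_algebraMap]) z

omit [Differential R] [DifferentialAlgebra K R] in
-- The counit axiom over `R`. It implies that a colinear map into `R ⊗ H` is determined by its
-- composite with the counit.
theorem counit_extCoact_self (z : R ⊗[K] H) :
    Algebra.TensorProduct.map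
      ((liftAlg R ((Algebra.ofId K R).comp (Bialgebra.counitAlgHom K H))).restrictScalars K)
      (AlgHom.id K H) ((RightComodule.self K H).extCoact R z) = z := by
  let ε : R ⊗[K] H →ₐ[R] R := liftAlg R ((Algebra.ofId K R).comp (Bialgebra.counitAlgHom K H))
  have key : ((Algebra.TensorProduct.map (ε.restrictScalars K) (AlgHom.id K H)).comp
      (Algebra.TensorProduct.assoc K K K R H H).symm.toAlgHom).comp
        Algebra.TensorProduct.includeRight =
      Algebra.TensorProduct.map ((Algebra.ofId K R).comp (Bialgebra.counitAlgHom K H))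
        (AlgHom.id K H) := by
    ext <;> simp [ε]
  have key2 : ((Algebra.TensorProduct.map (ε.restrictScalars K) (AlgHom.id K H)).comp
      ((Algebra.TensorProduct.assoc K K K R H H).symm.toAlgHom.comp
        (Algebra.TensorProduct.map (AlgHom.id K R) (Bialgebra.comulAlgHom K H)))) =
      AlgHom.id K (R ⊗[K] H) := by
    ext h
    · simp [ε, Algebra.TensorProduct.one_def]
    · have h3 := DFunLike.congr_fun key (Coalgebra.comul (R := K) h)
      have h4 := congrArg (Algebra.TensorProduct.map (Algebra.ofId K R) (AlgHom.id K H))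
        (Coalgebra.rTensor_counit_comul (R := K) h)
      have h5 : ∀ w : H ⊗[K] H,
          Algebra.TensorProduct.map (Algebra.ofId K R) (AlgHom.id K H)
            ((Coalgebra.counit (R := K)).rTensor H w) =
          Algebra.TensorProduct.map ((Algebra.ofId K R).comp (Bialgebra.counitAlgHom K H))
            (AlgHom.id K H) w := by
        intro w
        induction w using TensorProduct.induction_on with
        | zero => simp
        | add x y hx hy => simp only [map_add, hx, hy]
        | tmul a b => simp
      rw [h5, ← h3] at h4
      simpa using h4
  exact DFunLike.congr_fun key2 z

/-- Comodule trivializations of `X` over `R` come from `∂`-points of `X` over `R`. -/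
theorem IsComoduleIso.exists_point
    {φ : R ⊗[K] X.carrier ≃ₐ[R] R ⊗[K] (RightComodule.self K H).carrier}
    (hφ : IsComoduleIso φ) :
    ∃ x : X.carrier →ₐ[K] R, (∀ b, x (b′) = ((x b)′)) ∧
      ∀ z, (φ z : R ⊗[K] H) = triv x z := by
  let ψ : R ⊗[K] X.carrier →ₐ[R] R ⊗[K] H := φ.toAlgHom
  let ε : R ⊗[K] H →ₐ[R] R := liftAlg R ((Algebra.ofId K R).comp (Bialgebra.counitAlgHom K H))
  -- The point is the value of the trivialization at the identity of the group.
  let x : X.carrier →ₐ[K] R :=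
    ((ε.comp ψ).restrictScalars K).comp Algebra.TensorProduct.includeRight
  have h1 := counit_extCoact_self (K := K) (H := H) (R := R)
  refine ⟨x, fun b => ?_, ?_⟩
  · change ε (φ (1 ⊗ₜ (b′))) = ((ε (φ (1 ⊗ₜ b)))′)
    have : (1 ⊗ₜ (b′) : R ⊗[K] X.carrier) = ((1 ⊗ₜ b)′) := by simp [deriv_tmul]
    rw [this, hφ.1]
    exact counit_deriv_liftAlg (H := H) _
  · have : ψ = triv x := by
      ext b
      change φ (1 ⊗ₜ b) = triv x (1 ⊗ₜ b)
      rw [triv_one_tmul]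
      refine (h1 _).symm.trans ?_
      refine (congrArg (Algebra.TensorProduct.map (ε.restrictScalars K) (AlgHom.id K H))
        (hφ.2 (1 ⊗ₜ b))).trans ?_
      change Algebra.TensorProduct.map (ε.restrictScalars K) (AlgHom.id K H)
        (Algebra.TensorProduct.map (ψ.restrictScalars K) (AlgHom.id K H)
          ((Algebra.TensorProduct.assoc K K K R X.carrier H).symm (1 ⊗ₜ X.coact b))) = _
      generalize X.coact b = w
      induction w using TensorProduct.induction_on with
      | zero => simp
      | add x y hx hy => simp only [map_add, TensorProduct.tmul_add, hx, hy]
      | tmul a b => simp [x]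
    exact fun z => DFunLike.congr_fun this z

/-- The trivialization defined by a `∂`-point, if bijective, is an isomorphism of comodule
algebras. -/
theorem isComoduleIso_triv {x : X.carrier →ₐ[K] R} (hx : ∀ b, x (b′) = ((x b)′))
    (h : Function.Bijective (triv x)) :
    IsComoduleIso (B := X) (B' := RightComodule.self K H)
      (AlgEquiv.ofBijective (triv x) h : R ⊗[K] X.carrier ≃ₐ[R] R ⊗[K] H) := by
  refine ⟨triv_deriv hx, fun z => ?_⟩
  change (Algebra.TensorProduct.assoc K K K R H H).symm
      (Algebra.TensorProduct.map (AlgHom.id K R) (Bialgebra.comulAlgHom K H) (triv x z)) =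
    Algebra.TensorProduct.map ((triv x).restrictScalars K) (AlgHom.id K H)
      ((Algebra.TensorProduct.assoc K K K R X.carrier H).symm
        (Algebra.TensorProduct.map (AlgHom.id K R) X.coact z))
  -- Over this ring there are two universal points `g`, `g'` of the group, and colinearity becomes
  -- `x * (g * g') = (x * g) * g'`.
  let T := (R ⊗[K] H) ⊗[K] H
  let y : X.carrier →ₐ[K] T := (Algebra.TensorProduct.includeLeft.comp
    Algebra.TensorProduct.includeLeft).comp x
  let g : WithConv (H →ₐ[K] T) := toConv (Algebra.TensorProduct.includeLeft.comp
    Algebra.TensorProduct.includeRight)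
  let g' : WithConv (H →ₐ[K] T) := toConv Algebra.TensorProduct.includeRight
  have h1 : ((Algebra.TensorProduct.assoc K K K R H H).symm.toAlgHom.comp
      (Algebra.TensorProduct.map (AlgHom.id K R) (Bialgebra.comulAlgHom K H))).comp
        (Algebra.TensorProduct.map x (AlgHom.id K H)) =
      Algebra.TensorProduct.lift y (g * g').ofConv (fun _ _ => .all ..) := by
    ext a
    · simp [y, Algebra.TensorProduct.one_def]
    · have h3 : (Algebra.TensorProduct.assoc K K K R H H).symm.toAlgHom.comp
          Algebra.TensorProduct.includeRight =
          Algebra.TensorProduct.lift g.ofConv g'.ofConv (fun _ _ => .all ..) := by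
        ext <;> simp [g, g', Algebra.TensorProduct.one_def]
      have h4 := DFunLike.congr_fun h3 (Coalgebra.comul (R := K) a)
      have h5 : (g * g').ofConv a = _ := AlgHom.convMul_apply g g' a
      simp only [AlgHom.comp_apply, Algebra.TensorProduct.includeRight_apply,
        Algebra.TensorProduct.map_tmul, map_one, AlgHom.id_apply, Algebra.TensorProduct.lift_tmul,
        one_mul, AlgHom.coe_restrictScalars'] at h4 ⊢
      rw [h5]
      exact h4
  have h2 : (Algebra.TensorProduct.map ((triv x).restrictScalars K) (AlgHom.id K H)).comp
      ((Algebra.TensorProduct.assoc K K K R X.carrier H).symm.toAlgHom.comp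
        Algebra.TensorProduct.includeRight) =
      Algebra.TensorProduct.lift (pmul y g) g'.ofConv (fun _ _ => .all ..) := by
    have h3 : Algebra.TensorProduct.includeLeft.comp
        (Algebra.TensorProduct.map x (AlgHom.id K H)) =
        (Algebra.TensorProduct.lift y g.ofConv (fun _ _ => .all ..)) := by
      ext <;> simp [y, g]
    ext b
    · have := DFunLike.congr_fun h3 (X.coact b)
      simpa [Algebra.TensorProduct.one_def, triv_one_tmul, pmul] using this
    · simp [Algebra.TensorProduct.one_def, g', triv]
  have key : ((Algebra.TensorProduct.assoc K K K R H H).symm.toAlgHom.comp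
      (Algebra.TensorProduct.map (AlgHom.id K R) (Bialgebra.comulAlgHom K H))).comp
        ((triv x).restrictScalars K) =
      (Algebra.TensorProduct.map ((triv x).restrictScalars K) (AlgHom.id K H)).comp
        ((Algebra.TensorProduct.assoc K K K R X.carrier H).symm.toAlgHom.comp
          (Algebra.TensorProduct.map (AlgHom.id K R) X.coact)) := by
    ext b
    · simp [triv, Algebra.TensorProduct.one_def, TensorProduct.smul_tmul']
    · have h3 := DFunLike.congr_fun h1 (X.coact b)
      have h4 := DFunLike.congr_fun h2 (X.coact b)
      have h5 := DFunLike.congr_fun (pmul_mul y g g') b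
      simp only [AlgHom.comp_apply, Algebra.TensorProduct.includeRight_apply,
        Algebra.TensorProduct.map_tmul, map_one, AlgHom.coe_restrictScalars', triv_one_tmul] at h3 h4 ⊢
      exact h3.trans (h5.trans h4.symm)
  exact DFunLike.congr_fun key z

omit [Differential R] [DifferentialAlgebra K R] in
/-- A comodule algebra that has a bijective trivialization over a non-zero algebra is Galois. -/
theorem isGalois_of_triv_bijective [Nontrivial R] {x : X.carrier →ₐ[K] R}
    (h : Function.Bijective (triv x)) : IsGalois X := by
  let E := AlgEquiv.ofBijective (triv x) h
  have hE : ∀ z, E z = triv x z := fun _ => rfl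
  let B := X.carrier
  -- The coordinate of the universal point of `X` relative to the origin `x`: by `hκ₀`, `x * κ₀` is
  -- the universal point.
  let κ₀ : H →ₐ[K] R ⊗[K] B := (E.symm.toAlgHom.restrictScalars K).comp
    Algebra.TensorProduct.includeRight
  have hκ₀ : pmul (Algebra.TensorProduct.includeLeft.comp x) (toConv κ₀) =
      (Algebra.TensorProduct.includeRight : B →ₐ[K] R ⊗[K] B) := by
    have h1 : (E.symm.toAlgHom.restrictScalars K).comp
        (Algebra.TensorProduct.map x (AlgHom.id K H)) = Algebra.TensorProduct.lift
        ((Algebra.TensorProduct.includeLeft : R →ₐ[K] R ⊗[K] B).comp x) κ₀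
          (fun _ _ => .all ..) := by
      ext b
      · have := E.symm.commutes (x b)
        simpa [Algebra.TensorProduct.algebraMap_apply] using this
      · simp [κ₀]
    ext b
    have h2 := DFunLike.congr_fun h1 (X.coact b)
    refine h2.symm.trans ?_
    change E.symm (Algebra.TensorProduct.map x (AlgHom.id K H) (X.coact b)) = _
    rw [← triv_one_tmul, ← hE, E.symm_apply_apply]
    rfl
  let β := triv (AlgHom.id K B)
  let βR : R ⊗[K] (B ⊗[K] B) →ₐ[R] R ⊗[K] (B ⊗[K] H) :=
    Algebra.TensorProduct.map (AlgHom.id R R) (β.restrictScalars K)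
  let p₁ : R ⊗[K] B →ₐ[K] R ⊗[K] (B ⊗[K] B) :=
    Algebra.TensorProduct.map (AlgHom.id K R) Algebra.TensorProduct.includeLeft
  let p₂ : R ⊗[K] B →ₐ[K] R ⊗[K] (B ⊗[K] B) :=
    Algebra.TensorProduct.map (AlgHom.id K R) Algebra.TensorProduct.includeRight
  -- If `κ₁` and `κ₂` are the coordinates of the two universal points `b₁ = x * κ₁` and `b₂ = x *
  -- κ₂`, then `κ = κ₁⁻¹ κ₂` satisfies `b₁ * κ = b₂`. So over `R` the inverse of the Galois map is
  -- given by `κ`.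
  let κ : WithConv (H →ₐ[K] R ⊗[K] (B ⊗[K] B)) :=
    (toConv (p₁.comp κ₀))⁻¹ * toConv (p₂.comp κ₀)
  have hp₁ := congrArg (fun f => p₁.comp f) hκ₀
  have hp₂ := congrArg (fun f => p₂.comp f) hκ₀
  have hp : p₁.comp (Algebra.TensorProduct.includeLeft.comp x) =
      p₂.comp (Algebra.TensorProduct.includeLeft.comp x) := by
    ext b
    simp [p₁, p₂]
  simp only [comp_pmul] at hp₁ hp₂
  have hκ : pmul (p₁.comp Algebra.TensorProduct.includeRight) κ =
      p₂.comp Algebra.TensorProduct.includeRight := by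
    rw [← hp₁, ← pmul_mul, ← hp₂, ← hp]
    simp [κ]
  let inv : R ⊗[K] (B ⊗[K] H) →ₐ[R] R ⊗[K] (B ⊗[K] B) :=
    liftAlg R (Algebra.TensorProduct.lift (p₁.comp Algebra.TensorProduct.includeRight) κ.ofConv
      (fun _ _ => .all ..))
  have h1 : inv.comp βR = AlgHom.id R _ := by
    have h3 := IsGalois.lift_triv_id (p₁.comp Algebra.TensorProduct.includeRight) κ
    rw [hκ] at h3
    have h4 : ((inv.comp βR).restrictScalars K).comp Algebra.TensorProduct.includeRight =
        (Algebra.TensorProduct.includeRight : B ⊗[K] B →ₐ[K] R ⊗[K] (B ⊗[K] B)) := by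
      refine Eq.trans ?_ (h3.trans ?_)
      · ext b <;> · simp [inv, βR, β]; rfl
      · ext b <;> simp [p₁, p₂]
    refine Algebra.TensorProduct.ext (by ext) ?_
    exact h4
  have h2 : βR.comp inv = AlgHom.id R _ := by
    let f := βR.restrictScalars K
    let j : WithConv (H →ₐ[K] R ⊗[K] (B ⊗[K] H)) := toConv
      (Algebra.TensorProduct.includeRight.comp Algebra.TensorProduct.includeRight)
    have hq : f.comp (p₁.comp Algebra.TensorProduct.includeRight) =
        Algebra.TensorProduct.includeRight.comp Algebra.TensorProduct.includeLeft := by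
      ext b
      simp [f, βR, β, p₁, triv, TensorProduct.smul_tmul', Algebra.TensorProduct.one_def]
    have hr : f.comp (p₂.comp Algebra.TensorProduct.includeRight) =
        pmul (f.comp (p₁.comp Algebra.TensorProduct.includeRight)) j := by
      have h3 : Algebra.TensorProduct.includeRight = Algebra.TensorProduct.lift
          (f.comp (p₁.comp Algebra.TensorProduct.includeRight)) j.ofConv (fun _ _ => .all ..) := by
        rw [hq]
        ext <;> simp [j]
      ext b
      have h4 := DFunLike.congr_fun h3 (X.coact b)
      refine Eq.trans ?_ h4
      simp [f, βR, β, p₂, triv_one_tmul, B]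
    -- When `b₂` is `b₁` translated by the universal group point `j`, the quotient `κ` must be `j`;
    -- the common factor cancels because `triv x` is surjective.
    have hj : toConv (f.comp κ.ofConv) = j := by
      have h3 := congrArg (fun g => f.comp g) hκ
      simp only [comp_pmul] at h3
      rw [hr, ← hp₁] at h3
      simp only [comp_pmul, ← pmul_mul] at h3
      have h4 : f.comp (p₁.comp (Algebra.TensorProduct.includeLeft.comp x)) =
          (IsScalarTower.toAlgHom K R (R ⊗[K] (B ⊗[K] H))).comp x := by
        ext b
        simp [f, p₁, βR, β, Algebra.TensorProduct.one_def, triv]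
      rw [h4] at h3
      have h5 := congrArg (fun t => (toConv (f.comp (p₁.comp κ₀)))⁻¹ * t)
        (pmul_left_cancel h.2 h3)
      simpa only [inv_mul_cancel_left] using h5
    have h4 : ((βR.comp inv).restrictScalars K).comp Algebra.TensorProduct.includeRight =
        (Algebra.TensorProduct.includeRight : B ⊗[K] H →ₐ[K] R ⊗[K] (B ⊗[K] H)) := by
      ext b
      · simpa [inv, f] using DFunLike.congr_fun hq b
      · have := congrArg (fun g => g.ofConv b) hj
        have h5 : βR (p₁ (1 ⊗ₜ[K] 1)) = 1 := by
          rw [← Algebra.TensorProduct.one_def, map_one, map_one]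
        simpa [inv, f, h5, j] using this
    refine Algebra.TensorProduct.ext (by ext) ?_
    exact h4
  -- Bijectivity over `R` descends, as a non-zero algebra over a field is faithfully flat.
  have hbij : Function.Bijective ((β.restrictScalars K).toLinearMap.lTensor R) :=
    ⟨fun a b hab => by
      have := congrArg inv hab
      exact (DFunLike.congr_fun h1 a).symm.trans (this.trans (DFunLike.congr_fun h1 b)),
      fun b => ⟨inv b, DFunLike.congr_fun h2 b⟩⟩
  exact ⟨(Module.FaithfullyFlat.lTensor_injective_iff_injective K R _).1 hbij.1,
    (Module.FaithfullyFlat.lTensor_surjective_iff_surjective K R _).1 hbij.2⟩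

/-- A right torsor is Galois. -/
theorem RightTorsor.isGalois (X : RightTorsor K H) : IsGalois X.toRightComodule := by
  obtain ⟨R, _, _, _, _, _, φ, hφ⟩ := X.isForm
  obtain ⟨x, _, hx⟩ := hφ.exists_point
  refine isGalois_of_triv_bijective (x := x) ?_
  have : (fun z => (φ z : R ⊗[K] H)) = triv x := funext hx
  rw [← this]
  exact φ.bijective

instance (X : RightTorsor K H) : Nontrivial X.carrier := by
  obtain ⟨R, _, _, _, _, _, φ, hφ⟩ := X.isForm
  have h : Nontrivial (R ⊗[K] H) :=
    (liftAlg R ((Algebra.ofId K R).comp (Bialgebra.counitAlgHom K H))).toRingHom.domain_nontrivial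
  have h2 : Nontrivial (R ⊗[K] X.carrier) := (show R ⊗[K] H ≃ₐ[R] R ⊗[K] X.carrier from φ.symm).injective.nontrivial
  by_contra h3
  rw [not_nontrivial_iff_subsingleton] at h3
  exact false_of_nontrivial_of_subsingleton (R ⊗[K] X.carrier)

instance RightTorsor.finiteType [Algebra.FiniteType K H] (X : RightTorsor K H) :
    Algebra.FiniteType K X.carrier := by
  obtain ⟨R, _, _, _, _, _, φ, hφ⟩ := X.isForm
  have : Algebra.FiniteType R (R ⊗[K] X.carrier) :=
    Algebra.FiniteType.equiv (inferInstance : Algebra.FiniteType R (R ⊗[K] H)) φ.symm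
  exact Algebra.FiniteType.of_finiteType_tensorProduct_of_faithfullyFlat R

end Trivialization

/-! ### Classification of torsors -/

section TorsorCocycle

variable {K H : Type u} [Field K] [Differential K] [CommRing H] [Differential H]
  [HopfAlgebra K H] [DiffHopfAlgebra K H] {X Y : RightComodule K H}
  {T T' : Type u} [CommRing T] [Differential T] [Algebra K T] [DifferentialAlgebra K T]
  [CommRing T'] [Differential T'] [Algebra K T'] [DifferentialAlgebra K T']
  {S : Type u} [CommRing S] [Differential S] [Algebra K S] [DifferentialAlgebra K S]

/-- Composition with an algebra map, on points of `Spec(H)`. -/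
def convMap {T T' : Type*} [CommRing T] [Algebra K T] [CommRing T'] [Algebra K T']
    (f : T →ₐ[K] T') : WithConv (H →ₐ[K] T) →* WithConv (H →ₐ[K] T') where
  toFun g := toConv (f.comp g.ofConv)
  map_one' := by
    ext h
    exact f.commutes _
  map_mul' g g' := WithConv.ofConv_injective (AlgHom.comp_convMul_distrib f g g')

omit [Differential K] [Differential H] [DiffHopfAlgebra K H] in
theorem convMap_comp {T T' T'' : Type*} [CommRing T] [Algebra K T] [CommRing T'] [Algebra K T']
    [CommRing T''] [Algebra K T''] (f : T' →ₐ[K] T'') (g : T →ₐ[K] T') (x : WithConv (H →ₐ[K] T)) :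
    convMap f (convMap g x) = convMap (f.comp g) x := rfl

omit [DifferentialAlgebra K T] [DifferentialAlgebra K T'] in
theorem extendAlong_triv (f : DAlgHom K T T') (x : X.carrier →ₐ[K] T) :
    extendAlong f (triv x).toLinearMap = (triv (f.toAlgHom.comp x)).toLinearMap := by
  ext b
  have key : (Algebra.TensorProduct.map f.toAlgHom (AlgHom.id K H)).comp
      (Algebra.TensorProduct.map x (AlgHom.id K H)) =
      Algebra.TensorProduct.map (f.toAlgHom.comp x) (AlgHom.id K H) := by
    ext <;> simp
  have h := DFunLike.congr_fun key (X.coact b)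
  have h2 : ∀ w : T ⊗[K] H, f.toAlgHom.toLinearMap.rTensor H w =
      Algebra.TensorProduct.map f.toAlgHom (AlgHom.id K H) w := fun _ => rfl
  simpa [extendAlong_tmul, triv_one_tmul, h2] using h

/-- On points this is `x * (γ * g) = (x * γ) * g`. It turns the relation defining the cocycle of a
torsor into a relation between points. -/
theorem leftMul_triv (γ : points K H T) (x : X.carrier →ₐ[K] T) :
    leftMul γ ∘ₗ (triv x).toLinearMap = (triv (pmul x γ.1)).toLinearMap := by
  let i : T →ₐ[K] T ⊗[K] H := Algebra.TensorProduct.includeLeft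
  let g : WithConv (H →ₐ[K] T ⊗[K] H) := toConv Algebra.TensorProduct.includeRight
  let c : H →ₐ[K] T ⊗[K] H := (Algebra.TensorProduct.map γ.1.ofConv (AlgHom.id K H)).comp
      (Bialgebra.comulAlgHom K H)
  have h1 : toConv c = convMap i γ.1 * g := by
    apply WithConv.ofConv_injective
    ext h
    have h2 : Algebra.TensorProduct.map γ.1.ofConv (AlgHom.id K H) =
        Algebra.TensorProduct.lift (convMap i γ.1).ofConv g.ofConv (fun _ _ => .all ..) := by
      ext <;> simp [convMap, i, g]
    exact (DFunLike.congr_fun h2 _).trans (AlgHom.convMul_apply (convMap i γ.1) g h).symm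
  have h3 : ∀ y : X.carrier →ₐ[K] T, (Algebra.TensorProduct.map y (AlgHom.id K H)).comp X.coact =
      pmul (i.comp y) g := by
    intro y
    unfold pmul
    congr 1
    ext <;> simp [i, g]
  have h4 : (leftMul γ : T ⊗[K] H →ₗ[T] T ⊗[K] H) = (liftAlg T c).toLinearMap := by
    ext h
    change leftMul γ (1 ⊗ₜ h) = liftAlg T c (1 ⊗ₜ h)
    rw [liftAlg_one_tmul, leftMul, LinearMap.liftBaseChange_tmul, one_smul]
    rfl
  have h5 : ((liftAlg T c).restrictScalars K).comp
      (Algebra.TensorProduct.map x (AlgHom.id K H)) =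
      Algebra.TensorProduct.lift (i.comp x) c (fun _ _ => .all ..) := by
    ext <;> simp [i, Algebra.TensorProduct.one_def, TensorProduct.smul_tmul']
  rw [h4]
  ext b
  have h6 := DFunLike.congr_fun h5 (X.coact b)
  have h7 : pmul (i.comp x) (toConv c) = (Algebra.TensorProduct.map (pmul x γ.1)
      (AlgHom.id K H)).comp X.coact := by
    rw [h1, pmul_mul, h3, comp_pmul]
    rfl
  have h8 := h6.trans (DFunLike.congr_fun h7 b)
  simpa [triv_one_tmul] using h8

/-- Two out of three: the trivializations defined by `x` and by `x * γ` are both bijective. -/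
theorem leftMul_bijective {x : X.carrier →ₐ[K] T} (hX : IsGalois X) (γ : points K H T) :
    Function.Bijective (leftMul γ) := by
  have h := leftMul_triv γ x
  have h1 : Function.Bijective (leftMul γ ∘ₗ (triv x).toLinearMap) := by
    rw [h]
    exact hX.triv_bijective _
  rw [LinearMap.coe_comp] at h1
  exact (Function.Bijective.of_comp_iff _ (hX.triv_bijective x)).1 h1

/-- The value of a cocycle of `Spec(H)`, as a point. -/
def Cocycle.point (γ : Cocycle S (specFunctor K H)) : points K H (S ⊗[K] S) := γ.1

/-- A torsor is given by `γ` if and only if `d₂ x = d₁ x * γ` for some `∂`-point `x`. -/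
theorem RightTorsor.isGivenBy_iff {X : RightTorsor K H} {γ : Cocycle S (specFunctor K H)} :
    X.IsGivenBy γ ↔ ∃ x : X.carrier →ₐ[K] S, (∀ b, x (b′) = ((x b)′)) ∧
      (DAlgHom.inl K S S).toAlgHom.comp x =
        pmul ((DAlgHom.inr K S S).toAlgHom.comp x) γ.point.1 := by
  constructor
  · rintro ⟨φ, hφ, h⟩
    obtain ⟨x, hx, hφx⟩ := hφ.exists_point
    refine ⟨x, hx, ?_⟩
    have h1 : φ.toLinearMap = (triv x).toLinearMap := LinearMap.ext hφx
    have h2 : extendAlong (DAlgHom.inl K S S) (triv x).toLinearMap =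
        leftMul γ.point ∘ₗ extendAlong (DAlgHom.inr K S S) (triv x).toLinearMap := by
      rw [← h1]
      exact h
    rw [extendAlong_triv, extendAlong_triv, leftMul_triv] at h2
    exact triv_injective fun b => LinearMap.congr_fun h2 (1 ⊗ₜ b)
  · rintro ⟨x, hx, h⟩
    refine ⟨_, isComoduleIso_triv hx (X.isGalois.triv_bijective x), ?_⟩
    change extendAlong (DAlgHom.inl K S S) (triv x).toLinearMap =
        leftMul γ.point ∘ₗ extendAlong (DAlgHom.inr K S S) (triv x).toLinearMap
    rw [extendAlong_triv, extendAlong_triv, leftMul_triv, h]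

/-- A `∂`-point of a torsor defines a cocycle. -/
theorem RightTorsor.exists_isGivenBy (X : RightTorsor K H) (x : DAlgHom K X.carrier S) :
    ∃ γ : Cocycle S (specFunctor K H), X.IsGivenBy γ := by
  let i₁ := (DAlgHom.inl K S S).toAlgHom
  let i₂ := (DAlgHom.inr K S S).toAlgHom
  -- The only possible choice, `γ = d₁ x \ d₂ x`. Note that `i₂`, the right inclusion, is `d₁`, and
  -- `i₁` is `d₂`.
  let γ : points K H (S ⊗[K] S) := ⟨X.isGalois.div (i₂.comp x.toAlgHom) (i₁.comp x.toAlgHom),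
    X.isGalois.div_mem_points ((DAlgHom.inr K S S).comp x).map_deriv
      ((DAlgHom.inl K S S).comp x).map_deriv⟩
  have hγ : pmul (i₂.comp x.toAlgHom) γ.1 = i₁.comp x.toAlgHom := X.isGalois.pmul_div _ _
  let e₁₃ := (DAlgHom.tensor DAlgHom.id (DAlgHom.inr K S S) :
    DAlgHom K (S ⊗[K] S) (S ⊗[K] (S ⊗[K] S))).toAlgHom
  let e₁₂ := (DAlgHom.tensor DAlgHom.id (DAlgHom.inl K S S) :
    DAlgHom K (S ⊗[K] S) (S ⊗[K] (S ⊗[K] S))).toAlgHom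
  let e₂₃ := (DAlgHom.inr K S (S ⊗[K] S)).toAlgHom
  have h : ∀ f : S ⊗[K] S →ₐ[K] S ⊗[K] (S ⊗[K] S),
      pmul ((f.comp i₂).comp x.toAlgHom) (convMap f γ.1) = (f.comp i₁).comp x.toAlgHom := fun f => by
    have := congrArg (fun g => f.comp g) hγ
    simp only [comp_pmul] at this
    exact this
  have h₁₃ := h e₁₃
  have h₁₂ := h e₁₂
  have h₂₃ := h e₂₃
  have c1 : e₁₃.comp i₂ = e₂₃.comp i₂ := by
    ext s; simp [e₁₃, e₂₃, i₂, DAlgHom.inr, DAlgHom.tensor]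
  have c2 : e₁₂.comp i₂ = e₂₃.comp i₁ := by
    ext s; simp [e₁₂, e₂₃, i₂, i₁, DAlgHom.inr, DAlgHom.inl, DAlgHom.tensor]
  have c3 : e₁₂.comp i₁ = e₁₃.comp i₁ := by
    ext s; simp [e₁₂, e₁₃, i₁, DAlgHom.inr, DAlgHom.inl, DAlgHom.tensor, DAlgHom.id]
  refine ⟨⟨γ, Subtype.ext ?_⟩, isGivenBy_iff.2 ⟨x.toAlgHom, x.map_deriv, hγ.symm⟩⟩
  change convMap e₁₃ γ.1 = convMap e₂₃ γ.1 * convMap e₁₂ γ.1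
  -- Let `x₁, x₂, x₃` be the images of `x` over `S ⊗ S ⊗ S`. Both sides translate `x₃` to `x₁`, the
  -- right one by way of `x₂`.
  apply X.isGalois.pmul_cancel
  rw [h₁₃, c1, pmul_mul, h₂₃, ← c2, h₁₂, c3]

/-- Two points giving `γ` and `γ'` differ by `g = x \ x'`, and comparing `d₁ x * (d₁ g * γ')` with
`d₁ x * (γ * d₂ g)` makes `g` the coboundary. Conversely, replacing `x` by `x * g` realizes any
cohomologous cocycle. -/
theorem RightTorsor.cohomologous_of_isGivenBy {X : RightTorsor K H}
    {γ γ' : Cocycle S (specFunctor K H)} (h : X.IsGivenBy γ) (h' : X.IsGivenBy γ') :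
    (cocycleSetoid S (specFunctor K H)).r γ γ' := by
  obtain ⟨x, hx, h⟩ := isGivenBy_iff.1 h
  obtain ⟨x', hx', h'⟩ := isGivenBy_iff.1 h'
  let i₁ := (DAlgHom.inl K S S).toAlgHom
  let i₂ := (DAlgHom.inr K S S).toAlgHom
  let g := X.isGalois.div x x'
  have hg : pmul x g = x' := X.isGalois.pmul_div _ _
  refine ⟨⟨g, X.isGalois.div_mem_points hx hx'⟩, Subtype.ext ?_⟩
  change γ'.point.1 = (convMap i₂ g)⁻¹ * γ.point.1 * convMap i₁ g
  have key : convMap i₂ g * γ'.point.1 = γ.point.1 * convMap i₁ g := by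
    apply X.isGalois.pmul_cancel (x := i₂.comp x)
    rw [pmul_mul, pmul_mul]
    have h1 : pmul (i₂.comp x) (convMap i₂ g) = i₂.comp x' := by
      rw [← hg, comp_pmul]; rfl
    have h2 : pmul (i₁.comp x) (convMap i₁ g) = i₁.comp x' := by
      rw [← hg, comp_pmul]; rfl
    rw [h1, ← h, h2, h']
  rw [mul_assoc, ← key, inv_mul_cancel_left]

theorem RightTorsor.isGivenBy_of_cohomologous {X : RightTorsor K H}
    {γ γ' : Cocycle S (specFunctor K H)} (h : X.IsGivenBy γ)
    (hγ : (cocycleSetoid S (specFunctor K H)).r γ γ') : X.IsGivenBy γ' := by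
  obtain ⟨x, hx, h⟩ := isGivenBy_iff.1 h
  obtain ⟨g, hg⟩ := hγ
  let i₁ := (DAlgHom.inl K S S).toAlgHom
  let i₂ := (DAlgHom.inr K S S).toAlgHom
  have hg' : γ'.point.1 = (convMap i₂ g.1)⁻¹ * γ.point.1 * convMap i₁ g.1 := congrArg Subtype.val hg
  refine isGivenBy_iff.2 ⟨pmul x g.1, pmul_deriv hx g, ?_⟩
  rw [comp_pmul, comp_pmul, hg', ← pmul_mul]
  change pmul (i₁.comp x) (convMap i₁ g.1) = pmul (i₂.comp x) (convMap i₂ g.1 * _)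
  rw [mul_assoc, mul_inv_cancel_left, pmul_mul]
  congr 1

theorem RightTorsor.isGivenBy_of_isIso {X Y : RightTorsor K H}
    {γ : Cocycle S (specFunctor K H)} (h : X.IsGivenBy γ) (hXY : X.IsIso Y) : Y.IsGivenBy γ := by
  obtain ⟨x, hx, h⟩ := isGivenBy_iff.1 h
  obtain ⟨φ, hφ, hφ'⟩ := hXY
  refine isGivenBy_iff.2 ⟨x.comp φ.symm.toAlgHom, fun b => ?_, ?_⟩
  · change x (φ.symm (b′)) = _
    rw [deriv_symm hφ, hx]
    rfl
  · ext b
    obtain ⟨a, rfl⟩ := φ.surjective b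
    have h1 := DFunLike.congr_fun h a
    have h2 : ∀ f : Y.carrier →ₐ[K] S ⊗[K] S,
        pmul f γ.point.1 (φ a) = pmul (f.comp φ.toAlgHom) γ.point.1 a := by
      intro f
      unfold pmul
      rw [AlgHom.comp_apply, hφ']
      have : (Algebra.TensorProduct.lift f γ.point.1.ofConv (fun _ _ => .all ..)).comp
          (Algebra.TensorProduct.map φ.toAlgHom (AlgHom.id K H)) =
          Algebra.TensorProduct.lift (f.comp φ.toAlgHom) γ.point.1.ofConv (fun _ _ => .all ..) := by
        ext <;> simp
      exact DFunLike.congr_fun this (X.coact a)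
    have h3 : (x.comp φ.symm.toAlgHom).comp φ.toAlgHom = x := by
      ext; simp
    rw [h2, AlgHom.comp_assoc, h3]
    simpa using h1

/-- The isomorphism over `S` that matches the points `x` and `y` has equal base extensions along
`d₁` and `d₂`, because both points change by the same `γ`. It therefore descends to `K`. -/
theorem RightTorsor.isIso_of_isGivenBy [Nontrivial S] {X Y : RightTorsor K H}
    {γ : Cocycle S (specFunctor K H)} (hX : X.IsGivenBy γ) (hY : Y.IsGivenBy γ) : X.IsIso Y := by
  obtain ⟨x, hx, hxγ⟩ := isGivenBy_iff.1 hX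
  obtain ⟨y, hy, hyγ⟩ := isGivenBy_iff.1 hY
  let E : S ⊗[K] X.carrier ≃ₐ[S] S ⊗[K] H :=
    AlgEquiv.ofBijective (triv x) (X.isGalois.triv_bijective x)
  let F : S ⊗[K] Y.carrier ≃ₐ[S] S ⊗[K] H :=
    AlgEquiv.ofBijective (triv y) (Y.isGalois.triv_bijective y)
  let Φ := E.trans F.symm
  have hΦ : (triv y).toLinearMap ∘ₗ Φ.toLinearEquiv.toLinearMap = (triv x).toLinearMap := by
    ext b
    exact F.apply_symm_apply _
  have hΦ' : ∀ f : DAlgHom K S (S ⊗[K] S),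
      (triv (f.toAlgHom.comp y)).toLinearMap ∘ₗ extendAlong f Φ.toLinearEquiv.toLinearMap =
        (triv (f.toAlgHom.comp x)).toLinearMap := fun f => by
    rw [← extendAlong_triv, ← extendAlong_triv, ← extendAlong_comp, hΦ]
  obtain ⟨e, he⟩ := exists_descent_equiv Φ.toLinearEquiv (by
    have h1 := hΦ' (DAlgHom.inl K S S)
    have h2 := hΦ' (DAlgHom.inr K S S)
    rw [hxγ, hyγ, ← leftMul_triv, ← leftMul_triv, ← h2, LinearMap.comp_assoc] at h1
    -- Left multiplication by `γ` stands in front of both sides and is cancelled, and then the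
    -- trivialization defined by `d₁ y`.
    have h3 := LinearMap.cancel_left (leftMul_bijective
      (x := (DAlgHom.inr K S S).toAlgHom.comp x) X.isGalois γ.point).1 |>.1 h1
    exact LinearMap.cancel_left (Y.isGalois.triv_bijective _).1 |>.1 h3)
  have hE : ∀ b, triv y (1 ⊗ₜ e b) = triv x (1 ⊗ₜ b) := fun b => by
    rw [← he]
    exact LinearMap.congr_fun hΦ (1 ⊗ₜ b)
  -- The descended map is only known to be linear. Compatibility with products, `∂` and coactions is
  -- tested after this embedding in `S ⊗ H`, where both torsors look alike.
  have hinj : Function.Injective fun c : Y.carrier => triv y (1 ⊗ₜ c) :=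
    (Y.isGalois.triv_bijective y).1.comp one_tmul_injective
  let φ : X.carrier ≃ₐ[K] Y.carrier := AlgEquiv.ofLinearEquiv e
    (hinj (by
      change triv y (1 ⊗ₜ e 1) = triv y (1 ⊗ₜ 1)
      rw [hE, ← Algebra.TensorProduct.one_def, ← Algebra.TensorProduct.one_def, map_one, map_one]))
    (fun a b => hinj (by
      change triv y (1 ⊗ₜ e (a * b)) = triv y (1 ⊗ₜ (e a * e b))
      have h1 : ∀ {C : Type u} [CommRing C] [Algebra K C] (a b : C),
          (1 ⊗ₜ (a * b) : S ⊗[K] C) = 1 ⊗ₜ a * 1 ⊗ₜ b := by simp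
      rw [hE, h1, h1, map_mul, map_mul, hE, hE]))
  refine ⟨φ, fun b => hinj ?_, fun b => ?_⟩
  · change triv y (1 ⊗ₜ e (b′)) = triv y (1 ⊗ₜ ((e b)′))
    have h1 : ∀ {C : Type u} [CommRing C] [Algebra K C] [Differential C] [DifferentialAlgebra K C]
        (a : C), (1 ⊗ₜ (a′) : S ⊗[K] C) = ((1 ⊗ₜ a)′) := by simp [deriv_tmul]
    rw [hE, h1, h1, triv_deriv hx, triv_deriv hy, hE]
  · have h1 := (isComoduleIso_triv hy (Y.isGalois.triv_bijective y)).2 (1 ⊗ₜ φ b)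
    have h2 := (isComoduleIso_triv hx (X.isGalois.triv_bijective x)).2 (1 ⊗ₜ b)
    have h3 : (Algebra.TensorProduct.map ((triv y).restrictScalars K) (AlgHom.id K H))
        ((Algebra.TensorProduct.assoc K K K S Y.carrier H).symm (1 ⊗ₜ Y.coact (φ b))) =
      (Algebra.TensorProduct.map ((triv x).restrictScalars K) (AlgHom.id K H))
        ((Algebra.TensorProduct.assoc K K K S X.carrier H).symm (1 ⊗ₜ X.coact b)) :=
      h1.symm.trans ((congrArg _ (hE b)).trans h2)
    have h4 : ∀ w : X.carrier ⊗[K] H,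
        (Algebra.TensorProduct.map ((triv x).restrictScalars K) (AlgHom.id K H))
          ((Algebra.TensorProduct.assoc K K K S X.carrier H).symm (1 ⊗ₜ w)) =
        (Algebra.TensorProduct.map ((triv y).restrictScalars K) (AlgHom.id K H))
          ((Algebra.TensorProduct.assoc K K K S Y.carrier H).symm
            (1 ⊗ₜ Algebra.TensorProduct.map φ.toAlgHom (AlgHom.id K H) w)) := by
      intro w
      induction w using TensorProduct.induction_on with
      | zero => simp
      | add x y hx hy => simp only [map_add, TensorProduct.tmul_add, hx, hy]
      | tmul a h =>
        simp only [Algebra.TensorProduct.assoc_symm_tmul, Algebra.TensorProduct.map_tmul,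
          AlgHom.coe_restrictScalars', AlgHom.id_apply]
        congr 1
        exact (hE a).symm
    rw [h4] at h3
    have h5 : Function.Injective
        (Algebra.TensorProduct.map ((triv y).restrictScalars K) (AlgHom.id K H)) :=
      Module.Flat.rTensor_preserves_injective_linearMap
        ((triv y).restrictScalars K).toLinearMap (Y.isGalois.triv_bijective y).1
    exact one_tmul_injective (K := K) (A := S)
      ((Algebra.TensorProduct.assoc K K K S Y.carrier H).symm.injective (h5 h3))

end TorsorCocycle

/-! ### Torsors from cocycles -/

section Sub

variable {K : Type u} [CommRing K] [Differential K]

/-- The derivation of a subalgebra closed under `∂`. -/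
@[reducible]
def subalgebraDifferential {A : Type*} [CommRing A] [Differential A] [Algebra K A]
    (B : Subalgebra K A) (hB : ∀ b ∈ B, b′ ∈ B) : Differential B where
  deriv := Derivation.mk'
    ({ toFun := fun b => ⟨(b : A)′, hB b b.2⟩
       map_zero' := Subtype.ext (map_zero Differential.deriv)
       map_add' := fun a b => Subtype.ext (map_add Differential.deriv (a : A) (b : A)) } :
      B →+ B).toIntLinearMap
    (fun a b => Subtype.ext (Derivation.leibniz Differential.deriv (a : A) (b : A)))

theorem subalgebraDifferentialAlgebra {A : Type*} [CommRing A] [Differential A] [Algebra K A]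
    [DifferentialAlgebra K A] (B : Subalgebra K A) (hB : ∀ b ∈ B, b′ ∈ B) :
    letI := subalgebraDifferential B hB
    DifferentialAlgebra K B :=
  letI := subalgebraDifferential B hB
  ⟨fun k => Subtype.ext (deriv_algebraMap (A := K) (B := A) k)⟩

end Sub

/-! ### Base extensions and subobjects of comodule algebras -/

section Comodules

variable {K H : Type u} [Field K] [Differential K] [CommRing H] [Differential H]
  [HopfAlgebra K H] [DiffHopfAlgebra K H]

/-- The base extension of a comodule algebra, with coaction over the base field. -/
def RightComodule.ext (X : RightComodule K H) (S : Type u) [CommRing S] [Differential S]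
    [Algebra K S] [DifferentialAlgebra K S] : RightComodule K H where
  carrier := S ⊗[K] X.carrier
  coact := X.extCoact S
  coact_deriv z := by
    have h : ∀ z : S ⊗[K] (X.carrier ⊗[K] H),
        (Algebra.TensorProduct.assoc K K K S X.carrier H).symm (z′) =
          (((Algebra.TensorProduct.assoc K K K S X.carrier H).symm z)′) := by
      intro z
      induction z using TensorProduct.induction_on with
      | zero => simp
      | add x y hx hy => simp only [map_add, hx, hy]
      | tmul s w =>
        induction w using TensorProduct.induction_on with
        | zero => simp
        | add x y hx hy => simp only [TensorProduct.tmul_add, map_add, hx, hy]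
        | tmul b h =>
          simp only [deriv_tmul, map_add, TensorProduct.tmul_add, TensorProduct.add_tmul,
            Algebra.TensorProduct.assoc_symm_tmul]
          abel
    exact (congrArg _ ((DAlgHom.tensor (DAlgHom.id : DAlgHom K S S)
      ⟨X.coact, X.coact_deriv⟩).map_deriv z)).trans (h _)
  coassoc z := by
    let i : X.carrier →ₐ[K] S ⊗[K] X.carrier := Algebra.TensorProduct.includeRight
    have h1 : (X.extCoact S).comp i =
        (Algebra.TensorProduct.map i (AlgHom.id K H)).comp X.coact := by
      have : ((Algebra.TensorProduct.assoc K K K S X.carrier H).symm.toAlgHom.comp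
          Algebra.TensorProduct.includeRight) =
          Algebra.TensorProduct.map i (AlgHom.id K H) := by
        ext <;> simp [i, Algebra.TensorProduct.one_def]
      rw [← this]
      ext b
      simp [RightComodule.extCoact, i]
    have key : (Algebra.TensorProduct.assoc K K K (S ⊗[K] X.carrier) H H).toAlgHom.comp
        ((Algebra.TensorProduct.map (X.extCoact S) (AlgHom.id K H)).comp (X.extCoact S)) =
        (Algebra.TensorProduct.map (AlgHom.id K (S ⊗[K] X.carrier))
          (Bialgebra.comulAlgHom K H)).comp (X.extCoact S) := by
      have h2 : (Algebra.TensorProduct.assoc K K K (S ⊗[K] X.carrier) H H).toAlgHom.comp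
          ((Algebra.TensorProduct.map (X.extCoact S) (AlgHom.id K H)).comp
            (Algebra.TensorProduct.map i (AlgHom.id K H))) =
          (Algebra.TensorProduct.map i (AlgHom.id K (H ⊗[K] H))).comp
            ((Algebra.TensorProduct.assoc K K K X.carrier H H).toAlgHom.comp
              (Algebra.TensorProduct.map X.coact (AlgHom.id K H))) := by
        have h3 : (Algebra.TensorProduct.map i (AlgHom.id K (H ⊗[K] H))).comp
            (Algebra.TensorProduct.assoc K K K X.carrier H H).toAlgHom =
            (Algebra.TensorProduct.assoc K K K (S ⊗[K] X.carrier) H H).toAlgHom.comp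
              (Algebra.TensorProduct.map (Algebra.TensorProduct.map i (AlgHom.id K H))
                (AlgHom.id K H)) := by
          ext <;> simp [Algebra.TensorProduct.one_def]
        rw [← AlgHom.comp_assoc (Algebra.TensorProduct.map i _), h3, AlgHom.comp_assoc,
          ← Algebra.TensorProduct.map_comp, ← Algebra.TensorProduct.map_comp, h1]
      have h4 : (Algebra.TensorProduct.map (AlgHom.id K (S ⊗[K] X.carrier))
          (Bialgebra.comulAlgHom K H)).comp (Algebra.TensorProduct.map i (AlgHom.id K H)) =
          (Algebra.TensorProduct.map i (AlgHom.id K (H ⊗[K] H))).comp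
            (Algebra.TensorProduct.map (AlgHom.id K X.carrier) (Bialgebra.comulAlgHom K H)) := by
        rw [← Algebra.TensorProduct.map_comp, ← Algebra.TensorProduct.map_comp]
        rfl
      -- An algebra map out of `S ⊗ B` is determined on the two factors. On `S` the coaction is
      -- trivial; on `B` the identity is the coassociativity of `X`.
      refine Algebra.TensorProduct.ext ?_ ?_
      · ext s
        simp [RightComodule.extCoact, Algebra.TensorProduct.one_def]
      · ext b
        have h5 := DFunLike.congr_fun h1 b
        have h6 := DFunLike.congr_fun h2 (X.coact b)
        have h7 := DFunLike.congr_fun h4 (X.coact b)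
        have h8 := congrArg (Algebra.TensorProduct.map i (AlgHom.id K (H ⊗[K] H))) (X.coassoc b)
        refine (congrArg ((Algebra.TensorProduct.assoc K K K (S ⊗[K] X.carrier) H H).toAlgHom.comp
          (Algebra.TensorProduct.map (X.extCoact S) (AlgHom.id K H))) h5).trans ?_
        refine (h6.trans (h8.trans h7.symm)).trans ?_
        exact (congrArg (Algebra.TensorProduct.map (AlgHom.id K (S ⊗[K] X.carrier))
          (Bialgebra.comulAlgHom K H)) h5).symm
    exact DFunLike.congr_fun key z
  counit z := by
    have h : (Algebra.TensorProduct.rid K K (S ⊗[K] X.carrier)).toAlgHom.comp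
        ((Algebra.TensorProduct.map (AlgHom.id K (S ⊗[K] X.carrier))
          (Bialgebra.counitAlgHom K H)).comp
          (Algebra.TensorProduct.assoc K K K S X.carrier H).symm.toAlgHom) =
        Algebra.TensorProduct.map (AlgHom.id K S)
          ((Algebra.TensorProduct.rid K K X.carrier).toAlgHom.comp
          (Algebra.TensorProduct.map (AlgHom.id K X.carrier) (Bialgebra.counitAlgHom K H))) := by
      ext <;> simp [Algebra.TensorProduct.one_def]
    induction z using TensorProduct.induction_on with
    | zero => simp
    | add x y hx hy => simp only [map_add, hx, hy]
    | tmul s b =>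
      refine (DFunLike.congr_fun h (s ⊗ₜ X.coact b)).trans ?_
      exact congrArg (s ⊗ₜ[K] ·) (X.counit b)

/-- A `∂`-stable subalgebra to which the coaction restricts. -/
def RightComodule.sub (X : RightComodule K H) (B : Subalgebra K X.carrier)
    (hB : ∀ b ∈ B, b′ ∈ B)
    (hc : ∀ b ∈ B, X.coact b ∈ (Algebra.TensorProduct.map B.val (AlgHom.id K H)).range) :
    RightComodule K H :=
  letI := subalgebraDifferential B hB
  haveI := subalgebraDifferentialAlgebra B hB
  -- By flatness `B ⊗ H` embeds in the ambient tensor product. The coaction is restricted through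
  -- this embedding, and the comodule axioms are inherited.
  have hι : Function.Injective (Algebra.TensorProduct.map B.val (AlgHom.id K H)) :=
    Module.Flat.rTensor_preserves_injective_linearMap B.val.toLinearMap Subtype.val_injective
  let ρ : B →ₐ[K] B ⊗[K] H :=
    (AlgEquiv.ofInjective _ hι).symm.toAlgHom.comp
      ((X.coact.comp B.val).codRestrict _ fun b => hc b b.2)
  have hρ : ∀ b, Algebra.TensorProduct.map B.val (AlgHom.id K H) (ρ b) = X.coact b := fun b =>
    congrArg Subtype.val ((AlgEquiv.ofInjective _ hι).apply_symm_apply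
      ((X.coact.comp B.val).codRestrict _ (fun b => hc b b.2) b))
  { carrier := B
    coact := ρ
    coact_deriv := fun b => hι (by
      rw [hρ]
      refine (X.coact_deriv b).trans ?_
      rw [← hρ]
      exact ((DAlgHom.tensor (⟨B.val, fun _ => rfl⟩ : DAlgHom K B X.carrier)
        (DAlgHom.id : DAlgHom K H H)).map_deriv (ρ b)).symm)
    coassoc := fun b => by
      have hι' : Function.Injective (Algebra.TensorProduct.map B.val (AlgHom.id K (H ⊗[K] H))) :=
        Module.Flat.rTensor_preserves_injective_linearMap B.val.toLinearMap Subtype.val_injective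
      apply hι'
      have h1 : (Algebra.TensorProduct.map B.val (AlgHom.id K (H ⊗[K] H))).comp
          ((Algebra.TensorProduct.assoc K K K B H H).toAlgHom.comp
            (Algebra.TensorProduct.map ρ (AlgHom.id K H))) =
          ((Algebra.TensorProduct.assoc K K K X.carrier H H).toAlgHom.comp
            (Algebra.TensorProduct.map X.coact (AlgHom.id K H))).comp
            (Algebra.TensorProduct.map B.val (AlgHom.id K H)) := by
        have h3 : (Algebra.TensorProduct.map B.val (AlgHom.id K (H ⊗[K] H))).comp
            (Algebra.TensorProduct.assoc K K K B H H).toAlgHom =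
            (Algebra.TensorProduct.assoc K K K X.carrier H H).toAlgHom.comp
              (Algebra.TensorProduct.map (Algebra.TensorProduct.map B.val (AlgHom.id K H))
                (AlgHom.id K H)) := by
          ext <;> simp [Algebra.TensorProduct.one_def]
        rw [← AlgHom.comp_assoc, h3]
        ext a
        · simp [hρ]
        · simp
      have h2 : (Algebra.TensorProduct.map B.val (AlgHom.id K (H ⊗[K] H))).comp
          (Algebra.TensorProduct.map (AlgHom.id K B) (Bialgebra.comulAlgHom K H)) =
          (Algebra.TensorProduct.map (AlgHom.id K X.carrier) (Bialgebra.comulAlgHom K H)).comp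
            (Algebra.TensorProduct.map B.val (AlgHom.id K H)) := by
        ext <;> simp
      refine (DFunLike.congr_fun h1 (ρ b)).trans (Eq.trans ?_ (DFunLike.congr_fun h2 (ρ b)).symm)
      simp only [AlgHom.comp_apply, hρ]
      exact X.coassoc b
    counit := fun b => Subtype.ext (by
      have h1 : B.val.comp ((Algebra.TensorProduct.rid K K B).toAlgHom.comp
          (Algebra.TensorProduct.map (AlgHom.id K B) (Bialgebra.counitAlgHom K H))) =
          ((Algebra.TensorProduct.rid K K X.carrier).toAlgHom.comp
            (Algebra.TensorProduct.map (AlgHom.id K X.carrier) (Bialgebra.counitAlgHom K H))).comp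
            (Algebra.TensorProduct.map B.val (AlgHom.id K H)) := by
        ext <;> simp
      refine (DFunLike.congr_fun h1 (ρ b)).trans ?_
      simp only [AlgHom.comp_apply, hρ]
      exact X.counit b) }

theorem RightComodule.sub_coact (X : RightComodule K H) (B : Subalgebra K X.carrier)
    (hB : ∀ b ∈ B, b′ ∈ B)
    (hc : ∀ b ∈ B, X.coact b ∈ (Algebra.TensorProduct.map B.val (AlgHom.id K H)).range) (b : B) :
    Algebra.TensorProduct.map B.val (AlgHom.id K H)
      (show B ⊗[K] H from (X.sub B hB hc).coact b) = X.coact b :=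
  congrArg Subtype.val ((AlgEquiv.ofInjective _
    (Module.Flat.rTensor_preserves_injective_linearMap B.val.toLinearMap
      Subtype.val_injective : Function.Injective
        (Algebra.TensorProduct.map B.val (AlgHom.id K H)))).apply_symm_apply
      ((X.coact.comp B.val).codRestrict _ (fun b => hc b b.2) b))

end Comodules

/-! ### Twisting the trivial torsor by a cocycle -/

section TorsorDescent

variable {K H : Type u} [Field K] [Differential K] [CommRing H] [Differential H]
  [HopfAlgebra K H] [DiffHopfAlgebra K H]
  {S : Type u} [CommRing S] [Differential S] [Algebra K S] [DifferentialAlgebra K S]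

omit [Differential K] [Differential H] [DiffHopfAlgebra K H] in
theorem conv_mul_inv {T : Type*} [CommRing T] [Algebra K T] (a b : WithConv (H →ₐ[K] T)) :
    (a * b)⁻¹ = b⁻¹ * a⁻¹ :=
  mul_inv_rev a b

omit [Differential K] [Differential H] [DiffHopfAlgebra K H] in
theorem conv_mul_assoc {T : Type*} [CommRing T] [Algebra K T] (a b c : WithConv (H →ₐ[K] T)) :
    a * b * c = a * (b * c) :=
  mul_assoc a b c

theorem conv_mul_deriv {T : Type u} [CommRing T] [Differential T] [Algebra K T]
    [DifferentialAlgebra K T] {a b : WithConv (H →ₐ[K] T)}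
    (ha : ∀ h, a.ofConv (h′) = ((a.ofConv h)′)) (hb : ∀ h, b.ofConv (h′) = ((b.ofConv h)′))
    (h : H) : (a * b).ofConv (h′) = (((a * b).ofConv h)′) :=
  (points K H T).mul_mem (x := a) (y := b) ha hb h

omit [Differential K] [Differential H] [DiffHopfAlgebra K H] in
theorem convMap_mul {T T' : Type*} [CommRing T] [Algebra K T] [CommRing T'] [Algebra K T']
    (f : T →ₐ[K] T') (a b : WithConv (H →ₐ[K] T)) :
    convMap f (a * b) = convMap f a * convMap f b :=
  map_mul (convMap f) a b

omit [Differential K] in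
theorem rTensor_sub_eq_zero {M N P : Type*} [AddCommGroup M] [Module K M] [AddCommGroup N]
    [Module K N] [AddCommGroup P] [Module K P] {f g : M →ₗ[K] N} {w : M ⊗[K] P}
    (h : f.rTensor P w = g.rTensor P w) : (f - g).rTensor P w = 0 := by
  rw [LinearMap.rTensor_sub, LinearMap.sub_apply, h, sub_self]

/-- The cocycle identity for the inverse, with the factors in reversed order; `γ⁻¹` is what enters
the descent datum. -/
theorem Cocycle.point_cocycle (γ : Cocycle S (specFunctor K H)) :
    convMap (Algebra.TensorProduct.map (AlgHom.id K S) Algebra.TensorProduct.includeRight :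
        S ⊗[K] S →ₐ[K] S ⊗[K] (S ⊗[K] S)) γ.point.1⁻¹ =
      convMap (Algebra.TensorProduct.map (AlgHom.id K S) Algebra.TensorProduct.includeLeft :
        S ⊗[K] S →ₐ[K] S ⊗[K] (S ⊗[K] S)) γ.point.1⁻¹ *
      convMap (Algebra.TensorProduct.includeRight : S ⊗[K] S →ₐ[K] S ⊗[K] (S ⊗[K] S))
        γ.point.1⁻¹ := by
  have h : convMap (Algebra.TensorProduct.map (AlgHom.id K S) Algebra.TensorProduct.includeRight :
        S ⊗[K] S →ₐ[K] S ⊗[K] (S ⊗[K] S)) γ.point.1 =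
      convMap (Algebra.TensorProduct.includeRight : S ⊗[K] S →ₐ[K] S ⊗[K] (S ⊗[K] S)) γ.point.1 *
      convMap (Algebra.TensorProduct.map (AlgHom.id K S) Algebra.TensorProduct.includeLeft :
        S ⊗[K] S →ₐ[K] S ⊗[K] (S ⊗[K] S)) γ.point.1 :=
    congrArg Subtype.val γ.2
  rw [map_inv, h, map_inv, map_inv]
  exact conv_mul_inv _ _

/-- Restricting the cocycle identity to the small diagonal gives `c = c * c` for the restriction
`c`. -/
theorem Cocycle.point_diag (γ : Cocycle S (specFunctor K H)) :
    convMap (Algebra.TensorProduct.lmul' K) γ.point.1⁻¹ = 1 := by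
  let m : S ⊗[K] (S ⊗[K] S) →ₐ[K] S := (Algebra.TensorProduct.lmul' K).comp
    (Algebra.TensorProduct.map (AlgHom.id K S) (Algebra.TensorProduct.lmul' K))
  have h := congrArg (convMap m) γ.point_cocycle
  rw [map_mul, convMap_comp, convMap_comp, convMap_comp] at h
  have h1 : m.comp (Algebra.TensorProduct.map (AlgHom.id K S) Algebra.TensorProduct.includeRight) =
      Algebra.TensorProduct.lmul' K := by ext <;> simp [m]
  have h2 : m.comp (Algebra.TensorProduct.map (AlgHom.id K S) Algebra.TensorProduct.includeLeft) =
      Algebra.TensorProduct.lmul' K := by ext <;> simp [m]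
  have h3 : m.comp Algebra.TensorProduct.includeRight = Algebra.TensorProduct.lmul' K := by
    ext <;> simp [m]
  rw [h1, h2, h3] at h
  have h4 := congrArg (fun g => (convMap (Algebra.TensorProduct.lmul' K) γ.point.1⁻¹)⁻¹ * g) h
  simpa only [inv_mul_cancel_left, inv_mul_cancel] using h4.symm

/-- The descent datum on `S ⊗ H` defined by a cocycle. -/
def torsorTheta (γ : Cocycle S (specFunctor K H)) : S ⊗[K] H →ₐ[S] S ⊗[K] (S ⊗[K] H) :=
  liftAlg S (convMap (T' := S ⊗[K] (S ⊗[K] H)) (Algebra.TensorProduct.map (AlgHom.id K S)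
    Algebra.TensorProduct.includeLeft) γ.point.1⁻¹ * toConv (Algebra.TensorProduct.includeRight.comp
      Algebra.TensorProduct.includeRight) : WithConv (H →ₐ[K] S ⊗[K] (S ⊗[K] H))).ofConv

/-- On points the descent datum is `(s₁, s₂, g) ↦ (s₁, γ(s₁, s₂)⁻¹ g)`. This form is the one used in
all later computations. -/
theorem comp_torsorTheta (γ : Cocycle S (specFunctor K H)) {T : Type u} [CommRing T] [Algebra K T]
    (f : S ⊗[K] (S ⊗[K] H) →ₐ[K] T) :
    toConv ((f.comp ((torsorTheta γ).restrictScalars K)).comp Algebra.TensorProduct.includeRight) =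
      convMap (f.comp (Algebra.TensorProduct.map (AlgHom.id K S)
        Algebra.TensorProduct.includeLeft)) γ.point.1⁻¹ *
      toConv (f.comp (Algebra.TensorProduct.includeRight.comp
        Algebra.TensorProduct.includeRight)) := by
  rw [← convMap_comp]
  refine Eq.trans ?_ (map_mul (convMap f) _ _)
  apply WithConv.ofConv_injective
  ext h
  simp [torsorTheta, convMap]
  rfl

theorem torsorTheta_tmul_one (γ : Cocycle S (specFunctor K H)) (s : S) :
    torsorTheta γ (s ⊗ₜ 1) = s ⊗ₜ 1 := by
  simp [torsorTheta, Algebra.TensorProduct.one_def, TensorProduct.smul_tmul']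

theorem torsorTheta_deriv (γ : Cocycle S (specFunctor K H)) (z : S ⊗[K] H) :
    torsorTheta γ (z′) = ((torsorTheta γ z)′) := by
  refine liftAlg_deriv (A := S ⊗[K] (S ⊗[K] H)) (fun h => ?_) z
  exact conv_mul_deriv (T := S ⊗[K] (S ⊗[K] H))
    ((specFunctor K H).map (DAlgHom.tensor DAlgHom.id (DAlgHom.inl K S H)) γ.point⁻¹).2
    ((DAlgHom.inr K S (S ⊗[K] H)).comp (DAlgHom.inr K S H)).map_deriv h

/-- The unit condition for a descent datum, which holds because `γ` is trivial on the diagonal. -/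
theorem mul_torsorTheta (γ : Cocycle S (specFunctor K H)) (z : S ⊗[K] H) :
    liftAlg S (AlgHom.id K (S ⊗[K] H)) (torsorTheta γ z) = z := by
  let m : S ⊗[K] (S ⊗[K] H) →ₐ[S] S ⊗[K] H := liftAlg S (AlgHom.id K (S ⊗[K] H))
  have h : m.comp (torsorTheta γ) = AlgHom.id S _ := by
    refine Algebra.TensorProduct.ext (by ext) ?_
    apply WithConv.toConv_injective
    refine (comp_torsorTheta γ (m.restrictScalars K)).trans ?_
    have h1 : (m.restrictScalars K).comp (Algebra.TensorProduct.map (AlgHom.id K S)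
        Algebra.TensorProduct.includeLeft) =
        Algebra.TensorProduct.includeLeft.comp (Algebra.TensorProduct.lmul' K) := by
      ext <;> simp [m, TensorProduct.smul_tmul']
    rw [h1, ← convMap_comp, γ.point_diag, map_one, one_mul]
    congr 1
    ext h
    simp [m]
  exact DFunLike.congr_fun h z

/-- The associativity condition for a descent datum; on the factor `H` it is the cocycle identity
for `γ⁻¹`. -/
theorem torsorTheta_coassoc (γ : Cocycle S (specFunctor K H)) (z : S ⊗[K] H) :
    Algebra.TensorProduct.map (AlgHom.id K S) ((torsorTheta γ).restrictScalars K)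
        (torsorTheta γ z) =
      Algebra.TensorProduct.map (AlgHom.id K S) Algebra.TensorProduct.includeRight
        (torsorTheta γ z) := by
  let f : S ⊗[K] (S ⊗[K] H) →ₐ[K] S ⊗[K] (S ⊗[K] (S ⊗[K] H)) :=
    Algebra.TensorProduct.map (AlgHom.id K S) ((torsorTheta γ).restrictScalars K)
  let f' : S ⊗[K] (S ⊗[K] H) →ₐ[K] S ⊗[K] (S ⊗[K] (S ⊗[K] H)) :=
    Algebra.TensorProduct.map (AlgHom.id K S) Algebra.TensorProduct.includeRight
  have h : f.comp ((torsorTheta γ).restrictScalars K) =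
      f'.comp ((torsorTheta γ).restrictScalars K) := by
    refine Algebra.TensorProduct.ext ?_ ?_
    · ext s
      simp [torsorTheta_tmul_one, f, f', Algebra.TensorProduct.one_def]
    · apply WithConv.toConv_injective
      let q : S ⊗[K] (S ⊗[K] S) →ₐ[K] S ⊗[K] (S ⊗[K] (S ⊗[K] H)) :=
        Algebra.TensorProduct.map (AlgHom.id K S) (Algebra.TensorProduct.map (AlgHom.id K S)
          Algebra.TensorProduct.includeLeft)
      have h1 := comp_torsorTheta γ (T := S ⊗[K] (S ⊗[K] (S ⊗[K] H))) f
      have h2 := comp_torsorTheta γ (T := S ⊗[K] (S ⊗[K] (S ⊗[K] H))) f'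
      have h3 := comp_torsorTheta γ (T := S ⊗[K] (S ⊗[K] (S ⊗[K] H))) (Algebra.TensorProduct.includeRight :
        S ⊗[K] (S ⊗[K] H) →ₐ[K] S ⊗[K] (S ⊗[K] (S ⊗[K] H)))
      have hc := (congrArg (convMap (T' := S ⊗[K] (S ⊗[K] (S ⊗[K] H))) q)
        γ.point_cocycle).trans (convMap_mul (T' := S ⊗[K] (S ⊗[K] (S ⊗[K] H))) q _ _)
      rw [convMap_comp, convMap_comp, convMap_comp] at hc
      have e1 : f.comp (Algebra.TensorProduct.includeRight.comp
          Algebra.TensorProduct.includeRight) = ((Algebra.TensorProduct.includeRight :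
            S ⊗[K] (S ⊗[K] H) →ₐ[K] S ⊗[K] (S ⊗[K] (S ⊗[K] H))).comp
          ((torsorTheta γ).restrictScalars K)).comp Algebra.TensorProduct.includeRight := by
        ext; simp [f]
      have e2 : f.comp (Algebra.TensorProduct.map (AlgHom.id K S)
          Algebra.TensorProduct.includeLeft) = q.comp (Algebra.TensorProduct.map (AlgHom.id K S)
          Algebra.TensorProduct.includeLeft) := by
        ext <;> simp [f, q, torsorTheta_tmul_one, Algebra.TensorProduct.one_def]
      have e3 : f'.comp (Algebra.TensorProduct.map (AlgHom.id K S)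
          Algebra.TensorProduct.includeLeft) = q.comp (Algebra.TensorProduct.map (AlgHom.id K S)
          Algebra.TensorProduct.includeRight) := by
        ext <;> simp [f', q]
      have e4 : (Algebra.TensorProduct.includeRight :
          S ⊗[K] (S ⊗[K] H) →ₐ[K] S ⊗[K] (S ⊗[K] (S ⊗[K] H))).comp
          (Algebra.TensorProduct.map (AlgHom.id K S) Algebra.TensorProduct.includeLeft) =
          q.comp Algebra.TensorProduct.includeRight := by
        ext <;> simp [q]
      have e5 : f'.comp (Algebra.TensorProduct.includeRight.comp
          Algebra.TensorProduct.includeRight) = (Algebra.TensorProduct.includeRight :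
            S ⊗[K] (S ⊗[K] H) →ₐ[K] S ⊗[K] (S ⊗[K] (S ⊗[K] H))).comp
          (Algebra.TensorProduct.includeRight.comp Algebra.TensorProduct.includeRight) := by
        ext; simp [f']
      refine h1.trans (Eq.trans ?_ h2.symm)
      rw [e1, h3, e2, e3, e4, e5, hc]
      exact (conv_mul_assoc (T := S ⊗[K] (S ⊗[K] (S ⊗[K] H))) _ _ _).symm
  exact DFunLike.congr_fun h z

/-- The subalgebra of `S ⊗ H` descended along a cocycle. -/
def torsorSub (γ : Cocycle S (specFunctor K H)) : Subalgebra K (S ⊗[K] H) :=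
  AlgHom.equalizer ((torsorTheta γ).restrictScalars K) Algebra.TensorProduct.includeRight

theorem mem_torsorSub {γ : Cocycle S (specFunctor K H)} {z : S ⊗[K] H} :
    z ∈ torsorSub γ ↔ torsorTheta γ z = 1 ⊗ₜ z := Iff.rfl

theorem deriv_mem_torsorSub (γ : Cocycle S (specFunctor K H)) :
    ∀ z ∈ torsorSub γ, z′ ∈ torsorSub γ := fun z hz => by
  rw [mem_torsorSub] at hz ⊢
  rw [torsorTheta_deriv, hz]
  simp [deriv_tmul]

/-- The descent datum multiplies by `γ⁻¹` on the left, so it commutes with right translation. Since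
`H` is flat, tensoring with `H` preserves the equalizer that defines the subalgebra, and the
coaction restricts. -/
theorem coact_mem_torsorSub (γ : Cocycle S (specFunctor K H)) :
    ∀ z ∈ torsorSub γ, ((RightComodule.self K H).ext S).coact z ∈
      (Algebra.TensorProduct.map (torsorSub γ).val (AlgHom.id K H)).range := fun z hz => by
  let N := S ⊗[K] H
  let C : N →ₐ[K] N ⊗[K] H := (RightComodule.self K H).extCoact S
  let ι : N →ₐ[K] S ⊗[K] N := Algebra.TensorProduct.includeRight
  let θ : N →ₐ[K] S ⊗[K] N := (torsorTheta γ).restrictScalars K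
  have hex : Function.Exact ((torsorSub γ).val.toLinearMap.rTensor H)
      ((θ.toLinearMap - ι.toLinearMap).rTensor H) := by
    apply Module.Flat.rTensor_exact
    intro w
    rw [LinearMap.sub_apply, sub_eq_zero]
    exact ⟨fun h => ⟨⟨w, h⟩, rfl⟩, by rintro ⟨⟨w, h⟩, rfl⟩; exact h⟩
  let A := (Algebra.TensorProduct.assoc K K K S N H).symm.toAlgHom.comp
    (Algebra.TensorProduct.map (AlgHom.id K S) C)
  have hC : C.comp Algebra.TensorProduct.includeRight =
      (Algebra.TensorProduct.map (Algebra.TensorProduct.includeRight : H →ₐ[K] N)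
        (AlgHom.id K H)).comp (Bialgebra.comulAlgHom K H) := by
    have : ((Algebra.TensorProduct.assoc K K K S H H).symm.toAlgHom.comp
        Algebra.TensorProduct.includeRight) =
        Algebra.TensorProduct.map (Algebra.TensorProduct.includeRight : H →ₐ[K] N)
          (AlgHom.id K H) := by
      ext <;> simp [Algebra.TensorProduct.one_def]
    rw [← this]
    ext b
    simp [RightComodule.extCoact, C, RightComodule.self]
    rfl
  have hC' : ∀ {T : Type u} [CommRing T] [Algebra K T] (f : N ⊗[K] H →ₐ[K] T),
      toConv (f.comp (C.comp Algebra.TensorProduct.includeRight)) =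
        toConv (f.comp (Algebra.TensorProduct.includeLeft.comp
          Algebra.TensorProduct.includeRight)) *
        toConv (f.comp Algebra.TensorProduct.includeRight) := by
    intro T _ _ f
    rw [hC]
    apply WithConv.ofConv_injective
    ext h
    refine Eq.trans ?_ (AlgHom.convMul_apply _ _ h).symm
    have : f.comp (Algebra.TensorProduct.map (Algebra.TensorProduct.includeRight : H →ₐ[K] N)
        (AlgHom.id K H)) = Algebra.TensorProduct.lift (f.comp
          (Algebra.TensorProduct.includeLeft.comp Algebra.TensorProduct.includeRight))
          (f.comp Algebra.TensorProduct.includeRight) (fun _ _ => .all ..) := by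
      ext <;> simp
    exact DFunLike.congr_fun this _
  have hCl : ∀ s : S, C (s ⊗ₜ 1) = (s ⊗ₜ 1) ⊗ₜ 1 := fun s => by
    change (Algebra.TensorProduct.assoc K K K S H H).symm
      (s ⊗ₜ Bialgebra.comulAlgHom K H 1) = (s ⊗ₜ 1) ⊗ₜ 1
    rw [map_one]
    rfl
  have h2 : (Algebra.TensorProduct.map ι (AlgHom.id K H)).comp C = A.comp ι := by
    have : ((Algebra.TensorProduct.assoc K K K S N H).symm.toAlgHom.comp
        Algebra.TensorProduct.includeRight) = Algebra.TensorProduct.map ι (AlgHom.id K H) := by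
      ext <;> simp [ι, Algebra.TensorProduct.one_def]
    rw [← this]
    exact AlgHom.ext fun b => rfl
  -- Compatibility of `θ` with the coaction. On the factor `H` it amounts to `(γ⁻¹ * g) * g' = γ⁻¹ *
  -- (g * g')`.
  have h1 : (Algebra.TensorProduct.map θ (AlgHom.id K H)).comp C = A.comp θ := by
    refine Algebra.TensorProduct.ext ?_ ?_
    · ext s
      change Algebra.TensorProduct.map θ (AlgHom.id K H) (C (s ⊗ₜ 1)) = A (torsorTheta γ (s ⊗ₜ 1))
      rw [hCl, torsorTheta_tmul_one]
      change torsorTheta γ (s ⊗ₜ 1) ⊗ₜ 1 = (Algebra.TensorProduct.assoc K K K S N H).symm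
            (s ⊗ₜ C 1)
      rw [torsorTheta_tmul_one, map_one]
      rfl
    · apply WithConv.toConv_injective
      have h6 := hC' (T := (S ⊗[K] N) ⊗[K] H) (Algebra.TensorProduct.map θ (AlgHom.id K H))
      have h3 := comp_torsorTheta γ (T := (S ⊗[K] N) ⊗[K] H) A
      have h4 := hC' (T := (S ⊗[K] N) ⊗[K] H) (Algebra.TensorProduct.map ι (AlgHom.id K H))
      have h5 := comp_torsorTheta γ (T := (S ⊗[K] N) ⊗[K] H) (Algebra.TensorProduct.includeLeft :
        S ⊗[K] N →ₐ[K] (S ⊗[K] N) ⊗[K] H)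
      have e1 : (Algebra.TensorProduct.map θ (AlgHom.id K H)).comp
          (Algebra.TensorProduct.includeLeft.comp Algebra.TensorProduct.includeRight) =
          ((Algebra.TensorProduct.includeLeft : S ⊗[K] N →ₐ[K] (S ⊗[K] N) ⊗[K] H).comp
            ((torsorTheta γ).restrictScalars K)).comp Algebra.TensorProduct.includeRight := by
        ext; simp [θ]; rfl
      have e2 : A.comp (Algebra.TensorProduct.includeRight.comp
          Algebra.TensorProduct.includeRight) =
          (Algebra.TensorProduct.map ι (AlgHom.id K H)).comp
            (C.comp Algebra.TensorProduct.includeRight) := by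
        rw [← AlgHom.comp_assoc, ← AlgHom.comp_assoc, h2]
      have e3 : A.comp (Algebra.TensorProduct.map (AlgHom.id K S)
          Algebra.TensorProduct.includeLeft) =
          (Algebra.TensorProduct.includeLeft : S ⊗[K] N →ₐ[K] (S ⊗[K] N) ⊗[K] H).comp
            (Algebra.TensorProduct.map (AlgHom.id K S) Algebra.TensorProduct.includeLeft) := by
        ext a
        · simp [A, Algebra.TensorProduct.one_def]
        · change (Algebra.TensorProduct.assoc K K K S N H).symm
            (1 ⊗ₜ C (a ⊗ₜ 1)) = (1 ⊗ₜ (a ⊗ₜ 1)) ⊗ₜ 1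
          rw [hCl]
          rfl
      have e4 : (Algebra.TensorProduct.map θ (AlgHom.id K H)).comp
          Algebra.TensorProduct.includeRight = (Algebra.TensorProduct.map ι (AlgHom.id K H)).comp
          Algebra.TensorProduct.includeRight := by
        ext; simp
      refine h6.trans (Eq.trans ?_ h3.symm)
      rw [e1, h5, e2, h4, e3, e4]
      exact conv_mul_assoc (T := (S ⊗[K] N) ⊗[K] H) _ _ _
  obtain ⟨w, hw⟩ := (hex (C z)).1 (by
    refine rTensor_sub_eq_zero (f := θ.toLinearMap) (g := ι.toLinearMap) ?_
    exact (DFunLike.congr_fun h1 z).trans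
      ((congrArg A hz : A (θ z) = A (ι z)).trans (DFunLike.congr_fun h2 z).symm))
  exact ⟨w, hw⟩

theorem torsorSub_bijective (γ : Cocycle S (specFunctor K H)) :
    Function.Bijective (liftAlg S (torsorSub γ).val) := by
  have h := descent_bijective (torsorTheta γ).toLinearMap (Subalgebra.toSubmodule (torsorSub γ))
    (fun n => mem_torsorSub) (fun n => ?_) (fun n => ?_)
  · have h1 : ∀ z, (Subalgebra.toSubmodule (torsorSub γ)).subtype.liftBaseChange S z =
        liftAlg S (torsorSub γ).val z := by
      intro z
      induction z using TensorProduct.induction_on with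
      | zero => simp
      | add x y hx hy => simp only [map_add, hx, hy]
      | tmul a b => simp
    have h2 : ⇑((Subalgebra.toSubmodule (torsorSub γ)).subtype.liftBaseChange S) =
      ⇑(liftAlg S (torsorSub γ).val) := funext h1
    rw [← h2]
    exact h
  · refine Eq.trans ?_ (mul_torsorTheta γ n)
    have h1 : ∀ z : S ⊗[K] (S ⊗[K] H), (LinearMap.id : S ⊗[K] H →ₗ[K] S ⊗[K] H).liftBaseChange S z =
        liftAlg S (AlgHom.id K (S ⊗[K] H)) z := by
      intro z
      induction z using TensorProduct.induction_on with
      | zero => simp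
      | add x y hx hy => simp only [map_add, hx, hy]
      | tmul a b => simp
    exact h1 _
  · exact torsorTheta_coassoc γ n

/-- The comodule algebra descended along a cocycle. -/
def comoduleOfCocycle (γ : Cocycle S (specFunctor K H)) : RightComodule K H :=
  ((RightComodule.self K H).ext S).sub (torsorSub (H := H) γ)
    (deriv_mem_torsorSub (H := H) γ) (coact_mem_torsorSub (H := H) γ)

/-- The canonical point of the comodule algebra descended along a cocycle. -/
def comodulePoint (γ : Cocycle S (specFunctor K H)) : (comoduleOfCocycle γ).carrier →ₐ[K] S :=
  ((liftAlg S ((Algebra.ofId K S).comp (Bialgebra.counitAlgHom K H))).restrictScalars K).comp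
    (torsorSub γ).val

theorem comodulePoint_deriv (γ : Cocycle S (specFunctor K H)) (b : (comoduleOfCocycle γ).carrier) :
    comodulePoint γ (b′) = ((comodulePoint γ b)′) :=
  counit_deriv_liftAlg (K := K) (H := H) (R := S) ((torsorSub γ).val b)

/-- The canonical point is evaluation at the identity, so by the counit axiom its trivialization
extends the inclusion of the descended algebra in `S ⊗ H`. -/
theorem triv_comodulePoint (γ : Cocycle S (specFunctor K H))
    (b : torsorSub γ) : triv (X := comoduleOfCocycle γ) (comodulePoint γ) (1 ⊗ₜ b) = b.1 := by
  refine (triv_one_tmul (X := comoduleOfCocycle γ) _ _).trans ?_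
  have h1 := RightComodule.sub_coact ((RightComodule.self K H).ext S) (torsorSub (H := H) γ)
    (deriv_mem_torsorSub (H := H) γ) (coact_mem_torsorSub (H := H) γ) b
  have h2 := counit_extCoact_self (K := K) (H := H) (R := S) b.1
  refine Eq.trans ?_ h2
  refine Eq.trans ?_ (congrArg _ h1)
  have h3 : (Algebra.TensorProduct.map ((liftAlg S ((Algebra.ofId K S).comp
      (Bialgebra.counitAlgHom K H))).restrictScalars K) (AlgHom.id K H)).comp
      (Algebra.TensorProduct.map (torsorSub γ).val (AlgHom.id K H)) =
      Algebra.TensorProduct.map (((liftAlg S ((Algebra.ofId K S).comp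
        (Bialgebra.counitAlgHom K H))).restrictScalars K).comp (torsorSub γ).val)
        (AlgHom.id K H) := by
    ext <;> simp
  exact (DFunLike.congr_fun h3 _).symm

theorem triv_comodulePoint_bijective (γ : Cocycle S (specFunctor K H)) :
    Function.Bijective (triv (comodulePoint γ)) := by
  have h : (triv (comodulePoint γ) : S ⊗[K] torsorSub γ →ₐ[S] S ⊗[K] H) =
      liftAlg S (torsorSub γ).val := by
    ext b
    refine (triv_comodulePoint γ b).trans ?_
    exact (liftAlg_one_tmul (T := S) (torsorSub γ).val b).symm
  have h2 := torsorSub_bijective γ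
  rw [← h] at h2
  exact h2

/-- The torsor defined by a cocycle. -/
def torsorOfCocycle [Nontrivial S] (γ : Cocycle S (specFunctor K H)) : RightTorsor K H where
  toRightComodule := comoduleOfCocycle γ
  isForm := ⟨S, inferInstance, inferInstance, inferInstance, inferInstance, inferInstance, _,
    isComoduleIso_triv (comodulePoint_deriv γ) (triv_comodulePoint_bijective γ)⟩

/-- The equation `θ z = 1 ⊗ z` defining the descended algebra, evaluated at `(s₁, s₂, γ(s₁, s₂))`,
says `d₂ x = d₁ x * γ` for the canonical point `x`. -/
theorem torsorOfCocycle_isGivenBy [Nontrivial S] (γ : Cocycle S (specFunctor K H)) :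
    (torsorOfCocycle γ).IsGivenBy γ := by
  refine RightTorsor.isGivenBy_iff.2 ⟨comodulePoint γ, comodulePoint_deriv γ, ?_⟩
  let i₁ := (DAlgHom.inl K S S).toAlgHom
  let i₂ := (DAlgHom.inr K S S).toAlgHom
  let ε : S ⊗[K] H →ₐ[S] S := liftAlg S ((Algebra.ofId K S).comp (Bialgebra.counitAlgHom K H))
  let A : S ⊗[K] H →ₐ[K] S ⊗[K] S :=
    Algebra.TensorProduct.lift i₂ γ.point.1.ofConv (fun _ _ => .all ..)
  let Q : S ⊗[K] (S ⊗[K] H) →ₐ[K] S ⊗[K] S :=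
    Algebra.TensorProduct.lift i₁ A (fun _ _ => .all ..)
  -- At this point `θ` produces `γ⁻¹ * γ = 1`, that is, the counit.
  have hQ : Q.comp ((torsorTheta γ).restrictScalars K) = i₁.comp (ε.restrictScalars K) := by
    refine Algebra.TensorProduct.ext ?_ ?_
    · ext s
      simp [torsorTheta_tmul_one, Q, ε]
    · apply WithConv.toConv_injective
      refine (comp_torsorTheta (T := S ⊗[K] S) γ Q).trans ?_
      have h1 : Q.comp (Algebra.TensorProduct.map (AlgHom.id K S)
          Algebra.TensorProduct.includeLeft) = AlgHom.id K (S ⊗[K] S) := by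
        ext <;> simp [Q, A, i₁, i₂, DAlgHom.inl, DAlgHom.inr]
      have h2 : Q.comp (Algebra.TensorProduct.includeRight.comp
          Algebra.TensorProduct.includeRight) = γ.point.1.ofConv := by
        ext; simp [Q, A]
      rw [h1, h2]
      refine (inv_mul_cancel γ.point.1).trans ?_
      ext h
      simp [Algebra.ofId_apply, ε]
  ext b
  have h1 := DFunLike.congr_fun hQ b.1
  have h2 : Q (torsorTheta γ b.1) = A b.1 := by
    have h3 : ∀ z : S ⊗[K] H, Q (1 ⊗ₜ z) = A z := fun z => by simp [Q]
    exact (congrArg Q (mem_torsorSub.1 b.2)).trans (h3 b.1)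
  refine h1.symm.trans (h2.trans ?_)
  have h3 : A.comp (Algebra.TensorProduct.map (comodulePoint γ) (AlgHom.id K H)) =
      Algebra.TensorProduct.lift (i₂.comp (comodulePoint γ)) γ.point.1.ofConv
        (fun _ _ => .all ..) := by
    ext <;> simp [A]
  have h4 := (triv_one_tmul (X := comoduleOfCocycle γ) (comodulePoint γ) b).symm.trans
    (triv_comodulePoint γ b)
  rw [← h4]
  exact DFunLike.congr_fun h3 _

end TorsorDescent

/-! ### Classification of twisted forms -/

section ExtendLin

variable {K : Type*} [CommRing K]
  {T : Type*} [CommRing T] [Differential T] [Algebra K T]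
  {T' : Type*} [CommRing T'] [Differential T'] [Algebra K T']
  {M N P : Type*} [AddCommGroup M] [Module K M] [AddCommGroup N] [Module K N]
  [AddCommGroup P] [Module K P]

/-- The base extension of a linear isomorphism. -/
def extendLin (f : DAlgHom K T T') (e : T ⊗[K] M ≃ₗ[T] T ⊗[K] N) :
    T' ⊗[K] M ≃ₗ[T'] T' ⊗[K] N :=
  LinearEquiv.ofLinearMap (extendAlong f e.toLinearMap) (extendAlong f e.symm.toLinearMap)
    (by rw [← extendAlong_comp]; simp [extendAlong_id])
    (by rw [← extendAlong_comp]; simp [extendAlong_id])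

theorem extendLin_toLinearMap (f : DAlgHom K T T') (e : T ⊗[K] M ≃ₗ[T] T ⊗[K] N) :
    (extendLin f e).toLinearMap = extendAlong f e.toLinearMap := rfl

theorem extendLin_rTensor (f : DAlgHom K T T') (e : T ⊗[K] M ≃ₗ[T] T ⊗[K] N) (z : T ⊗[K] M) :
    extendLin f e (f.toAlgHom.toLinearMap.rTensor M z) = f.toAlgHom.toLinearMap.rTensor N (e z) :=
  extendAlong_rTensor f e.toLinearMap z

theorem extendLin_trans (f : DAlgHom K T T') (e : T ⊗[K] M ≃ₗ[T] T ⊗[K] N)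
    (e' : T ⊗[K] N ≃ₗ[T] T ⊗[K] P) :
    extendLin f (e.trans e') = (extendLin f e).trans (extendLin f e') :=
  LinearEquiv.toLinearMap_injective (extendAlong_comp f e'.toLinearMap e.toLinearMap)

theorem extendLin_comp {T'' : Type*} [CommRing T''] [Differential T''] [Algebra K T'']
    (g : DAlgHom K T' T'') (f : DAlgHom K T T') (e : T ⊗[K] M ≃ₗ[T] T ⊗[K] N) :
    extendLin (g.comp f) e = extendLin g (extendLin f e) :=
  LinearEquiv.toLinearMap_injective (extendAlong_trans g f e.toLinearMap)

theorem DAlgHom.eq_of_toAlgHom {f g : DAlgHom K T T'} (h : f.toAlgHom = g.toAlgHom) : f = g := by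
  cases f
  cases g
  congr

end ExtendLin

section LieForms

variable {K : Type u} [Field K] [Differential K]
  {L L' L'' : Type u} [LieRing L] [LieAlgebra K L] [DiffLieAlgebra K L]
  [LieRing L'] [LieAlgebra K L'] [DiffLieAlgebra K L']
  [LieRing L''] [LieAlgebra K L''] [DiffLieAlgebra K L'']
  {S : Type u} [CommRing S] [Differential S] [Algebra K S] [DifferentialAlgebra K S]
  {T : Type u} [CommRing T] [Differential T] [Algebra K T] [DifferentialAlgebra K T]

theorem IsDiffLieIso.symm {Ψ : S ⊗[K] L ≃ₗ[S] S ⊗[K] L'} (h : IsDiffLieIso Ψ) :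
    IsDiffLieIso Ψ.symm :=
  ⟨fun x y => Ψ.injective (by rw [h.1]; simp), fun x => Ψ.injective (by rw [h.2]; simp)⟩

theorem IsDiffLieIso.trans {Ψ : S ⊗[K] L ≃ₗ[S] S ⊗[K] L'} (h : IsDiffLieIso Ψ)
    {Φ : S ⊗[K] L' ≃ₗ[S] S ⊗[K] L''} (h' : IsDiffLieIso Φ) : IsDiffLieIso (Ψ.trans Φ) :=
  ⟨fun x y => by simp only [LinearEquiv.trans_apply, h.1, h'.1],
    fun x => by simp only [LinearEquiv.trans_apply, h.2, h'.2]⟩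

theorem IsDiffLieIso.extend {Ψ : S ⊗[K] L ≃ₗ[S] S ⊗[K] L'} (h : IsDiffLieIso Ψ)
    (f : DAlgHom K S T) : IsDiffLieIso (extendLin f Ψ) :=
  ⟨extendAlong_lie f Ψ.toLinearMap h.1, extendAlong_del f Ψ.toLinearMap h.2⟩

/-- The value of a cocycle of `Aut_∂(L)`, as an automorphism. -/
def Cocycle.aut (σ : Cocycle S (autFunctor K L)) : lieAut K L (S ⊗[K] S) := σ.1

theorem LieForm.isGivenBy_iff {F : LieForm K L} {σ : Cocycle S (autFunctor K L)} :
    F.IsGivenBy σ ↔ ∃ Ψ : S ⊗[K] L ≃ₗ[S] S ⊗[K] F.carrier, IsDiffLieIso Ψ ∧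
      extendLin (DAlgHom.inl K S S) Ψ = σ.aut.1.trans (extendLin (DAlgHom.inr K S S) Ψ) :=
  exists_congr fun _ => and_congr_right fun _ =>
    ⟨fun h => LinearEquiv.toLinearMap_injective h, fun h => congrArg LinearEquiv.toLinearMap h⟩

/-- Each of the three embeddings of `S` in `S ⊗ S ⊗ S` factors through `S ⊗ S` in two ways. -/
theorem coface_relations (K S : Type u) [Field K] [Differential K] [CommRing S] [Differential S]
    [Algebra K S] [DifferentialAlgebra K S] :
    (DAlgHom.tensor DAlgHom.id (DAlgHom.inr K S S) :
        DAlgHom K (S ⊗[K] S) (S ⊗[K] (S ⊗[K] S))).comp (DAlgHom.inr K S S) =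
      (DAlgHom.inr K S (S ⊗[K] S)).comp (DAlgHom.inr K S S) ∧
    (DAlgHom.tensor DAlgHom.id (DAlgHom.inl K S S) :
        DAlgHom K (S ⊗[K] S) (S ⊗[K] (S ⊗[K] S))).comp (DAlgHom.inr K S S) =
      (DAlgHom.inr K S (S ⊗[K] S)).comp (DAlgHom.inl K S S) ∧
    (DAlgHom.tensor DAlgHom.id (DAlgHom.inl K S S) :
        DAlgHom K (S ⊗[K] S) (S ⊗[K] (S ⊗[K] S))).comp (DAlgHom.inl K S S) =
      (DAlgHom.tensor DAlgHom.id (DAlgHom.inr K S S)).comp (DAlgHom.inl K S S) := by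
  refine ⟨?_, ?_, ?_⟩ <;>
  · apply DAlgHom.eq_of_toAlgHom
    ext s
    simp [DAlgHom.comp, DAlgHom.tensor, DAlgHom.inl, DAlgHom.inr, DAlgHom.id,
      Algebra.TensorProduct.one_def]

theorem LieForm.exists_isGivenBy (F : LieForm K L) {Ψ : S ⊗[K] L ≃ₗ[S] S ⊗[K] F.carrier}
    (hΨ : IsDiffLieIso Ψ) : ∃ σ : Cocycle S (autFunctor K L), F.IsGivenBy σ := by
  let i₁ := DAlgHom.inl K S S
  let i₂ := DAlgHom.inr K S S
  -- The forced choice `σ = (d₁ Ψ)⁻¹ ∘ d₂ Ψ`.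
  let s : S ⊗[K] S ⊗[K] L ≃ₗ[S ⊗[K] S] (S ⊗[K] S) ⊗[K] L :=
    (extendLin i₁ Ψ).trans (extendLin i₂ Ψ).symm
  let σ : lieAut K L (S ⊗[K] S) := ⟨s, (hΨ.extend i₁).trans (hΨ.extend i₂).symm⟩
  have hs : extendLin i₁ Ψ = s.trans (extendLin i₂ Ψ) := by
    ext x
    simp [s]
  have h : ∀ f : DAlgHom K (S ⊗[K] S) (S ⊗[K] (S ⊗[K] S)),
      extendLin (f.comp i₁) Ψ = (extendLin f s).trans (extendLin (f.comp i₂) Ψ) := fun f => by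
    rw [extendLin_comp, hs, extendLin_trans, ← extendLin_comp]
  obtain ⟨c1, c2, c3⟩ := coface_relations K S
  have h₁₃ := h (DAlgHom.tensor DAlgHom.id (DAlgHom.inr K S S))
  have h₁₂ := h (DAlgHom.tensor DAlgHom.id (DAlgHom.inl K S S))
  have h₂₃ := h (DAlgHom.inr K S (S ⊗[K] S))
  refine ⟨⟨σ, Subtype.ext ?_⟩, LieForm.isGivenBy_iff.2 ⟨Ψ, hΨ, hs⟩⟩
  -- The product in the automorphism group is composition, so the factor `e₁₂` acts before `e₂₃`,
  -- and `trans` lists it on the left.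
  change extendLin (DAlgHom.tensor DAlgHom.id (DAlgHom.inr K S S)) s =
    (extendLin (DAlgHom.tensor DAlgHom.id (DAlgHom.inl K S S)) s).trans
      (extendLin (DAlgHom.inr K S (S ⊗[K] S)) s)
  ext x
  apply (extendLin ((DAlgHom.inr K S (S ⊗[K] S)).comp (DAlgHom.inr K S S)) Ψ).injective
  rw [← c3, c1, h₁₂, c2, h₂₃] at h₁₃
  exact (LinearEquiv.congr_fun h₁₃ x).symm

/-- Two trivializations differ by the automorphism `x = Ψ⁻¹ ∘ Ψ'` of `S ⊗ L`, and `x` is the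
coboundary. -/
theorem LieForm.cohomologous_of_isGivenBy {F : LieForm K L} {σ σ' : Cocycle S (autFunctor K L)}
    (h : F.IsGivenBy σ) (h' : F.IsGivenBy σ') : (cocycleSetoid S (autFunctor K L)).r σ σ' := by
  obtain ⟨Ψ, hΨ, h⟩ := LieForm.isGivenBy_iff.1 h
  obtain ⟨Ψ', hΨ', h'⟩ := LieForm.isGivenBy_iff.1 h'
  obtain ⟨x, hx⟩ : ∃ x : lieAut K L S, Ψ' = x.1.trans Ψ :=
    ⟨⟨Ψ'.trans Ψ.symm, hΨ'.trans hΨ.symm⟩, by ext z; simp⟩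
  refine ⟨x, ?_⟩
  have key : (autFunctor K L).map (DAlgHom.inr K S S) x * σ'.1 =
      σ.1 * (autFunctor K L).map (DAlgHom.inl K S S) x := by
    apply Subtype.ext
    change σ'.aut.1.trans (extendLin (DAlgHom.inr K S S) x.1) =
      (extendLin (DAlgHom.inl K S S) x.1).trans σ.aut.1
    ext z
    apply (extendLin (DAlgHom.inr K S S) Ψ).injective
    rw [hx, extendLin_trans, extendLin_trans, h] at h'
    exact (LinearEquiv.congr_fun h' z).symm
  rw [mul_assoc, ← key, inv_mul_cancel_left]

theorem LieForm.isGivenBy_of_cohomologous {F : LieForm K L} {σ σ' : Cocycle S (autFunctor K L)}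
    (h : F.IsGivenBy σ) (hσ : (cocycleSetoid S (autFunctor K L)).r σ σ') : F.IsGivenBy σ' := by
  obtain ⟨Ψ, hΨ, h⟩ := LieForm.isGivenBy_iff.1 h
  obtain ⟨x, hx⟩ := hσ
  let y : lieAut K L S := x
  have key : (autFunctor K L).map (DAlgHom.inr K S S) x * σ'.1 =
      σ.1 * (autFunctor K L).map (DAlgHom.inl K S S) x := by
    rw [hx, mul_assoc, mul_inv_cancel_left]
  have key' : σ'.aut.1.trans (extendLin (DAlgHom.inr K S S) y.1) =
      (extendLin (DAlgHom.inl K S S) y.1).trans σ.aut.1 := congrArg Subtype.val key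
  refine LieForm.isGivenBy_iff.2 ⟨y.1.trans Ψ, IsDiffLieIso.trans y.2 hΨ, ?_⟩
  rw [extendLin_trans, extendLin_trans, h]
  ext z
  exact congrArg (extendLin (DAlgHom.inr K S S) Ψ) (LinearEquiv.congr_fun key' z).symm

theorem LieForm.isGivenBy_of_isIso {F F' : LieForm K L} {σ : Cocycle S (autFunctor K L)}
    (h : F.IsGivenBy σ) (hF : F.IsIso F') : F'.IsGivenBy σ := by
  obtain ⟨Ψ, hΨ, h⟩ := LieForm.isGivenBy_iff.1 h
  obtain ⟨e, he⟩ := hF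
  have hE : ∀ {T : Type u} [CommRing T] [Differential T] [Algebra K T] [DifferentialAlgebra K T],
      IsDiffLieIso (e.toLinearEquiv.baseChange K T F.carrier F'.carrier) := by
    intro T _ _ _ _
    constructor
    · intro x y
      induction x using TensorProduct.induction_on with
      | zero => simp
      | add x x' hx hy => simp only [map_add, hx, hy, add_lie]
      | tmul a m =>
        induction y using TensorProduct.induction_on with
        | zero => simp
        | add x x' hx hy => simp only [map_add, hx, hy, lie_add]
        | tmul b n =>
          simp only [LieAlgebra.ExtendScalars.bracket_tmul, LinearEquiv.baseChange_tmul]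
          exact congrArg _ (e.map_lie m n)
    · intro x
      induction x using TensorProduct.induction_on with
      | zero => simp
      | add x x' hx hy => simp only [map_add, hx, hy]
      | tmul a m => simp [del_tmul, he]
  -- An isomorphism defined over `K` has the same extension along both cofaces, so it does not
  -- affect the cocycle.
  have hE' : ∀ f : DAlgHom K S (S ⊗[K] S),
      extendLin f (e.toLinearEquiv.baseChange K S F.carrier F'.carrier) =
        e.toLinearEquiv.baseChange K (S ⊗[K] S) F.carrier F'.carrier := by
    intro f
    apply LinearEquiv.toLinearMap_injective
    ext m
    simp [extendLin_toLinearMap, extendAlong_tmul]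
  refine LieForm.isGivenBy_iff.2 ⟨Ψ.trans _, hΨ.trans hE, ?_⟩
  rw [extendLin_trans, extendLin_trans, h, hE', hE']
  rfl

/-- In `Ψ' ∘ Ψ⁻¹` the automorphism `σ` cancels, so both base extensions agree and the map descends;
bracket and `∂` are compared inside `S ⊗ F'`. -/
theorem LieForm.isIso_of_isGivenBy [Nontrivial S] {F F' : LieForm K L}
    {σ : Cocycle S (autFunctor K L)} (h : F.IsGivenBy σ) (h' : F'.IsGivenBy σ) : F.IsIso F' := by
  obtain ⟨Ψ, hΨ, h⟩ := LieForm.isGivenBy_iff.1 h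
  obtain ⟨Ψ', hΨ', h'⟩ := LieForm.isGivenBy_iff.1 h'
  have hΦ := hΨ.symm.trans hΨ'
  have hs : ∀ f : DAlgHom K S (S ⊗[K] S), extendLin f Ψ.symm = (extendLin f Ψ).symm := fun _ => rfl
  obtain ⟨e, he⟩ := exists_descent_equiv (Ψ.symm.trans Ψ') (by
    refine congrArg LinearEquiv.toLinearMap (?_ : extendLin (DAlgHom.inl K S S) _ =
      extendLin (DAlgHom.inr K S S) _)
    rw [extendLin_trans, extendLin_trans, hs, hs, h, h']
    ext z
    simp)
  have hinj := one_tmul_injective (K := K) (A := S) (N := F'.carrier)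
  refine ⟨{ e with map_lie' := fun {x y} => hinj ?_ }, fun x => hinj ?_⟩
  · change 1 ⊗ₜ e ⁅x, y⁆ = 1 ⊗ₜ ⁅e x, e y⁆
    have h1 := hΦ.1 (1 ⊗ₜ x) (1 ⊗ₜ y)
    rw [he, he] at h1
    simp only [LieAlgebra.ExtendScalars.bracket_tmul, mul_one] at h1
    rw [← h1, he]
  · change 1 ⊗ₜ e (DiffModule.del K x) = 1 ⊗ₜ DiffModule.del K (e x)
    have h1 := hΦ.2 (1 ⊗ₜ x)
    rw [he] at h1
    simp only [del_tmul, Derivation.map_one_eq_zero, TensorProduct.zero_tmul, zero_add] at h1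
    rw [← h1, he]

end LieForms

/-! ### Twisting a Lie algebra by a cocycle -/

section FormDescent

variable {K : Type u} [Field K] [Differential K]
  {L : Type u} [LieRing L] [LieAlgebra K L] [DiffLieAlgebra K L]
  {S : Type u} [CommRing S] [Differential S] [Algebra K S] [DifferentialAlgebra K S]

/-- The descent datum on `S ⊗ L` defined by a cocycle, with values in `(S ⊗ S) ⊗ L`. -/
def formAlpha (σ : Cocycle S (autFunctor K L)) (z : S ⊗[K] L) : (S ⊗[K] S) ⊗[K] L :=
  σ.aut.1 ((DAlgHom.inl K S S).toAlgHom.toLinearMap.rTensor L z)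

/-- The descent datum on `S ⊗ L` defined by a cocycle. -/
def formTheta (σ : Cocycle S (autFunctor K L)) : S ⊗[K] L →ₗ[S] S ⊗[K] (S ⊗[K] L) where
  toFun z := TensorProduct.assoc K S S L (formAlpha σ z)
  map_add' x y := by simp only [formAlpha, map_add]
  map_smul' s x := by
    -- Scalars enter through the left inclusion of `S` in `S ⊗ S`, hence act on the outer factor
    -- after reassociation.
    have h : ∀ w : (S ⊗[K] S) ⊗[K] L, TensorProduct.assoc K S S L ((s ⊗ₜ[K] (1 : S)) • w) =
        s • TensorProduct.assoc K S S L w := by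
      intro w
      induction w using TensorProduct.induction_on with
      | zero => simp
      | add x y hx hy => simp only [smul_add, map_add, hx, hy]
      | tmul a l =>
        induction a using TensorProduct.induction_on with
        | zero => simp
        | add x y hx hy =>
          simp only [TensorProduct.add_tmul, smul_add, map_add, hx, hy]
        | tmul a b => simp [TensorProduct.smul_tmul']
    rw [formAlpha, rTensor_smul, map_smul]
    exact h _

theorem Cocycle.aut_cocycle (σ : Cocycle S (autFunctor K L)) :
    extendLin (DAlgHom.tensor DAlgHom.id (DAlgHom.inr K S S)) σ.aut.1 =
      (extendLin (DAlgHom.tensor DAlgHom.id (DAlgHom.inl K S S)) σ.aut.1).trans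
        (extendLin (DAlgHom.inr K S (S ⊗[K] S)) σ.aut.1) :=
  congrArg Subtype.val σ.2

/-- Multiplication `S ⊗ S → S`. -/
def mulDAlgHom (K S : Type u) [Field K] [Differential K] [CommRing S] [Differential S]
    [Algebra K S] [DifferentialAlgebra K S] : DAlgHom K (S ⊗[K] S) S :=
  ⟨Algebra.TensorProduct.lmul' K, fun z => by
    induction z using TensorProduct.induction_on with
    | zero => simp
    | add x y hx hy => simp only [map_add, hx, hy]
    | tmul a b =>
      simp [deriv_tmul]
      ring⟩

/-- On the small diagonal the cocycle identity says that an automorphism equals its own square. -/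
theorem Cocycle.aut_diag (σ : Cocycle S (autFunctor K L)) :
    extendLin (mulDAlgHom K S) σ.aut.1 = LinearEquiv.refl S _ := by
  let m : DAlgHom K (S ⊗[K] (S ⊗[K] S)) S :=
    (mulDAlgHom K S).comp (DAlgHom.tensor DAlgHom.id (mulDAlgHom K S))
  have h := congrArg (extendLin m) σ.aut_cocycle
  have h1 : m.comp (DAlgHom.tensor DAlgHom.id (DAlgHom.inr K S S)) = mulDAlgHom K S := by
    apply DAlgHom.eq_of_toAlgHom
    ext <;> simp [m, DAlgHom.comp, DAlgHom.tensor, DAlgHom.id, mulDAlgHom, DAlgHom.inr]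
  have h2 : m.comp (DAlgHom.tensor DAlgHom.id (DAlgHom.inl K S S)) = mulDAlgHom K S := by
    apply DAlgHom.eq_of_toAlgHom
    ext <;> simp [m, DAlgHom.comp, DAlgHom.tensor, DAlgHom.id, mulDAlgHom, DAlgHom.inl]
  have h3 : m.comp (DAlgHom.inr K S (S ⊗[K] S)) = mulDAlgHom K S := by
    apply DAlgHom.eq_of_toAlgHom
    ext <;> simp [m, DAlgHom.comp, DAlgHom.tensor, DAlgHom.id, mulDAlgHom, DAlgHom.inr]
  rw [extendLin_trans, ← extendLin_comp, ← extendLin_comp, ← extendLin_comp, h1, h2, h3] at h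
  ext z
  exact ((extendLin (mulDAlgHom K S) σ.aut.1).injective (LinearEquiv.congr_fun h z)).symm

theorem mul_formTheta (σ : Cocycle S (autFunctor K L)) (z : S ⊗[K] L) :
    (LinearMap.id : S ⊗[K] L →ₗ[K] S ⊗[K] L).liftBaseChange S (formTheta σ z) = z := by
  have h : ∀ w : (S ⊗[K] S) ⊗[K] L, (LinearMap.id : S ⊗[K] L →ₗ[K] S ⊗[K] L).liftBaseChange S
      (TensorProduct.assoc K S S L w) = (mulDAlgHom K S).toAlgHom.toLinearMap.rTensor L w := by
    intro w
    induction w using TensorProduct.induction_on with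
    | zero => simp
    | add x y hx hy => simp only [map_add, hx, hy]
    | tmul a l =>
      induction a using TensorProduct.induction_on with
      | zero => simp
      | add x y hx hy =>
        simp only [TensorProduct.add_tmul, map_add, hx, hy]
      | tmul a b => simp [TensorProduct.smul_tmul', mulDAlgHom]
  refine (h _).trans ?_
  rw [formAlpha, ← extendLin_rTensor, σ.aut_diag, LinearEquiv.refl_apply, ← rTensor_comp]
  have h1 : (mulDAlgHom K S).comp (DAlgHom.inl K S S) = DAlgHom.id := by
    apply DAlgHom.eq_of_toAlgHom
    ext; simp [DAlgHom.comp, DAlgHom.id, mulDAlgHom, DAlgHom.inl]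
  rw [h1]
  exact LinearMap.congr_fun (LinearMap.rTensor_id L S) z

/-- After reassociation the two sides are `e₂₃ σ ∘ e₁₂ σ` and `e₁₃ σ` applied to the image of `z` in
the first factor, so the cocycle identity applies. -/
theorem formTheta_coassoc (σ : Cocycle S (autFunctor K L)) (z : S ⊗[K] L) :
    ((formTheta σ).restrictScalars K).lTensor S (formTheta σ z) =
      (TensorProduct.mk K S (S ⊗[K] L) 1).lTensor S (formTheta σ z) := by
  let α' : (S ⊗[K] (S ⊗[K] S)) ⊗[K] L →ₗ[K] S ⊗[K] (S ⊗[K] (S ⊗[K] L)) :=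
    (TensorProduct.assoc K S S L).toLinearMap.lTensor S ∘ₗ
      (TensorProduct.assoc K S (S ⊗[K] S) L).toLinearMap
  let e₁₂ : DAlgHom K (S ⊗[K] S) (S ⊗[K] (S ⊗[K] S)) :=
    DAlgHom.tensor DAlgHom.id (DAlgHom.inl K S S)
  let e₁₃ : DAlgHom K (S ⊗[K] S) (S ⊗[K] (S ⊗[K] S)) :=
    DAlgHom.tensor DAlgHom.id (DAlgHom.inr K S S)
  let e₂₃ := DAlgHom.inr K S (S ⊗[K] S)
  have ha : ∀ (a : S) (v : (S ⊗[K] S) ⊗[K] L),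
      α' ((a ⊗ₜ[K] (1 : S ⊗[K] S)) • e₂₃.toAlgHom.toLinearMap.rTensor L v) =
        a ⊗ₜ TensorProduct.assoc K S S L v := by
    intro a v
    induction v using TensorProduct.induction_on with
    | zero => simp
    | add x y hx hy => simp only [map_add, smul_add, TensorProduct.tmul_add, hx, hy]
    | tmul s l => simp [TensorProduct.smul_tmul', α', e₂₃, DAlgHom.inr]
  have h1 : ∀ w : (S ⊗[K] S) ⊗[K] L,
      ((formTheta σ).restrictScalars K).lTensor S (TensorProduct.assoc K S S L w) =
        α' (extendLin e₂₃ σ.aut.1 (e₁₂.toAlgHom.toLinearMap.rTensor L w)) := by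
    intro w
    induction w using TensorProduct.induction_on with
    | zero => simp
    | add x y hx hy => simp only [map_add, hx, hy]
    | tmul s l =>
      induction s using TensorProduct.induction_on with
      | zero => simp
      | add x y hx hy => simp only [TensorProduct.add_tmul, map_add, hx, hy]
      | tmul a b =>
        have h2 : e₁₂.toAlgHom.toLinearMap.rTensor L ((a ⊗ₜ b) ⊗ₜ l) =
            (a ⊗ₜ[K] (1 : S ⊗[K] S)) • e₂₃.toAlgHom.toLinearMap.rTensor L
              ((b ⊗ₜ[K] (1 : S)) ⊗ₜ[K] l) := by
          simp [TensorProduct.smul_tmul', e₂₃, e₁₂, DAlgHom.inr, DAlgHom.inl, DAlgHom.tensor,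
            DAlgHom.id]
        rw [h2, map_smul, extendLin_rTensor, ha]
        rfl
  have h2 : ∀ w : (S ⊗[K] S) ⊗[K] L,
      (TensorProduct.mk K S (S ⊗[K] L) 1).lTensor S (TensorProduct.assoc K S S L w) =
        α' (e₁₃.toAlgHom.toLinearMap.rTensor L w) := by
    intro w
    induction w using TensorProduct.induction_on with
    | zero => simp
    | add x y hx hy => simp only [map_add, hx, hy]
    | tmul s l =>
      induction s using TensorProduct.induction_on with
      | zero => simp
      | add x y hx hy => simp only [TensorProduct.add_tmul, map_add, hx, hy]
      | tmul a b => simp [α', e₁₃, DAlgHom.inr, DAlgHom.tensor, DAlgHom.id]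
  obtain ⟨-, -, c3⟩ := coface_relations K S
  refine (h1 _).trans (Eq.trans ?_ (h2 _).symm)
  congr 1
  rw [formAlpha, ← extendLin_rTensor, ← extendLin_rTensor, σ.aut_cocycle, ← rTensor_comp,
    ← rTensor_comp, c3]
  rfl

/-- The descended `K`-space. -/
def formSub (σ : Cocycle S (autFunctor K L)) : Submodule K (S ⊗[K] L) where
  carrier := {z | formAlpha σ z = (DAlgHom.inr K S S).toAlgHom.toLinearMap.rTensor L z}
  zero_mem' := by simp [formAlpha]
  add_mem' {x y} hx hy := by
    simp only [formAlpha, Set.mem_ofPred_eq, map_add] at hx hy ⊢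
    rw [hx, hy]
  smul_mem' k x hx := by
    simp only [formAlpha, Set.mem_ofPred_eq, map_smul] at hx ⊢
    rw [← hx]
    exact LinearMap.map_smul_of_tower _ _ _

theorem mem_formSub {σ : Cocycle S (autFunctor K L)} {z : S ⊗[K] L} : z ∈ formSub σ ↔
    formAlpha σ z = (DAlgHom.inr K S S).toAlgHom.toLinearMap.rTensor L z := Iff.rfl

theorem lie_mem_formSub {σ : Cocycle S (autFunctor K L)} {x y : S ⊗[K] L} (hx : x ∈ formSub σ)
    (hy : y ∈ formSub σ) : ⁅x, y⁆ ∈ formSub σ := by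
  rw [mem_formSub, formAlpha] at *
  rw [rTensor_lie, rTensor_lie, σ.aut.2.1, hx, hy]

theorem del_mem_formSub {σ : Cocycle S (autFunctor K L)} {x : S ⊗[K] L} (hx : x ∈ formSub σ) :
    DiffModule.del S x ∈ formSub σ := by
  rw [mem_formSub, formAlpha] at *
  rw [rTensor_del, rTensor_del, σ.aut.2.2, hx]

instance (σ : Cocycle S (autFunctor K L)) : LieRing (formSub σ) where
  bracket x y := ⟨⁅x.1, y.1⁆, lie_mem_formSub x.2 y.2⟩
  add_lie x y z := Subtype.ext (add_lie x.1 y.1 z.1)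
  lie_add x y z := Subtype.ext (lie_add x.1 y.1 z.1)
  lie_self x := Subtype.ext (lie_self x.1)
  leibniz_lie x y z := Subtype.ext (leibniz_lie x.1 y.1 z.1)

instance (σ : Cocycle S (autFunctor K L)) : LieAlgebra K (formSub σ) where
  lie_smul k x y := Subtype.ext (by
    change ⁅x.1, k • y.1⁆ = k • ⁅x.1, y.1⁆
    rw [← algebraMap_smul S k y.1, lie_smul, algebraMap_smul])

instance (σ : Cocycle S (autFunctor K L)) : DiffLieAlgebra K (formSub σ) where
  del :=
    { toFun := fun x => ⟨DiffModule.del S x.1, del_mem_formSub x.2⟩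
      map_zero' := Subtype.ext (map_zero _)
      map_add' := fun x y => Subtype.ext (map_add _ x.1 y.1) }
  del_smul k x := Subtype.ext (by
    change DiffModule.del S (k • x.1) = k′ • x.1 + k • DiffModule.del S x.1
    rw [← algebraMap_smul S k x.1, DiffModule.del_smul, deriv_algebraMap, algebraMap_smul,
      algebraMap_smul])
  del_lie x y := Subtype.ext (DiffLieAlgebra.del_lie (R := S) x.1 y.1)

theorem formSub_bijective (σ : Cocycle S (autFunctor K L)) :
    Function.Bijective ((formSub σ).subtype.liftBaseChange S) := by
  refine descent_bijective (formTheta σ) (formSub σ) (fun z => ?_) (mul_formTheta σ)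
    (formTheta_coassoc σ)
  have h : ∀ z : S ⊗[K] L, TensorProduct.assoc K S S L
      ((DAlgHom.inr K S S).toAlgHom.toLinearMap.rTensor L z) = 1 ⊗ₜ z := by
    intro z
    induction z using TensorProduct.induction_on with
    | zero => simp
    | add x y hx hy => simp only [map_add, hx, hy, TensorProduct.tmul_add]
    | tmul s l => simp [DAlgHom.inr]
  rw [mem_formSub, ← h]
  exact (TensorProduct.assoc K S S L).injective.eq_iff.symm

/-- The trivialization over `S` of the form descended along a cocycle. -/
def formIso (σ : Cocycle S (autFunctor K L)) : S ⊗[K] formSub σ ≃ₗ[S] S ⊗[K] L :=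
  LinearEquiv.ofBijective _ (formSub_bijective σ)

theorem formIso_tmul (σ : Cocycle S (autFunctor K L)) (s : S) (x : formSub σ) :
    formIso σ (s ⊗ₜ x) = s • x.1 :=
  LinearMap.liftBaseChange_tmul ..

theorem formIso_isDiffLieIso (σ : Cocycle S (autFunctor K L)) : IsDiffLieIso (formIso σ) := by
  constructor
  · intro x y
    induction x using TensorProduct.induction_on with
    | zero => simp
    | add x x' hx hy => simp only [map_add, hx, hy, add_lie]
    | tmul a m =>
      induction y using TensorProduct.induction_on with
      | zero => simp
      | add x x' hx hy => simp only [map_add, hx, hy, lie_add]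
      | tmul b n =>
        rw [LieAlgebra.ExtendScalars.bracket_tmul, formIso_tmul, formIso_tmul, formIso_tmul,
          smul_lie, lie_smul, smul_smul]
        rfl
  · intro x
    induction x using TensorProduct.induction_on with
    | zero => simp
    | add x x' hx hy => simp only [map_add, hx, hy]
    | tmul a m =>
      rw [del_tmul, map_add, formIso_tmul, formIso_tmul, formIso_tmul, DiffModule.del_smul]
      rfl

/-- The twisted form defined by a cocycle. -/
def formOfCocycle [Nontrivial S] (σ : Cocycle S (autFunctor K L)) : LieForm K L where
  carrier := formSub σ
  isForm := ⟨S, inferInstance, inferInstance, inferInstance, inferInstance, inferInstance,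
    (formIso σ).symm, (formIso_isDiffLieIso σ).symm⟩

/-- Membership in the descended space is `σ (d₂ x) = d₁ x`. Stated for `formIso`, this is the
required relation for its inverse. -/
theorem formOfCocycle_isGivenBy [Nontrivial S] (σ : Cocycle S (autFunctor K L)) :
    (formOfCocycle σ).IsGivenBy σ := by
  refine LieForm.isGivenBy_iff.2 ⟨(formIso σ).symm, (formIso_isDiffLieIso σ).symm, ?_⟩
  change (extendLin (DAlgHom.inl K S S) (formIso σ)).symm =
    σ.aut.1.trans (extendLin (DAlgHom.inr K S S) (formIso σ)).symm
  have h : (extendLin (DAlgHom.inr K S S) (formIso σ)).toLinearMap =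
      ((extendLin (DAlgHom.inl K S S) (formIso σ)).trans σ.aut.1).toLinearMap := by
    ext x
    have h1 : ∀ f : DAlgHom K S (S ⊗[K] S), extendLin f (formIso σ) (1 ⊗ₜ x) =
        f.toAlgHom.toLinearMap.rTensor L x.1 := fun f => by
      have := extendLin_rTensor f (formIso σ) (1 ⊗ₜ x)
      rw [formIso_tmul, one_smul] at this
      simpa using this
    change extendLin (DAlgHom.inr K S S) (formIso σ) (1 ⊗ₜ x) =
      σ.aut.1 (extendLin (DAlgHom.inl K S S) (formIso σ) (1 ⊗ₜ x))
    rw [h1, h1]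
    exact (mem_formSub.1 x.2).symm
  have h' := LinearEquiv.toLinearMap_injective h
  rw [h']
  ext z
  simp

end FormDescent

/-! ### Trivializing Lie forms over the universal extension -/

section Finiteness

/-- An `ε`-derivation is determined by its values on finitely many algebra generators. -/
instance HopfLie.finite (K H : Type*) [Field K] [CommRing H] [HopfAlgebra K H]
    [Algebra.FiniteType K H] : Module.Finite K (HopfLie K H) := by
  obtain ⟨s, hs⟩ := (Algebra.FiniteType.out : (⊤ : Subalgebra K H).FG)
  let f : HopfLie K H →ₗ[K] (s → K) := LinearMap.pi fun a => HopfLie.eval a.1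
  refine Module.Finite.of_injective f ((injective_iff_map_eq_zero f).2 fun D hD => Subtype.ext ?_)
  exact derLie_eq_zero D.2 hs fun a ha => congrFun hD ⟨a, ha⟩

section Contract

variable {K : Type u} [Field K]
  {R : Type u} [CommRing R] [Algebra K R]
  {M N : Type u} [AddCommGroup M] [Module K M] [AddCommGroup N] [Module K N]

/-- Contraction of an element of `R ⊗ N` with a linear form on `N`. -/
def contract (φ : N →ₗ[K] K) : R ⊗[K] N →ₗ[K] R :=
  (TensorProduct.rid K R).toLinearMap ∘ₗ φ.lTensor R

theorem contract_tmul (φ : N →ₗ[K] K) (r : R) (n : N) : contract φ (r ⊗ₜ n) = φ n • r := by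
  simp [contract]

/-- The matrix entries of a linear map `R ⊗ M → R ⊗ N`. -/
def matrixEntries (Ψ : R ⊗[K] M →ₗ[R] R ⊗[K] N) : Set R :=
  {r | ∃ (φ : N →ₗ[K] K) (m : M), r = contract φ (Ψ (1 ⊗ₜ m))}

/-- The entries depend bilinearly on the form `φ` and the vector `m`, so they lie in the image of a
finite-dimensional space. -/
theorem fg_adjoin_matrixEntries [Module.Finite K M] [Module.Finite K N]
    (Ψ : R ⊗[K] M →ₗ[R] R ⊗[K] N) :
    (Algebra.adjoin K (matrixEntries Ψ)).FG := by
  let β : (N →ₗ[K] K) →ₗ[K] M →ₗ[K] R := LinearMap.mk₂ K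
    (fun φ m => contract φ (Ψ (1 ⊗ₜ m)))
    (fun φ ψ m => by
      simp only [contract, LinearMap.lTensor_add, LinearMap.comp_add, LinearMap.add_apply])
    (fun k φ m => by
      simp only [contract, LinearMap.lTensor_smul, LinearMap.comp_smul, LinearMap.smul_apply])
    (fun φ m m' => by simp only [TensorProduct.tmul_add, map_add])
    (fun k φ m => by
      rw [TensorProduct.tmul_smul, LinearMap.map_smul_of_tower, map_smul])
  have hle : Submodule.span K (matrixEntries Ψ) ≤ LinearMap.range (TensorProduct.lift β) := by
    rw [Submodule.span_le]
    rintro _ ⟨φ, m, rfl⟩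
    exact ⟨φ ⊗ₜ m, TensorProduct.lift.tmul _ _⟩
  have hfin := Submodule.finiteDimensional_of_le hle
  obtain ⟨s, hs⟩ := Module.Finite.iff_fg.1 hfin
  refine ⟨s, ?_⟩
  rw [← Algebra.adjoin_span (R := K) (s := (s : Set R)), hs, Algebra.adjoin_span]

theorem mem_range_of_contract [Module.Finite K N] (R₀ : Subalgebra K R) (z : R ⊗[K] N)
    (h : ∀ φ : N →ₗ[K] K, contract φ z ∈ R₀) :
    z ∈ LinearMap.range (R₀.val.toLinearMap.rTensor N) := by
  let b := Module.finBasis K N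
  have hz : z = ∑ j, contract (b.coord j) z ⊗ₜ b j := by
    clear h
    induction z using TensorProduct.induction_on with
    | zero => simp
    | add x y hx hy =>
      simp only [map_add, TensorProduct.add_tmul, Finset.sum_add_distrib]
      rw [← hx, ← hy]
    | tmul r n =>
      simp only [contract_tmul, TensorProduct.smul_tmul, Module.Basis.coord_apply]
      rw [← TensorProduct.tmul_sum, b.sum_repr]
  rw [hz]
  exact sum_mem fun j _ => ⟨⟨_, h (b.coord j)⟩ ⊗ₜ b j, by simp⟩

/-- A linear map is defined over any subalgebra that contains its matrix entries; finiteness of `N`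
allows an element of `R ⊗ N` to be recovered from its coordinates. -/
theorem exists_restrict_matrix [Module.Finite K N] (R₀ : Subalgebra K R)
    (Ψ : R ⊗[K] M →ₗ[R] R ⊗[K] N) (h : matrixEntries Ψ ⊆ R₀) :
    ∃ Ψ₀ : R₀ ⊗[K] M →ₗ[R₀] R₀ ⊗[K] N, ∀ z,
      R₀.val.toLinearMap.rTensor N (Ψ₀ z) = Ψ (R₀.val.toLinearMap.rTensor M z) := by
  have hinj : Function.Injective (R₀.val.toLinearMap.rTensor N) :=
    Module.Flat.rTensor_preserves_injective_linearMap _ Subtype.val_injective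
  let f : M →ₗ[K] R₀ ⊗[K] N := (LinearEquiv.ofInjective _ hinj).symm.toLinearMap ∘ₗ
    (Ψ.restrictScalars K ∘ₗ TensorProduct.mk K R M 1).codRestrict _ fun m =>
      mem_range_of_contract R₀ _ fun φ => h ⟨φ, m, rfl⟩
  have hf : ∀ m, R₀.val.toLinearMap.rTensor N (f m) = Ψ (1 ⊗ₜ m) := fun m =>
    congrArg Subtype.val ((LinearEquiv.ofInjective _ hinj).apply_symm_apply _)
  refine ⟨f.liftBaseChange R₀, fun z => ?_⟩
  induction z using TensorProduct.induction_on with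
  | zero => simp
  | add x y hx hy => simp only [map_add, hx, hy]
  | tmul r m =>
    rw [LinearMap.liftBaseChange_tmul]
    have h1 : ∀ w : R₀ ⊗[K] N, R₀.val.toLinearMap.rTensor N (r • w) =
        (r : R) • R₀.val.toLinearMap.rTensor N w := by
      intro w
      induction w using TensorProduct.induction_on with
      | zero => simp
      | add x y hx hy => simp only [smul_add, map_add, hx, hy]
      | tmul a n => simp [TensorProduct.smul_tmul']
    rw [h1, hf, ← map_smul, LinearMap.rTensor_tmul]
    simp [TensorProduct.smul_tmul']

end Contract

section Deriv

variable {K : Type u} [Field K] [Differential K]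
  {R : Type u} [CommRing R] [Differential R] [Algebra K R] [DifferentialAlgebra K R]
  {M N : Type u} [AddCommGroup M] [Module K M] [AddCommGroup N] [Module K N]
  [DiffModule K M] [DiffModule K N]

/-- Since `Ψ` commutes with `∂`, the derivative of an entry is a sum of two entries: one with the
vector differentiated, one with the form differentiated. -/
theorem deriv_mem_adjoin_matrixEntries (Ψ : R ⊗[K] M →ₗ[R] R ⊗[K] N)
    (hΨ : ∀ x, Ψ (DiffModule.del R x) = DiffModule.del R (Ψ x)) (r : R)
    (hr : r ∈ matrixEntries Ψ) : r′ ∈ Algebra.adjoin K (matrixEntries Ψ) := by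
  obtain ⟨φ, m, rfl⟩ := hr
  -- The derivative of `φ` in the dual space; neither `∂ ∘ φ` nor `φ ∘ ∂` need be `K`-linear, but
  -- their difference is.
  let ψ : N →ₗ[K] K :=
    { toFun := fun n => (φ n)′ - φ (DiffModule.del K n)
      map_add' := fun a b => by simp only [map_add]; ring
      map_smul' := fun k a => by
        simp only [DiffModule.del_smul, map_add, map_smul, smul_eq_mul, Derivation.leibniz,
          RingHom.id_apply]
        ring }
  have h : ∀ z : R ⊗[K] N, (contract φ z)′ = contract φ (DiffModule.del R z) + contract ψ z := by
    intro z
    induction z using TensorProduct.induction_on with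
    | zero => simp
    | add x y hx hy =>
      simp only [map_add, hx, hy]
      ring
    | tmul r n =>
      simp only [del_tmul, map_add, contract_tmul, Algebra.smul_def, Derivation.leibniz,
        deriv_algebraMap, Algebra.algebraMap_self, RingHom.id_apply, ψ, LinearMap.coe_mk, AddHom.coe_mk, map_sub]
      ring
  have h1 := hΨ (1 ⊗ₜ m)
  simp only [del_tmul, Derivation.map_one_eq_zero, TensorProduct.zero_tmul, zero_add] at h1
  rw [h, ← h1]
  exact add_mem (Algebra.subset_adjoin ⟨φ, _, rfl⟩) (Algebra.subset_adjoin ⟨ψ, m, rfl⟩)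

theorem deriv_mem_adjoin {s : Set R} (hs : ∀ r ∈ s, r′ ∈ Algebra.adjoin K s) (r : R)
    (hr : r ∈ Algebra.adjoin K s) : r′ ∈ Algebra.adjoin K s := by
  induction hr using Algebra.adjoin_induction with
  | mem x hx => exact hs x hx
  | algebraMap k => rw [deriv_algebraMap]; exact Subalgebra.algebraMap_mem _ _
  | add x y _ _ hx hy => rw [map_add]; exact add_mem hx hy
  | mul x y hx' hy' hx hy =>
    rw [Derivation.leibniz, smul_eq_mul, smul_eq_mul]
    exact add_mem (mul_mem hx' hy) (mul_mem hy' hx)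

end Deriv

/-- Twisted forms of a finite-dimensional `∂`-Lie algebra are trivialized by a `∂`-algebra that is
finitely generated as an algebra. -/
theorem IsTwistedForm.exists_finiteType {K L L' : Type u} [Field K] [Differential K]
    [LieRing L] [LieAlgebra K L] [DiffLieAlgebra K L] [LieRing L'] [LieAlgebra K L']
    [DiffLieAlgebra K L'] [Module.Finite K L] (h : IsTwistedForm K L L') :
    ∃ (S : Type u) (_ : CommRing S) (_ : Differential S) (_ : Algebra K S)
      (_ : DifferentialAlgebra K S), Nontrivial S ∧ Algebra.FiniteType K S ∧
      ∃ Ψ : S ⊗[K] L ≃ₗ[S] S ⊗[K] L', IsDiffLieIso Ψ := by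
  obtain ⟨R, _, _, _, _, _, Ψ, hΨ⟩ := h
  have : Module.Finite R (R ⊗[K] L') := Module.Finite.equiv Ψ
  -- Finite-dimensionality of the form descends from `R`; it is needed to restrict `Ψ` itself.
  have : Module.Finite K L' := Module.Finite.of_finite_tensorProduct_of_faithfullyFlat R
  -- The entries of the inverse are included so that the restricted map remains invertible.
  let E := matrixEntries Ψ.toLinearMap ∪ matrixEntries Ψ.symm.toLinearMap
  let R₀ := Algebra.adjoin K E
  have hd : ∀ r ∈ R₀, r′ ∈ R₀ := deriv_mem_adjoin fun r hr => by
    rcases hr with hr | hr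
    · exact Algebra.adjoin_mono Set.subset_union_left
        (deriv_mem_adjoin_matrixEntries _ hΨ.2 r hr)
    · exact Algebra.adjoin_mono Set.subset_union_right
        (deriv_mem_adjoin_matrixEntries _ hΨ.symm.2 r hr)
  have hfg : Algebra.FiniteType K R₀ := by
    refine (Subalgebra.fg_iff_finiteType _).1 ?_
    change (Algebra.adjoin K (_ ∪ _)).FG
    rw [Algebra.adjoin_union]
    exact (fg_adjoin_matrixEntries _).sup (fg_adjoin_matrixEntries _)
  let _ := subalgebraDifferential R₀ hd
  have := subalgebraDifferentialAlgebra R₀ hd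
  obtain ⟨F, hF⟩ := exists_restrict_matrix R₀ Ψ.toLinearMap
    (Set.subset_union_left.trans Algebra.subset_adjoin)
  obtain ⟨G, hG⟩ := exists_restrict_matrix R₀ Ψ.symm.toLinearMap
    (Set.subset_union_right.trans Algebra.subset_adjoin)
  have hinj : ∀ {N : Type u} [AddCommGroup N] [Module K N],
      Function.Injective (R₀.val.toLinearMap.rTensor N) := fun {N} _ _ =>
    Module.Flat.rTensor_preserves_injective_linearMap _ Subtype.val_injective
  let v : DAlgHom K R₀ R := ⟨R₀.val, fun _ => rfl⟩
  refine ⟨R₀, inferInstance, inferInstance, inferInstance, inferInstance, inferInstance, hfg,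
    LinearEquiv.ofLinearMap F G ?_ ?_, ?_, ?_⟩
  · ext x
    apply hinj
    change R₀.val.toLinearMap.rTensor L' (F (G (1 ⊗ₜ x))) = R₀.val.toLinearMap.rTensor L' (1 ⊗ₜ x)
    rw [hF, hG]
    exact Ψ.apply_symm_apply _
  · ext x
    apply hinj
    change R₀.val.toLinearMap.rTensor L (G (F (1 ⊗ₜ x))) = R₀.val.toLinearMap.rTensor L (1 ⊗ₜ x)
    rw [hG, hF]
    exact Ψ.symm_apply_apply _
  · intro x y
    apply hinj
    change R₀.val.toLinearMap.rTensor L' (F ⁅x, y⁆) = v.toAlgHom.toLinearMap.rTensor L' ⁅F x, F y⁆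
    rw [hF, rTensor_lie]
    change Ψ (v.toAlgHom.toLinearMap.rTensor L ⁅x, y⁆) =
      ⁅R₀.val.toLinearMap.rTensor L' (F x), R₀.val.toLinearMap.rTensor L' (F y)⁆
    rw [rTensor_lie, hΨ.1, hF, hF]
    rfl
  · intro x
    apply hinj
    change R₀.val.toLinearMap.rTensor L' (F (DiffModule.del R₀ x)) =
      v.toAlgHom.toLinearMap.rTensor L' (DiffModule.del R₀ (F x))
    rw [hF, rTensor_del]
    change Ψ (v.toAlgHom.toLinearMap.rTensor L (DiffModule.del R₀ x)) =
      DiffModule.del R (R₀.val.toLinearMap.rTensor L' (F x))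
    rw [rTensor_del, hΨ.2, hF]
    rfl

theorem IsTwistedForm.exists_iso {K U L L' : Type u} [Field K] [CharZero K] [Differential K]
    [Field U] [Differential U] [Algebra K U] [DifferentialAlgebra K U] (hU : IsDiffUniversal K U)
    [LieRing L] [LieAlgebra K L] [DiffLieAlgebra K L] [LieRing L'] [LieAlgebra K L']
    [DiffLieAlgebra K L'] [Module.Finite K L] (h : IsTwistedForm K L L') :
    ∃ Ψ : U ⊗[K] L ≃ₗ[U] U ⊗[K] L', IsDiffLieIso Ψ := by
  obtain ⟨S, _, _, _, _, _, _, Ψ, hΨ⟩ := h.exists_finiteType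
  obtain ⟨f⟩ := exists_diffPoint hU S
  exact ⟨extendLin f Ψ, hΨ.extend f⟩

end Finiteness

/-! ### Transport of derivations along isomorphisms over an extension -/

section Transport

variable {K : Type*} [Field K] {H H' H'' : Type*} [CommRing H] [HopfAlgebra K H]
  [CommRing H'] [HopfAlgebra K H'] [CommRing H''] [HopfAlgebra K H'']
  {T : Type*} [CommRing T] [Algebra K T]

variable (K H T) in
/-- The counit of `T ⊗ H`. -/
def counitT : T ⊗[K] H →ₐ[T] T :=
  liftAlg T ((Algebra.ofId K T).comp (Bialgebra.counitAlgHom K H))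

theorem counitT_tmul (t : T) (h : H) :
    counitT K H T (t ⊗ₜ h) = t * algebraMap K T (Coalgebra.counit h) := by
  simp [counitT, Algebra.ofId_apply]

/-- The `T`-linear extension to `T ⊗ H` of a linear map `H → T`. -/
def linT (D : WithConv (H →ₗ[K] T)) : T ⊗[K] H →ₗ[T] T :=
  D.ofConv.liftBaseChange T

theorem linT_tmul (D : WithConv (H →ₗ[K] T)) (t : T) (h : H) : linT D (t ⊗ₜ h) = t * D h := by
  simp [linT]

theorem linT_mul {D : WithConv (H →ₗ[K] T)} (hD : D ∈ derLie K H T) (a b : T ⊗[K] H) :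
    linT D (a * b) = linT D a * counitT K H T b + counitT K H T a * linT D b := by
  induction a using TensorProduct.induction_on with
  | zero => simp
  | add x y hx hy => simp only [add_mul, map_add, hx, hy]; ring
  | tmul s h =>
    induction b using TensorProduct.induction_on with
    | zero => simp
    | add x y hx hy => simp only [mul_add, map_add, hx, hy]; ring
    | tmul t h' =>
      simp only [Algebra.TensorProduct.tmul_mul_tmul, linT_tmul, counitT_tmul, mem_derLie.1 hD]
      ring

/-- Transport of linear maps `H → T` along a map `T ⊗ H' → T ⊗ H`. -/
def transLin (J : T ⊗[K] H' →ₗ[T] T ⊗[K] H) :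
    WithConv (H →ₗ[K] T) →ₗ[T] WithConv (H' →ₗ[K] T) where
  toFun D := toConv ((linT D ∘ₗ J).restrictScalars K ∘ₗ TensorProduct.mk K T H' 1)
  map_add' D E := by
    ext h
    change linT (D + E) (J (1 ⊗ₜ h)) = linT D (J (1 ⊗ₜ h)) + linT E (J (1 ⊗ₜ h))
    generalize J (1 ⊗ₜ h) = z
    induction z using TensorProduct.induction_on with
    | zero => simp
    | add x y hx hy => simp only [map_add, hx, hy]; ring
    | tmul t h =>
      rw [linT_tmul, linT_tmul, linT_tmul, ← mul_add]
      rfl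
  map_smul' t D := by
    ext h
    change linT (t • D) (J (1 ⊗ₜ h)) = t * linT D (J (1 ⊗ₜ h))
    generalize J (1 ⊗ₜ h) = z
    induction z using TensorProduct.induction_on with
    | zero => simp
    | add x y hx hy => simp only [map_add, hx, hy]; ring
    | tmul s h =>
      rw [linT_tmul, linT_tmul, mul_left_comm]
      rfl

theorem transLin_apply (J : T ⊗[K] H' →ₗ[T] T ⊗[K] H) (D : WithConv (H →ₗ[K] T)) (h : H') :
    transLin J D h = linT D (J (1 ⊗ₜ h)) := rfl

theorem linT_transLin (J : T ⊗[K] H' →ₗ[T] T ⊗[K] H) (D : WithConv (H →ₗ[K] T)) :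
    linT (transLin J D) = linT D ∘ₗ J := by
  ext h
  change linT (transLin J D) (1 ⊗ₜ h) = linT D (J (1 ⊗ₜ h))
  rw [linT_tmul, one_mul, transLin_apply]

/-- Being a derivation at the identity involves only the algebra structure and the augmentation, so
`J` need not respect coproducts here. -/
theorem transLin_mem {J : T ⊗[K] H' →ₐ[T] T ⊗[K] H}
    (hJ : (counitT K H T).comp J = counitT K H' T) {D : WithConv (H →ₗ[K] T)}
    (hD : D ∈ derLie K H T) : transLin J.toLinearMap D ∈ derLie K H' T := by
  intro a b
  have h1 : ∀ a : H', counitT K H T (J (1 ⊗ₜ a)) = algebraMap K T (Coalgebra.counit a) := by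
    intro a
    rw [← AlgHom.comp_apply, hJ, counitT_tmul, one_mul]
  have h2 : (1 ⊗ₜ (a * b) : T ⊗[K] H') = 1 ⊗ₜ a * 1 ⊗ₜ b := by simp
  simp only [transLin_apply]
  rw [h2, ← h1, ← h1]
  exact (congrArg (linT D) (map_mul J _ _)).trans (linT_mul hD _ _)

/-- Transport of `ε`-derivations along an isomorphism `T ⊗ H' ≃ T ⊗ H` of augmented algebras. -/
def derTransport (J : T ⊗[K] H' ≃ₐ[T] T ⊗[K] H)
    (hJ : (counitT K H T).comp J.toAlgHom = counitT K H' T) :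
    derLie K H T ≃ₗ[T] derLie K H' T :=
  have hJ' : (counitT K H' T).comp J.symm.toAlgHom = counitT K H T := by
    rw [← hJ]
    ext h
    simp
  { toFun := fun D => ⟨transLin J.toAlgHom.toLinearMap D.1, transLin_mem hJ D.2⟩
    invFun := fun D => ⟨transLin J.symm.toAlgHom.toLinearMap D.1, transLin_mem hJ' D.2⟩
    map_add' := fun D E => Subtype.ext (map_add (transLin J.toAlgHom.toLinearMap) D.1 E.1)
    map_smul' := fun t D => Subtype.ext (map_smul (transLin J.toAlgHom.toLinearMap) t D.1)
    left_inv := fun D => Subtype.ext (by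
      ext h
      change linT (transLin J.toAlgHom.toLinearMap D.1) (J.symm (1 ⊗ₜ h)) = D.1 h
      rw [linT_transLin]
      change linT D.1 (J (J.symm (1 ⊗ₜ h))) = D.1 h
      rw [J.apply_symm_apply, linT_tmul, one_mul])
    right_inv := fun D => Subtype.ext (by
      ext h
      change linT (transLin J.symm.toAlgHom.toLinearMap D.1) (J (1 ⊗ₜ h)) = D.1 h
      rw [linT_transLin]
      change linT D.1 (J.symm (J (1 ⊗ₜ h))) = D.1 h
      rw [J.symm_apply_apply, linT_tmul, one_mul]) }

end Transport

section TransportDel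

variable {K : Type*} [Field K] [Differential K]
  {H H' : Type*} [CommRing H] [HopfAlgebra K H] [Differential H] [DiffHopfAlgebra K H]
  [CommRing H'] [HopfAlgebra K H'] [Differential H'] [DiffHopfAlgebra K H']
  {T : Type*} [CommRing T] [Differential T] [Algebra K T] [DifferentialAlgebra K T]

theorem deriv_linT (D : WithConv (H →ₗ[K] T)) (z : T ⊗[K] H) :
    (linT D z)′ = linT D (z′) + linT (convDel D) z := by
  induction z using TensorProduct.induction_on with
  | zero => simp
  | add x y hx hy => simp only [map_add, hx, hy]; ring
  | tmul t h =>
    simp only [deriv_tmul, map_add, linT_tmul, Derivation.leibniz, smul_eq_mul, convDel_apply]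
    ring

theorem convDel_transLin {J : T ⊗[K] H' →ₗ[T] T ⊗[K] H} (hJ : ∀ z, J (z′) = ((J z)′))
    (D : WithConv (H →ₗ[K] T)) : convDel (transLin J D) = transLin J (convDel D) := by
  ext h
  change (transLin J D h)′ - transLin J D (h′) = transLin J (convDel D) h
  have h1 : (1 ⊗ₜ (h′) : T ⊗[K] H') = ((1 ⊗ₜ h)′) := by simp [deriv_tmul]
  rw [transLin_apply, transLin_apply, transLin_apply, h1, hJ, deriv_linT]
  ring

end TransportDel

/-! ### Algebras with a left Galois coaction -/

section LeftGalois

variable {K A B : Type*} [CommRing K] [CommRing A] [Algebra K A] [CommRing B] [Algebra K B]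
  {T T' : Type*} [CommRing T] [Algebra K T] [CommRing T'] [Algebra K T']

/-- The translate `g * x` of a point `x` of `Spec(B)` by a point `g` of `Spec(A)`, with respect to
a map `B → A ⊗ B`. -/
def actBy (lam : B →ₐ[K] A ⊗[K] B) (g : A →ₐ[K] T) (x : B →ₐ[K] T) : B →ₐ[K] T :=
  (Algebra.TensorProduct.lift g x (fun _ _ => .all ..)).comp lam

theorem comp_actBy (lam : B →ₐ[K] A ⊗[K] B) (f : T →ₐ[K] T') (g : A →ₐ[K] T) (x : B →ₐ[K] T) :
    f.comp (actBy lam g x) = actBy lam (f.comp g) (f.comp x) := by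
  unfold actBy
  rw [← AlgHom.comp_assoc]
  congr 1
  ext <;> simp

theorem actBy_deriv [Differential K] [Differential A] [DifferentialAlgebra K A] [Differential B]
    [DifferentialAlgebra K B] [Differential T] {lam : B →ₐ[K] A ⊗[K] B}
    (hl : ∀ b, lam (b′) = ((lam b)′)) {g : A →ₐ[K] T} (hg : ∀ a, g (a′) = ((g a)′))
    {x : B →ₐ[K] T} (hx : ∀ b, x (b′) = ((x b)′)) (b : B) :
    actBy lam g x (b′) = ((actBy lam g x b)′) := by
  unfold actBy
  rw [AlgHom.comp_apply, AlgHom.comp_apply, hl]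
  generalize lam b = z
  induction z using TensorProduct.induction_on with
  | zero => simp
  | add x y hx hy => simp only [map_add, hx, hy]
  | tmul a b =>
    simp only [deriv_tmul, map_add, Algebra.TensorProduct.lift_tmul, hx, hg, Derivation.leibniz,
      smul_eq_mul]
    ring

/-- The coaction `lam : B → A ⊗ B` is Galois: `b ⊗ c ↦ lam(b) (1 ⊗ c)` is bijective. -/
def IsLeftGalois (lam : B →ₐ[K] A ⊗[K] B) : Prop :=
  Function.Bijective
    (Algebra.TensorProduct.lift lam Algebra.TensorProduct.includeRight (fun _ _ => .all ..) :
      B ⊗[K] B →ₐ[K] A ⊗[K] B)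

namespace IsLeftGalois

variable {lam : B →ₐ[K] A ⊗[K] B} (hl : IsLeftGalois lam)

/-- The Galois isomorphism. -/
def equiv : B ⊗[K] B ≃ₐ[K] A ⊗[K] B :=
  AlgEquiv.ofBijective _ hl

theorem equiv_tmul (b c : B) : hl.equiv (b ⊗ₜ c) = lam b * 1 ⊗ₜ c := rfl

theorem equiv_symm_one_tmul (c : B) : hl.equiv.symm (1 ⊗ₜ c) = 1 ⊗ₜ c := by
  rw [AlgEquiv.symm_apply_eq, equiv_tmul, map_one, one_mul]

/-- The point `x / y` of `Spec(A)`, with `(x / y) * y = x`. -/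
def ldiv (x y : B →ₐ[K] T) : A →ₐ[K] T :=
  (Algebra.TensorProduct.lift x y (fun _ _ => .all ..)).comp
    (hl.equiv.symm.toAlgHom.comp Algebra.TensorProduct.includeLeft)

theorem comp_ldiv (f : T →ₐ[K] T') (x y : B →ₐ[K] T) :
    f.comp (hl.ldiv x y) = hl.ldiv (f.comp x) (f.comp y) := by
  unfold ldiv
  rw [← AlgHom.comp_assoc]
  congr 1
  ext <;> simp

/-- The left Galois map is the comorphism of `(g, x) ↦ (g * x, x)`; existence and uniqueness of left
quotients follow by inverting it. -/
theorem lift_equiv (g : A →ₐ[K] T) (x : B →ₐ[K] T) :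
    (Algebra.TensorProduct.lift g x (fun _ _ => .all ..)).comp hl.equiv.toAlgHom =
      Algebra.TensorProduct.lift (actBy lam g x) x (fun _ _ => .all ..) := by
  ext b
  · simp [equiv_tmul, actBy, ← Algebra.TensorProduct.one_def]
  · simp [equiv_tmul]

theorem lift_ldiv (x y : B →ₐ[K] T) :
    Algebra.TensorProduct.lift (hl.ldiv x y) y (fun _ _ => .all ..) =
      (Algebra.TensorProduct.lift x y (fun _ _ => .all ..)).comp hl.equiv.symm.toAlgHom := by
  ext b
  · simp [ldiv]
  · simp [equiv_symm_one_tmul]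

theorem actBy_ldiv (x y : B →ₐ[K] T) : actBy lam (hl.ldiv x y) y = x := by
  have h := hl.lift_equiv (hl.ldiv x y) y
  rw [lift_ldiv] at h
  ext b
  simpa using (DFunLike.congr_fun h (b ⊗ₜ 1)).symm

include hl in
theorem actBy_cancel {g g' : A →ₐ[K] T} {x : B →ₐ[K] T}
    (h : actBy lam g x = actBy lam g' x) : g = g' := by
  have h1 := hl.lift_equiv g x
  rw [h, ← hl.lift_equiv] at h1
  ext a
  have := DFunLike.congr_fun h1 (hl.equiv.symm (a ⊗ₜ 1))
  simpa using this

theorem ldiv_actBy (g : A →ₐ[K] T) (x : B →ₐ[K] T) : hl.ldiv (actBy lam g x) x = g :=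
  hl.actBy_cancel (hl.actBy_ldiv _ _)

theorem ldiv_deriv [Differential K] [Differential A] [DifferentialAlgebra K A] [Differential B]
    [DifferentialAlgebra K B] [Differential T] (hd : ∀ b, lam (b′) = ((lam b)′))
    {x y : B →ₐ[K] T} (hx : ∀ b, x (b′) = ((x b)′)) (hy : ∀ b, y (b′) = ((y b)′)) (a : A) :
    hl.ldiv x y (a′) = ((hl.ldiv x y a)′) := by
  have h1 : ∀ z, hl.equiv (z′) = ((hl.equiv z)′) := by
    intro z
    induction z using TensorProduct.induction_on with
    | zero => simp
    | add x y hx hy => simp only [map_add, hx, hy]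
    | tmul a b =>
      simp only [deriv_tmul, map_add, equiv_tmul, hd, Derivation.leibniz, smul_eq_mul,
        Differential.deriv.map_one_eq_zero, TensorProduct.zero_tmul, zero_add]
      ring
  have h2 : (a′ ⊗ₜ 1 : A ⊗[K] B) = ((a ⊗ₜ 1)′) := by simp [deriv_tmul]
  change (Algebra.TensorProduct.lift x y (fun _ _ => .all ..)) (hl.equiv.symm (a′ ⊗ₜ 1)) =
    (((Algebra.TensorProduct.lift x y (fun _ _ => .all ..)) (hl.equiv.symm (a ⊗ₜ 1)))′)
  rw [h2, deriv_symm h1]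
  generalize hl.equiv.symm (a ⊗ₜ 1) = z
  induction z using TensorProduct.induction_on with
  | zero => simp
  | add x y hx hy => simp only [map_add, hx, hy]
  | tmul a b =>
    simp only [deriv_tmul, map_add, Algebra.TensorProduct.lift_tmul, hx, hy, Derivation.leibniz,
      smul_eq_mul]
    ring

end IsLeftGalois

end LeftGalois

/-! ### Left points of a bi-Galois algebra -/

section LeftAction

variable {K H : Type u} [Field K] [Differential K] [CommRing H] [Differential H]
  [HopfAlgebra K H] [DiffHopfAlgebra K H] {X : RightTorsor K H} (Y : BiGalois X)
  {T T' : Type u} [CommRing T] [Algebra K T] [CommRing T'] [Algebra K T']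

namespace BiGalois

theorem isLeftGalois : IsLeftGalois Y.lam := Y.galois

/-- The translate `g * x` of a point `x` of `X` by a point `g` of `G^X`. -/
def lmul (g : Y.carrier →ₐ[K] T) (x : X.carrier →ₐ[K] T) : X.carrier →ₐ[K] T :=
  actBy Y.lam g x

theorem comp_lmul (f : T →ₐ[K] T') (g : Y.carrier →ₐ[K] T) (x : X.carrier →ₐ[K] T) :
    f.comp (Y.lmul g x) = Y.lmul (f.comp g) (f.comp x) :=
  comp_actBy _ _ _ _

/-- The point `x / y` of `G^X`, with `(x / y) * y = x`. -/
def ldiv (x y : X.carrier →ₐ[K] T) : Y.carrier →ₐ[K] T :=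
  Y.isLeftGalois.ldiv x y

theorem comp_ldiv (f : T →ₐ[K] T') (x y : X.carrier →ₐ[K] T) :
    f.comp (Y.ldiv x y) = Y.ldiv (f.comp x) (f.comp y) :=
  Y.isLeftGalois.comp_ldiv _ _ _

theorem ldiv_lmul (x y : X.carrier →ₐ[K] T) : Y.lmul (Y.ldiv x y) y = x :=
  Y.isLeftGalois.actBy_ldiv _ _

theorem lmul_ldiv (g : Y.carrier →ₐ[K] T) (x : X.carrier →ₐ[K] T) : Y.ldiv (Y.lmul g x) x = g :=
  Y.isLeftGalois.ldiv_actBy _ _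

/-- The trivialization `T ⊗ B → T ⊗ H'`, `t ⊗ b ↦ t x(b₍₀₎) ⊗ b₍₋₁₎`, defined by a point `x`. -/
def ltriv (x : X.carrier →ₐ[K] T) : T ⊗[K] X.carrier →ₐ[T] T ⊗[K] Y.carrier :=
  liftAlg T (Y.lmul Algebra.TensorProduct.includeRight (Algebra.TensorProduct.includeLeft.comp x))

/-- The trivialization defined by a point is an isomorphism. -/
def ltrivEquiv (x : X.carrier →ₐ[K] T) : T ⊗[K] X.carrier ≃ₐ[T] T ⊗[K] Y.carrier :=
  AlgEquiv.ofAlgHom (Y.ltriv x)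
    (liftAlg T (Y.ldiv Algebra.TensorProduct.includeRight
      (Algebra.TensorProduct.includeLeft.comp x)))
    (by
      refine Algebra.TensorProduct.ext (by ext) ?_
      have h1 : ((Y.ltriv x).restrictScalars K).comp (Algebra.TensorProduct.includeLeft.comp x) =
          Algebra.TensorProduct.includeLeft.comp x := by
        ext b
        simp [ltriv, TensorProduct.smul_tmul', Algebra.TensorProduct.one_def]
      have h2 : ((Y.ltriv x).restrictScalars K).comp Algebra.TensorProduct.includeRight =
          Y.lmul Algebra.TensorProduct.includeRight
            (Algebra.TensorProduct.includeLeft.comp x) := by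
        ext b
        simp [ltriv]
      have h3 := Y.comp_ldiv ((Y.ltriv x).restrictScalars K) Algebra.TensorProduct.includeRight
        (Algebra.TensorProduct.includeLeft.comp x)
      rw [h1, h2, lmul_ldiv] at h3
      refine Eq.trans ?_ h3
      ext b
      simp)
    (by
      refine Algebra.TensorProduct.ext (by ext) ?_
      let m : T ⊗[K] Y.carrier →ₐ[T] T ⊗[K] X.carrier :=
        (liftAlg T (Y.ldiv Algebra.TensorProduct.includeRight
          (Algebra.TensorProduct.includeLeft.comp x)))
      have h1 : (m.restrictScalars K).comp (Algebra.TensorProduct.includeLeft.comp x) =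
          Algebra.TensorProduct.includeLeft.comp x := by
        ext b
        simp [m, TensorProduct.smul_tmul', Algebra.TensorProduct.one_def]
      have h2 : (m.restrictScalars K).comp Algebra.TensorProduct.includeRight =
          Y.ldiv Algebra.TensorProduct.includeRight
            (Algebra.TensorProduct.includeLeft.comp x) := by
        ext b
        simp [m]
      have h3 := Y.comp_lmul (m.restrictScalars K) Algebra.TensorProduct.includeRight
        (Algebra.TensorProduct.includeLeft.comp x)
      rw [h1, h2, ldiv_lmul] at h3
      refine Eq.trans ?_ h3
      ext b
      simp [ltriv, m])

theorem ltrivEquiv_apply (x : X.carrier →ₐ[K] T) (z : T ⊗[K] X.carrier) :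
    Y.ltrivEquiv x z = Y.ltriv x z := rfl

end BiGalois

end LeftAction

/-! ### Convolution actions and the comparison of the two groups -/

section LinearAction

variable {K H : Type u} [Field K] [Differential K] [CommRing H] [Differential H]
  [HopfAlgebra K H] [DiffHopfAlgebra K H] {X : RightTorsor K H} (Y : BiGalois X)
  {T T' : Type u} [CommRing T] [Algebra K T] [CommRing T'] [Algebra K T']

namespace BiGalois

/-- The left convolution action of linear maps `H' → T` on linear maps `B → T`. -/
def lactL (f : WithConv (Y.carrier →ₗ[K] T)) (φ : X.carrier →ₗ[K] T) : X.carrier →ₗ[K] T :=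
  LinearMap.mul' K T ∘ₗ TensorProduct.map f.ofConv φ ∘ₗ Y.lam.toLinearMap

end BiGalois

/-- The right convolution action of linear maps `H → T` on linear maps `B → T`. -/
def ractL (φ : X.carrier →ₗ[K] T) (g : WithConv (H →ₗ[K] T)) : X.carrier →ₗ[K] T :=
  LinearMap.mul' K T ∘ₗ TensorProduct.map φ g.ofConv ∘ₗ X.coact.toLinearMap

/-- Coassociativity for arbitrary linear functionals instead of algebra maps. Derivations are not
points, so the action must be extended to the whole convolution algebra. -/
theorem ractL_mul (φ : X.carrier →ₗ[K] T) (f g : WithConv (H →ₗ[K] T)) :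
    ractL φ (f * g) = ractL (ractL φ f) g := by
  have h : LinearMap.mul' K T ∘ₗ TensorProduct.map (LinearMap.mul' K T ∘ₗ
      TensorProduct.map φ f.ofConv) g.ofConv = LinearMap.mul' K T ∘ₗ
      TensorProduct.map φ (LinearMap.mul' K T ∘ₗ TensorProduct.map f.ofConv g.ofConv) ∘ₗ
        (TensorProduct.assoc K X.carrier H H).toLinearMap := by
    ext a b c
    simp [mul_assoc]
  ext b
  have h1 := LinearMap.congr_fun h
    (Algebra.TensorProduct.map X.coact (AlgHom.id K H) (X.coact b))
  have h2 := congrArg (LinearMap.mul' K T ∘ₗ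
      TensorProduct.map φ (LinearMap.mul' K T ∘ₗ TensorProduct.map f.ofConv g.ofConv)) (X.coassoc b)
  have h3 : ∀ w : X.carrier ⊗[K] H, (LinearMap.mul' K T ∘ₗ TensorProduct.map φ
      (LinearMap.mul' K T ∘ₗ TensorProduct.map f.ofConv g.ofConv))
      (Algebra.TensorProduct.map (AlgHom.id K X.carrier) (Bialgebra.comulAlgHom K H) w) =
      LinearMap.mul' K T (TensorProduct.map φ (f * g).ofConv w) := by
    intro w
    induction w using TensorProduct.induction_on with
    | zero => simp
    | add x y hx hy => simp only [map_add, hx, hy]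
    | tmul a h => simp
  have h4 : ∀ w : X.carrier ⊗[K] H, (LinearMap.mul' K T ∘ₗ TensorProduct.map (LinearMap.mul' K T ∘ₗ
      TensorProduct.map φ f.ofConv) g.ofConv)
      (Algebra.TensorProduct.map X.coact (AlgHom.id K H) w) =
      LinearMap.mul' K T (TensorProduct.map (ractL φ f) g.ofConv w) := by
    intro w
    induction w using TensorProduct.induction_on with
    | zero => simp
    | add x y hx hy => simp only [map_add, hx, hy]
    | tmul a h => simp; rfl
  exact (h3 _).symm.trans (h2.symm.trans (h1.symm.trans (h4 _)))

theorem ractL_toLin (x : X.carrier →ₐ[K] T) (g : WithConv (H →ₐ[K] T)) :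
    ractL x.toLinearMap (toLin g) = (pmul x g).toLinearMap := by
  ext b
  change (LinearMap.mul' K T ∘ₗ TensorProduct.map x.toLinearMap g.ofConv.toLinearMap) (X.coact b) =
    (Algebra.TensorProduct.lift x g.ofConv (fun _ _ => .all ..)).toLinearMap (X.coact b)
  congr 1
  ext ; simp

theorem linT_triv (x : X.carrier →ₐ[K] T) (g : WithConv (H →ₗ[K] T)) (b : X.carrier) :
    linT g (triv x (1 ⊗ₜ b)) = ractL x.toLinearMap g b := by
  rw [triv_one_tmul]
  change (linT g) _ = LinearMap.mul' K T (TensorProduct.map x.toLinearMap g.ofConv (X.coact b))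
  generalize X.coact b = w
  induction w using TensorProduct.induction_on with
  | zero => simp
  | add x y hx hy => simp only [map_add, hx, hy]
  | tmul a h => simp [linT_tmul]

namespace BiGalois

theorem lactL_mul (f g : WithConv (Y.carrier →ₗ[K] T)) (φ : X.carrier →ₗ[K] T) :
    Y.lactL (f * g) φ = Y.lactL f (Y.lactL g φ) := by
  have h : LinearMap.mul' K T ∘ₗ TensorProduct.map (LinearMap.mul' K T ∘ₗ
      TensorProduct.map f.ofConv g.ofConv) φ = LinearMap.mul' K T ∘ₗ
      TensorProduct.map f.ofConv (LinearMap.mul' K T ∘ₗ TensorProduct.map g.ofConv φ) ∘ₗ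
        (TensorProduct.assoc K Y.carrier Y.carrier X.carrier).toLinearMap := by
    ext a b c
    simp [mul_assoc]
  ext b
  have h1 := LinearMap.congr_fun h (Algebra.TensorProduct.map (Bialgebra.comulAlgHom K Y.carrier)
    (AlgHom.id K X.carrier) (Y.lam b))
  have h2 := congrArg (LinearMap.mul' K T ∘ₗ
      TensorProduct.map f.ofConv (LinearMap.mul' K T ∘ₗ TensorProduct.map g.ofConv φ)) (Y.coassoc b)
  have h3 : ∀ w : Y.carrier ⊗[K] X.carrier, (LinearMap.mul' K T ∘ₗ TensorProduct.map
      (LinearMap.mul' K T ∘ₗ TensorProduct.map f.ofConv g.ofConv) φ)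
      (Algebra.TensorProduct.map (Bialgebra.comulAlgHom K Y.carrier) (AlgHom.id K X.carrier) w) =
      LinearMap.mul' K T (TensorProduct.map (f * g).ofConv φ w) := by
    intro w
    induction w using TensorProduct.induction_on with
    | zero => simp
    | add x y hx hy => simp only [map_add, hx, hy]
    | tmul a h => simp
  have h4 : ∀ w : Y.carrier ⊗[K] X.carrier, (LinearMap.mul' K T ∘ₗ TensorProduct.map f.ofConv
      (LinearMap.mul' K T ∘ₗ TensorProduct.map g.ofConv φ))
      (Algebra.TensorProduct.map (AlgHom.id K Y.carrier) Y.lam w) =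
      LinearMap.mul' K T (TensorProduct.map f.ofConv (Y.lactL g φ) w) := by
    intro w
    induction w using TensorProduct.induction_on with
    | zero => simp
    | add x y hx hy => simp only [map_add, hx, hy]
    | tmul a h => simp; rfl
  exact (h3 _).symm.trans (h1.trans (h2.trans (h4 _)))

/-- The compatibility `lam_coact` of the two coactions, for functionals. The comparison of the
brackets and the appearance of the adjoint action both rest on it. -/
theorem lactL_ractL (f : WithConv (Y.carrier →ₗ[K] T)) (φ : X.carrier →ₗ[K] T)
    (g : WithConv (H →ₗ[K] T)) : Y.lactL f (ractL φ g) = ractL (Y.lactL f φ) g := by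
  have h : LinearMap.mul' K T ∘ₗ TensorProduct.map (LinearMap.mul' K T ∘ₗ
      TensorProduct.map f.ofConv φ) g.ofConv = LinearMap.mul' K T ∘ₗ
      TensorProduct.map f.ofConv (LinearMap.mul' K T ∘ₗ TensorProduct.map φ g.ofConv) ∘ₗ
        (TensorProduct.assoc K Y.carrier X.carrier H).toLinearMap := by
    ext a b c
    simp [mul_assoc]
  ext b
  have h1 := LinearMap.congr_fun h (Algebra.TensorProduct.map Y.lam
    (AlgHom.id K H) (X.coact b))
  have h2 := congrArg (LinearMap.mul' K T ∘ₗ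
      TensorProduct.map f.ofConv (LinearMap.mul' K T ∘ₗ TensorProduct.map φ g.ofConv))
      (Y.lam_coact b)
  have h3 : ∀ w : Y.carrier ⊗[K] X.carrier, (LinearMap.mul' K T ∘ₗ TensorProduct.map f.ofConv
      (LinearMap.mul' K T ∘ₗ TensorProduct.map φ g.ofConv))
      (Algebra.TensorProduct.map (AlgHom.id K Y.carrier) X.coact w) =
      LinearMap.mul' K T (TensorProduct.map f.ofConv (ractL φ g) w) := by
    intro w
    induction w using TensorProduct.induction_on with
    | zero => simp
    | add x y hx hy => simp only [map_add, hx, hy]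
    | tmul a h => simp; rfl
  have h4 : ∀ w : X.carrier ⊗[K] H, (LinearMap.mul' K T ∘ₗ TensorProduct.map
      (LinearMap.mul' K T ∘ₗ TensorProduct.map f.ofConv φ) g.ofConv)
      (Algebra.TensorProduct.map Y.lam (AlgHom.id K H) w) =
      LinearMap.mul' K T (TensorProduct.map (Y.lactL f φ) g.ofConv w) := by
    intro w
    induction w using TensorProduct.induction_on with
    | zero => simp
    | add x y hx hy => simp only [map_add, hx, hy]
    | tmul a h => simp; rfl
  exact (h3 _).symm.trans (h2.symm.trans (h1.symm.trans (h4 _)))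

theorem ltriv_one_tmul (x : X.carrier →ₐ[K] T) (b : X.carrier) :
    Y.ltriv x (1 ⊗ₜ b) = Algebra.TensorProduct.lift
      (Algebra.TensorProduct.includeRight : Y.carrier →ₐ[K] T ⊗[K] Y.carrier)
      (Algebra.TensorProduct.includeLeft.comp x) (fun _ _ => .all ..) (Y.lam b) := by
  simp [ltriv, lmul, actBy]

theorem linT_ltriv (x : X.carrier →ₐ[K] T) (f : WithConv (Y.carrier →ₗ[K] T)) (b : X.carrier) :
    linT f (Y.ltriv x (1 ⊗ₜ b)) = Y.lactL f x.toLinearMap b := by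
  rw [ltriv_one_tmul]
  change (linT f) _ = LinearMap.mul' K T (TensorProduct.map f.ofConv x.toLinearMap (Y.lam b))
  generalize Y.lam b = w
  induction w using TensorProduct.induction_on with
  | zero => simp
  | add x y hx hy => simp only [map_add, hx, hy]
  | tmul a h =>
    simp [linT_tmul]
    exact mul_comm _ _

/-- The action of a functional on `x` is its composite with `ltriv x`, which is surjective;
identities in the convolution algebra of `H'` can thus be tested on one point. -/
theorem lactL_cancel {f f' : WithConv (Y.carrier →ₗ[K] T)} {x : X.carrier →ₐ[K] T}
    (h : Y.lactL f x.toLinearMap = Y.lactL f' x.toLinearMap) : f = f' := by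
  have h1 : linT f ∘ₗ (Y.ltriv x).toLinearMap = linT f' ∘ₗ (Y.ltriv x).toLinearMap := by
    ext b
    change linT f (Y.ltriv x (1 ⊗ₜ b)) = linT f' (Y.ltriv x (1 ⊗ₜ b))
    rw [linT_ltriv, linT_ltriv, h]
  ext a
  obtain ⟨z, hz⟩ := (Y.ltrivEquiv x).surjective (1 ⊗ₜ a)
  rw [ltrivEquiv_apply] at hz
  have h2 : linT f (Y.ltriv x z) = linT f' (Y.ltriv x z) := LinearMap.congr_fun h1 z
  rw [hz, linT_tmul, linT_tmul, one_mul, one_mul] at h2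
  exact h2

/-- The isomorphism `T ⊗ H' ≃ T ⊗ H` defined by a point. -/
def compare (x : X.carrier →ₐ[K] T) : T ⊗[K] Y.carrier ≃ₐ[T] T ⊗[K] H :=
  (Y.ltrivEquiv x).symm.trans (AlgEquiv.ofBijective (triv x) (X.isGalois.triv_bijective x))

theorem compare_ltriv (x : X.carrier →ₐ[K] T) (z : T ⊗[K] X.carrier) :
    Y.compare x (Y.ltriv x z) = triv x z := by
  rw [← ltrivEquiv_apply]
  change triv x ((Y.ltrivEquiv x).symm (Y.ltrivEquiv x z)) = _
  rw [AlgEquiv.symm_apply_apply]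

theorem compare_unique {x : X.carrier →ₐ[K] T} {A : Type*} [CommRing A] [Algebra T A]
    {f g : T ⊗[K] Y.carrier →ₐ[T] A}
    (h : ∀ b, f (Y.ltriv x (1 ⊗ₜ b)) = g (Y.ltriv x (1 ⊗ₜ b))) : f = g := by
  let _ : Algebra K A := ((algebraMap T A).comp (algebraMap K T)).toAlgebra
  have : IsScalarTower K T A := IsScalarTower.of_algebraMap_eq' rfl
  have h1 : f.comp (Y.ltriv x) = g.comp (Y.ltriv x) := by
    refine Algebra.TensorProduct.ext (by ext) ?_
    ext b
    exact h b
  ext a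
  obtain ⟨z, hz⟩ := (Y.ltrivEquiv x).surjective (1 ⊗ₜ a)
  rw [ltrivEquiv_apply] at hz
  have := DFunLike.congr_fun h1 z
  simpa [hz] using this

/-- Both identities act trivially: `x * 1 = x = 1 * x`. -/
theorem counitT_compare (x : X.carrier →ₐ[K] T) :
    (counitT K H T).comp (Y.compare x).toAlgHom = counitT K Y.carrier T := by
  refine Y.compare_unique (x := x) fun b => ?_
  change counitT K H T (Y.compare x (Y.ltriv x (1 ⊗ₜ b))) = _
  rw [compare_ltriv]
  refine (counit_triv x b).trans ?_
  rw [ltriv_one_tmul]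
  have h := congrArg x (Y.counit b)
  refine h.symm.trans ?_
  generalize Y.lam b = w
  induction w using TensorProduct.induction_on with
  | zero => simp
  | add x y hx hy => simp only [map_add, hx, hy]
  | tmul a c => simp [counitT_tmul, mul_comm, Algebra.smul_def]

/-- The transport of derivations from `G` to `G^X` defined by a point of `X`. -/
def transport (x : X.carrier →ₐ[K] T) : derLie K H T ≃ₗ[T] derLie K Y.carrier T :=
  derTransport (Y.compare x) (Y.counitT_compare x)

/-- The relation `c_x(D) * x = x * D`, which together with `lactL_cancel` characterizes the
transport. -/
theorem lactL_transLin (x : X.carrier →ₐ[K] T) (D : WithConv (H →ₗ[K] T)) :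
    Y.lactL (transLin (Y.compare x).toAlgHom.toLinearMap D) x.toLinearMap =
      ractL x.toLinearMap D := by
  ext b
  rw [← linT_ltriv, linT_transLin, ← linT_triv]
  exact congrArg (linT D) (Y.compare_ltriv x _)

/-- Write `c` for `c_x`. Then `c(D) c(E) x = c(D) x E = x D E = c(DE) x`, by commutation of the two
actions. -/
theorem transLin_mul (x : X.carrier →ₐ[K] T) (D E : WithConv (H →ₗ[K] T)) :
    transLin (Y.compare x).toAlgHom.toLinearMap (D * E) =
      transLin (Y.compare x).toAlgHom.toLinearMap D *
        transLin (Y.compare x).toAlgHom.toLinearMap E := by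
  apply Y.lactL_cancel (x := x)
  rw [lactL_transLin, lactL_mul, lactL_transLin, lactL_ractL, lactL_transLin, ractL_mul]

theorem transport_lie (x : X.carrier →ₐ[K] T) (D E : derLie K H T) :
    Y.transport x ⁅D, E⁆ = ⁅Y.transport x D, Y.transport x E⁆ := by
  apply Subtype.ext
  change transLin _ (D.1 * E.1 - E.1 * D.1) = transLin _ D.1 * transLin _ E.1 -
    transLin _ E.1 * transLin _ D.1
  rw [map_sub, transLin_mul, transLin_mul]

/-- Translating the point by `γ` amounts to composition with the adjoint action of `γ`. -/
theorem transport_pmul (x : X.carrier →ₐ[K] T) (γ : WithConv (H →ₐ[K] T)) (D : derLie K H T) :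
    Y.transport (pmul x γ) D = Y.transport x (conj γ D) := by
  apply Subtype.ext
  apply Y.lactL_cancel (x := pmul x γ)
  change Y.lactL (transLin _ D.1) _ = Y.lactL (transLin _ (toLin γ * D.1 * toLin γ⁻¹)) _
  -- The right side applied to `xγ` is `c_x(γDγ⁻¹) xγ = x(γDγ⁻¹)γ = (xγ)D`, which is the left side
  -- applied to `xγ`.
  rw [lactL_transLin, ← ractL_toLin, lactL_ractL, lactL_transLin, ← ractL_mul, ← ractL_mul,
    mul_assoc _ _ (toLin γ), ← map_mul, inv_mul_cancel, map_one, mul_one]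

end BiGalois

end LinearAction

/-! ### The Lie algebra of the left group as a twisted form -/

section GaloisTwist

variable {K H : Type u} [Field K] [Differential K] [CommRing H] [Differential H]
  [HopfAlgebra K H] [DiffHopfAlgebra K H] {X : RightTorsor K H} (Y : BiGalois X)
  {T T' : Type u} [CommRing T] [Differential T] [Algebra K T] [DifferentialAlgebra K T]
  [CommRing T'] [Differential T'] [Algebra K T'] [DifferentialAlgebra K T']

namespace BiGalois

theorem ltriv_deriv {x : X.carrier →ₐ[K] T} (hx : ∀ b, x (b′) = ((x b)′))
    (z : T ⊗[K] X.carrier) : Y.ltriv x (z′) = ((Y.ltriv x z)′) := by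
  refine liftAlg_deriv (A := T ⊗[K] Y.carrier) (fun b => ?_) z
  have key : ∀ w : Y.carrier ⊗[K] X.carrier, Algebra.TensorProduct.lift
      (Algebra.TensorProduct.includeRight : Y.carrier →ₐ[K] T ⊗[K] Y.carrier)
      (Algebra.TensorProduct.includeLeft.comp x) (fun _ _ => .all ..) (w′) =
      ((Algebra.TensorProduct.lift
      (Algebra.TensorProduct.includeRight : Y.carrier →ₐ[K] T ⊗[K] Y.carrier)
      (Algebra.TensorProduct.includeLeft.comp x) (fun _ _ => .all ..) w)′) := by
    intro w
    induction w using TensorProduct.induction_on with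
    | zero => simp
    | add x y hx hy => simp only [map_add, hx, hy]
    | tmul a c => simp [deriv_tmul, hx, add_comm]
  exact (congrArg _ (Y.lam_deriv b)).trans (key _)

theorem compare_deriv {x : X.carrier →ₐ[K] T} (hx : ∀ b, x (b′) = ((x b)′))
    (z : T ⊗[K] Y.carrier) : Y.compare x (z′) = ((Y.compare x z)′) := by
  have h := deriv_symm (e := Y.ltrivEquiv x) (Y.ltriv_deriv hx) z
  exact (congrArg (triv x) h).trans (triv_deriv hx _)

theorem transport_del {x : X.carrier →ₐ[K] T} (hx : ∀ b, x (b′) = ((x b)′)) (D : derLie K H T) :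
    Y.transport x (DiffModule.del T D) = DiffModule.del T (Y.transport x D) :=
  Subtype.ext (convDel_transLin (Y.compare_deriv hx) D.1).symm

/-- Over `B` the universal point identifies `H'` with `H`, and finite type descends along the
faithfully flat extension `B`. It is needed to identify `T ⊗ 𝔤^X` with `Der_ε(H', T)`. -/
theorem finiteType [Algebra.FiniteType K H] : Algebra.FiniteType K Y.carrier := by
  have h : Algebra.FiniteType X.carrier (X.carrier ⊗[K] Y.carrier) :=
    Algebra.FiniteType.equiv (inferInstance : Algebra.FiniteType X.carrier (X.carrier ⊗[K] H))
      (Y.compare (AlgHom.id K X.carrier)).symm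
  exact Algebra.FiniteType.of_finiteType_tensorProduct_of_faithfullyFlat X.carrier

omit [DifferentialAlgebra K T] [DifferentialAlgebra K T'] in
theorem compare_comp (f : DAlgHom K T T') (x : X.carrier →ₐ[K] T) (h : Y.carrier) :
    Y.compare (f.toAlgHom.comp x) (1 ⊗ₜ h) =
      Algebra.TensorProduct.map f.toAlgHom (AlgHom.id K H) (Y.compare x (1 ⊗ₜ h)) := by
  let q := (Y.compare (f.toAlgHom.comp x)).toLinearMap
  let p := (Y.compare x).toLinearMap
  suffices q = extendAlong f p by
    have h1 := LinearMap.congr_fun this (1 ⊗ₜ h)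
    rw [extendAlong_tmul, one_smul] at h1
    exact h1
  -- Both trivializations are natural in the point. As `compare` carries one to the other, its
  -- naturality follows by cancelling the surjective `ltriv`.
  have h2 : extendAlong f (Y.ltriv x).toLinearMap = (Y.ltriv (f.toAlgHom.comp x)).toLinearMap := by
    ext b
    change extendAlong f (Y.ltriv x).toLinearMap (1 ⊗ₜ b) = Y.ltriv (f.toAlgHom.comp x) (1 ⊗ₜ b)
    rw [extendAlong_tmul, one_smul, ltriv_one_tmul]
    change Algebra.TensorProduct.map f.toAlgHom (AlgHom.id K Y.carrier) (Y.ltriv x (1 ⊗ₜ b)) = _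
    rw [ltriv_one_tmul, ← AlgHom.comp_apply]
    congr 1
    ext <;> simp
  have h3 : p ∘ₗ (Y.ltriv x).toLinearMap = (triv x).toLinearMap :=
    LinearMap.ext fun z => Y.compare_ltriv x z
  have h4 : q ∘ₗ (Y.ltriv (f.toAlgHom.comp x)).toLinearMap =
      (triv (f.toAlgHom.comp x)).toLinearMap :=
    LinearMap.ext fun z => Y.compare_ltriv _ z
  have h5 := congrArg (extendAlong f) h3
  rw [extendAlong_comp, extendAlong_triv, ← h4, h2] at h5
  exact ((LinearMap.cancel_right (Y.ltrivEquiv (f.toAlgHom.comp x)).surjective).1 h5).symm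

variable [Algebra.FiniteType K H]

/-- The isomorphism `T ⊗ 𝔤 ≃ T ⊗ 𝔤^X` defined by a point of `X`. -/
def lieIso (x : X.carrier →ₐ[K] T) : T ⊗[K] HopfLie K H ≃ₗ[T] T ⊗[K] HopfLie K Y.carrier :=
  have := Y.finiteType
  (derEquiv K H T).trans ((Y.transport x).trans (derEquiv K Y.carrier T).symm)

omit [Differential T] [DifferentialAlgebra K T] in
theorem derBaseChange_lieIso (x : X.carrier →ₐ[K] T) (z : T ⊗[K] HopfLie K H) :
    derBaseChange K Y.carrier T (Y.lieIso x z) = Y.transport x (derBaseChange K H T z) :=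
  have := Y.finiteType
  (derEquiv K Y.carrier T).apply_symm_apply _

theorem lieIso_isDiffLieIso {x : X.carrier →ₐ[K] T} (hx : ∀ b, x (b′) = ((x b)′)) :
    IsDiffLieIso (Y.lieIso x) := by
  have := Y.finiteType
  have hinj := (derBaseChange_bijective (K := K) (H := Y.carrier) (T := T)).1
  refine ⟨fun a b => hinj ?_, fun a => hinj ?_⟩
  · rw [derBaseChange_lie, derBaseChange_lieIso, derBaseChange_lieIso, derBaseChange_lieIso,
      derBaseChange_lie, transport_lie]
  · rw [derBaseChange_del, derBaseChange_lieIso, derBaseChange_lieIso, derBaseChange_del,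
      transport_del Y hx]

omit [Differential T] [DifferentialAlgebra K T] in
-- `transport_pmul` carried over to `T ⊗ 𝔤`; the adjoint action enters the theorem here.
theorem lieIso_pmul (x : X.carrier →ₐ[K] T) (γ : WithConv (H →ₐ[K] T))
    (z : T ⊗[K] HopfLie K H) : Y.lieIso (pmul x γ) z = Y.lieIso x (adEquiv γ z) := by
  have := Y.finiteType
  apply (derBaseChange_bijective (K := K) (H := Y.carrier) (T := T)).1
  rw [derBaseChange_lieIso, derBaseChange_lieIso, transport_pmul, derBaseChange_adEquiv]

omit [DifferentialAlgebra K T] [DifferentialAlgebra K T'] in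
theorem lieIso_comp (f : DAlgHom K T T') (x : X.carrier →ₐ[K] T) :
    extendAlong f (Y.lieIso x).toLinearMap = (Y.lieIso (f.toAlgHom.comp x)).toLinearMap := by
  have := Y.finiteType
  refine extendAlong_unique f fun z => ?_
  rw [extendAlong_rTensor]
  apply (derBaseChange_bijective (K := K) (H := Y.carrier) (T := T')).1
  change derBaseChange K Y.carrier T' (f.toAlgHom.toLinearMap.rTensor _ (Y.lieIso x z)) =
    derBaseChange K Y.carrier T' (Y.lieIso (f.toAlgHom.comp x) _)
  rw [derBaseChange_lieIso]
  apply Subtype.ext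
  ext h
  refine (derBaseChange_rTensor f (Y.lieIso x z) h).trans ?_
  rw [derBaseChange_lieIso]
  change f.toAlgHom (linT (derBaseChange K H T z).1 (Y.compare x (1 ⊗ₜ h))) =
    linT (derBaseChange K H T' (f.toAlgHom.toLinearMap.rTensor _ z)).1
      (Y.compare (f.toAlgHom.comp x) (1 ⊗ₜ h))
  rw [compare_comp]
  generalize Y.compare x (1 ⊗ₜ h) = w
  induction w using TensorProduct.induction_on with
  | zero => simp
  | add x y hx hy => simp only [map_add, hx, hy]
  | tmul t a =>
    rw [Algebra.TensorProduct.map_tmul, linT_tmul, linT_tmul, map_mul]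
    exact congrArg _ (derBaseChange_rTensor f z a).symm

theorem isTwistedForm [Nontrivial T] {x : X.carrier →ₐ[K] T} (hx : ∀ b, x (b′) = ((x b)′)) :
    IsTwistedForm K (HopfLie K H) (HopfLie K Y.carrier) :=
  ⟨T, inferInstance, inferInstance, inferInstance, inferInstance, inferInstance, Y.lieIso x,
    Y.lieIso_isDiffLieIso hx⟩

/-- If the torsor `X` is given by `γ`, then `Lie(G^X)` is given by `Ad γ`. -/
theorem isGivenBy {S : Type u} [CommRing S] [Differential S] [Algebra K S]
    [DifferentialAlgebra K S] {γ : Cocycle S (specFunctor K H)} (h : X.IsGivenBy γ)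
    (hY : IsTwistedForm K (HopfLie K H) (HopfLie K Y.carrier))
    (σ : Cocycle S (autFunctor K (HopfLie K H))) (hσ : σ.1 = (adNat K H).app _ γ.1) :
    ({ carrier := HopfLie K Y.carrier, isForm := hY } : LieForm K (HopfLie K H)).IsGivenBy σ := by
  obtain ⟨x, hx, h⟩ := RightTorsor.isGivenBy_iff.1 h
  refine ⟨Y.lieIso x, Y.lieIso_isDiffLieIso hx, ?_⟩
  -- With `Ψ = lieIso x`, the extension `d₂ Ψ` is `lieIso (d₂ x) = lieIso (d₁ x * γ)`, which is `d₁
  -- Ψ ∘ Ad γ`.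
  rw [lieIso_comp, lieIso_comp, h, hσ]
  exact LinearMap.ext fun z => Y.lieIso_pmul _ _ z

end BiGalois

end GaloisTwist

/-! ### The group acting on a torsor from the left -/

section LeftGroup

variable {K H : Type u} [Field K] [Differential K] [CommRing H] [Differential H]
  [HopfAlgebra K H] [DiffHopfAlgebra K H] {X : RightTorsor K H}
  {A : Type u} [CommRing A] [Algebra K A]
  {lam : X.carrier →ₐ[K] A ⊗[K] X.carrier}
  {T T' : Type u} [CommRing T] [Algebra K T] [CommRing T'] [Algebra K T']

variable (lam) in
/-- The coaction `lam` commutes with the right coaction. -/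
def CommutesWithCoact : Prop :=
  ∀ b : X.carrier, Algebra.TensorProduct.assoc K K K A X.carrier H
      (Algebra.TensorProduct.map lam (AlgHom.id K H) (X.coact b)) =
    Algebra.TensorProduct.map (AlgHom.id K A) X.coact (lam b)

/-- The map `f` is a triple of points `(g, x, h)`. This side of the bicomodule identity reads `(g *
x) * h`; the side in `comp_map_coact_lam` reads `g * (x * h)`. -/
theorem comp_map_lam_coact (f : A ⊗[K] (X.carrier ⊗[K] H) →ₐ[K] T) :
    (f.comp ((Algebra.TensorProduct.assoc K K K A X.carrier H).toAlgHom.comp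
      (Algebra.TensorProduct.map lam (AlgHom.id K H)))).comp X.coact =
    pmul (actBy lam (f.comp Algebra.TensorProduct.includeLeft)
      (f.comp (Algebra.TensorProduct.includeRight.comp Algebra.TensorProduct.includeLeft)))
      (toConv (f.comp (Algebra.TensorProduct.includeRight.comp
        Algebra.TensorProduct.includeRight))) := by
  have h2 : Algebra.TensorProduct.lift (f.comp Algebra.TensorProduct.includeLeft)
      (f.comp (Algebra.TensorProduct.includeRight.comp Algebra.TensorProduct.includeLeft))
      (fun _ _ => .all ..) =
      (f.comp (Algebra.TensorProduct.assoc K K K A X.carrier H).toAlgHom).comp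
        Algebra.TensorProduct.includeLeft := by
    ext <;> simp [Algebra.TensorProduct.one_def]
  unfold pmul actBy
  congr 1
  rw [h2]
  ext <;> simp [Algebra.TensorProduct.one_def]

theorem comp_map_coact_lam (f : A ⊗[K] (X.carrier ⊗[K] H) →ₐ[K] T) :
    (f.comp (Algebra.TensorProduct.map (AlgHom.id K A) X.coact)).comp lam =
    actBy lam (f.comp Algebra.TensorProduct.includeLeft)
      (pmul (f.comp (Algebra.TensorProduct.includeRight.comp Algebra.TensorProduct.includeLeft))
        (toConv (f.comp (Algebra.TensorProduct.includeRight.comp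
          Algebra.TensorProduct.includeRight)))) := by
  have h2 : Algebra.TensorProduct.lift
      (f.comp (Algebra.TensorProduct.includeRight.comp Algebra.TensorProduct.includeLeft))
      (toConv (f.comp (Algebra.TensorProduct.includeRight.comp
        Algebra.TensorProduct.includeRight))).ofConv (fun _ _ => .all ..) = f.comp Algebra.TensorProduct.includeRight := by
    ext <;> simp
  unfold pmul actBy
  congr 1
  rw [h2]
  ext <;> simp

theorem CommutesWithCoact.actBy_pmul (hc : CommutesWithCoact lam) (g : A →ₐ[K] T)
    (x : X.carrier →ₐ[K] T) (h : WithConv (H →ₐ[K] T)) :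
    actBy lam g (pmul x h) = pmul (actBy lam g x) h := by
  let f : A ⊗[K] (X.carrier ⊗[K] H) →ₐ[K] T := Algebra.TensorProduct.lift g
    (Algebra.TensorProduct.lift x h.ofConv (fun _ _ => .all ..)) (fun _ _ => .all ..)
  have h1 : f.comp Algebra.TensorProduct.includeLeft = g := by ext; simp [f]
  have h2 : f.comp (Algebra.TensorProduct.includeRight.comp Algebra.TensorProduct.includeLeft) =
      x := by ext; simp [f]
  have h3 : f.comp (Algebra.TensorProduct.includeRight.comp Algebra.TensorProduct.includeRight) =
      h.ofConv := by ext; simp [f]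
  have h4 := comp_map_lam_coact (lam := lam) f
  have h5 := comp_map_coact_lam (lam := lam) f
  rw [h1, h2, h3] at h4 h5
  ext b
  exact (DFunLike.congr_fun h5 b).symm.trans
    ((congrArg f (hc b)).symm.trans (DFunLike.congr_fun h4 b))

theorem commutesWithCoact_of_actBy_pmul
    (h : ∀ (T : Type u) [CommRing T] [Algebra K T] (g : A →ₐ[K] T) (x : X.carrier →ₐ[K] T)
      (k : WithConv (H →ₐ[K] T)), actBy lam g (pmul x k) = pmul (actBy lam g x) k) :
    CommutesWithCoact lam := by
  intro b
  -- The universal triple of points lives over this ring.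
  let T := A ⊗[K] (X.carrier ⊗[K] H)
  have h1 := comp_map_lam_coact (lam := lam) (T := T) (AlgHom.id K T)
  have h2 := comp_map_coact_lam (lam := lam) (T := T) (AlgHom.id K T)
  exact (DFunLike.congr_fun h1 b).trans ((DFunLike.congr_fun (h T _ _ _) b).symm.trans
    (DFunLike.congr_fun h2 b).symm)

variable (hl : IsLeftGalois lam) (hc : CommutesWithCoact lam)

include hc in
-- If `g * y = x` then `g * (y * h) = x * h`, and `g` is unique.
theorem IsLeftGalois.ldiv_pmul (x y : X.carrier →ₐ[K] T) (h : WithConv (H →ₐ[K] T)) :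
    hl.ldiv (pmul x h) (pmul y h) = hl.ldiv x y :=
  hl.actBy_cancel (x := pmul y h) (by rw [hl.actBy_ldiv, hc.actBy_pmul, hl.actBy_ldiv])

include hl in
theorem IsLeftGalois.eq_of_actBy_universal {g g' : A →ₐ[K] T}
    (h : actBy lam ((Algebra.TensorProduct.includeRight : T →ₐ[K] X.carrier ⊗[K] T).comp g)
        Algebra.TensorProduct.includeLeft =
      actBy lam ((Algebra.TensorProduct.includeRight : T →ₐ[K] X.carrier ⊗[K] T).comp g')
        Algebra.TensorProduct.includeLeft) : g = g' := by
  have h1 := hl.actBy_cancel h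
  ext a
  exact one_tmul_injective (K := K) (A := X.carrier) (DFunLike.congr_fun h1 a)

/-- `T`-points of the left group correspond to `G`-equivariant families of maps from `X` to
itself over `T`, represented by their value `p` at the universal point. -/
theorem IsLeftGalois.exists_point (hl : IsLeftGalois lam) (hc : CommutesWithCoact lam)
    (p : X.carrier →ₐ[K] X.carrier ⊗[K] T)
    (hp : ∀ (T' : Type u) [CommRing T'] [Algebra K T'] (f : T →ₐ[K] T')
      (x : X.carrier →ₐ[K] T') (h : WithConv (H →ₐ[K] T')),
      (Algebra.TensorProduct.lift (pmul x h) f (fun _ _ => .all ..)).comp p =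
        pmul ((Algebra.TensorProduct.lift x f (fun _ _ => .all ..)).comp p) h) :
    ∃ δ : A →ₐ[K] T,
      (∀ a, (1 ⊗ₜ δ a : X.carrier ⊗[K] T) =
        hl.ldiv p Algebra.TensorProduct.includeLeft a) ∧
      ∀ (T' : Type u) [CommRing T'] [Algebra K T'] (f : T →ₐ[K] T') (x : X.carrier →ₐ[K] T'),
        actBy lam (f.comp δ) x =
          (Algebra.TensorProduct.lift x f (fun _ _ => .all ..)).comp p := by
  let B := X.carrier
  -- The group element that moves the universal point to its image `p`. A priori it depends on the
  -- point of `X`.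
  let g : A →ₐ[K] B ⊗[K] T := hl.ldiv p Algebra.TensorProduct.includeLeft
  have hg : ∀ (T' : Type u) [CommRing T'] [Algebra K T'] (f : T →ₐ[K] T')
      (x : B →ₐ[K] T'), (Algebra.TensorProduct.lift x f (fun _ _ => .all ..)).comp g =
        hl.ldiv ((Algebra.TensorProduct.lift x f (fun _ _ => .all ..)).comp p) x := by
    intro T' _ _ f x
    refine (hl.comp_ldiv _ _ _).trans ?_
    congr 1
    ext b
    simp
  -- Any two points are `G`-translates of each other and the family is equivariant, so the element
  -- does not depend on the point.
  have hind : ∀ (T' : Type u) [CommRing T'] [Algebra K T'] (f : T →ₐ[K] T')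
      (x y : B →ₐ[K] T'), (Algebra.TensorProduct.lift x f (fun _ _ => .all ..)).comp g =
        (Algebra.TensorProduct.lift y f (fun _ _ => .all ..)).comp g := by
    intro T' _ _ f x y
    obtain ⟨h, rfl⟩ : ∃ h, y = pmul x h := ⟨X.isGalois.div x y, (X.isGalois.pmul_div x y).symm⟩
    rw [hg, hg, hp, hl.ldiv_pmul hc]
  obtain ⟨s, hs⟩ := exists_retraction K B
  -- Independence, applied to the two universal points over `B ⊗ B`, is the descent condition
  -- placing `g` in `T`.
  have hmem : ∀ a, g a ∈ (Algebra.TensorProduct.includeRight : T →ₐ[K] B ⊗[K] T).range := by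
    intro a
    have h1 := exists_eq_one_tmul s hs (g a) (by
      have h2 := hind ((B ⊗[K] B) ⊗[K] T) Algebra.TensorProduct.includeRight
        (Algebra.TensorProduct.includeLeft.comp Algebra.TensorProduct.includeLeft)
        (Algebra.TensorProduct.includeLeft.comp Algebra.TensorProduct.includeRight)
      have h3 := DFunLike.congr_fun h2 a
      have h4 : ∀ (i : B →ₐ[K] B ⊗[K] B) (z : B ⊗[K] T), i.toLinearMap.rTensor T z =
          Algebra.TensorProduct.lift
            ((Algebra.TensorProduct.includeLeft : B ⊗[K] B →ₐ[K] (B ⊗[K] B) ⊗[K] T).comp i)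
            Algebra.TensorProduct.includeRight (fun _ _ => .all ..) z := by
        intro i z
        induction z using TensorProduct.induction_on with
        | zero => simp
        | add x y hx hy => simp only [map_add, hx, hy]
        | tmul a b => simp
      rw [h4, h4]
      exact h3)
    exact ⟨_, h1.symm⟩
  have hinj : Function.Injective (Algebra.TensorProduct.includeRight : T →ₐ[K] B ⊗[K] T) :=
    one_tmul_injective (K := K) (A := B)
  let δ : A →ₐ[K] T := (AlgEquiv.ofInjective _ hinj).symm.toAlgHom.comp (g.codRestrict _ hmem)
  have hδ : ∀ a, (1 ⊗ₜ δ a : B ⊗[K] T) = g a := fun a =>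
    congrArg Subtype.val ((AlgEquiv.ofInjective _ hinj).apply_symm_apply (g.codRestrict _ hmem a))
  refine ⟨δ, hδ, fun T' _ _ f x => ?_⟩
  have h5 : f.comp δ = (Algebra.TensorProduct.lift x f (fun _ _ => .all ..)).comp g := by
    ext a
    refine Eq.trans ?_ (congrArg (Algebra.TensorProduct.lift x f (fun _ _ => .all ..)) (hδ a))
    rw [Algebra.TensorProduct.lift_tmul, map_one, one_mul]
    rfl
  rw [h5, hg, hl.actBy_ldiv]

/-- Algebra maps out of the left group are determined by how they act on the torsor. -/
theorem IsLeftGalois.hom_ext (hl : IsLeftGalois lam) {g g' : A →ₐ[K] T}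
    (h : ∀ (T' : Type u) [CommRing T'] [Algebra K T'] (f : T →ₐ[K] T') (x : X.carrier →ₐ[K] T'),
      actBy lam (f.comp g) x = actBy lam (f.comp g') x) : g = g' :=
  hl.eq_of_actBy_universal (h _ _ _)

include hc in
-- With `y = x * h`, the hypothesis becomes `g * x = (g * x) * h`, and freeness of the right action
-- gives `h = 1`.
theorem CommutesWithCoact.actBy_injective {g : A →ₐ[K] T} {x y : X.carrier →ₐ[K] T}
    (h : actBy lam g x = actBy lam g y) : x = y := by
  rw [← X.isGalois.pmul_div x y, hc.actBy_pmul] at h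
  have h1 : (X.isGalois.div x y) = 1 :=
    X.isGalois.pmul_cancel (x := actBy lam g x) (by rw [← h, pmul_one])
  rw [← X.isGalois.pmul_div x y, h1, pmul_one]

/-- Since `(x h) \ (y h) = h⁻¹ (x \ y) h`, the assignment `y (x \ y)` is equivariant; this is what
the antipode needs. -/
theorem IsGalois.div_pmul_pmul (x y : X.carrier →ₐ[K] T) (h : WithConv (H →ₐ[K] T)) :
    pmul (pmul y h) (X.isGalois.div (pmul x h) (pmul y h)) =
      pmul (pmul y (X.isGalois.div x y)) h := by
  have h1 : h * X.isGalois.div (pmul x h) (pmul y h) = X.isGalois.div x y * h :=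
    X.isGalois.pmul_cancel (x := x) (by
      rw [pmul_mul, X.isGalois.pmul_div, pmul_mul, X.isGalois.pmul_div])
  rw [← pmul_mul, h1, pmul_mul]

include hc in
/-- The coproduct of the left group. -/
theorem IsLeftGalois.exists_comul :
    ∃ δ : A →ₐ[K] A ⊗[K] A,
      (∀ a, (1 ⊗ₜ δ a : X.carrier ⊗[K] (A ⊗[K] A)) =
        hl.ldiv (actBy lam (Algebra.TensorProduct.includeRight.comp
            Algebra.TensorProduct.includeLeft)
          (actBy lam (Algebra.TensorProduct.includeRight.comp Algebra.TensorProduct.includeRight)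
            Algebra.TensorProduct.includeLeft)) Algebra.TensorProduct.includeLeft a) ∧
      ∀ (T' : Type u) [CommRing T'] [Algebra K T'] (f : A ⊗[K] A →ₐ[K] T')
        (x : X.carrier →ₐ[K] T'), actBy lam (f.comp δ) x =
          actBy lam (f.comp Algebra.TensorProduct.includeLeft)
            (actBy lam (f.comp Algebra.TensorProduct.includeRight) x) := by
  let p : X.carrier →ₐ[K] X.carrier ⊗[K] (A ⊗[K] A) :=
    actBy lam (Algebra.TensorProduct.includeRight.comp Algebra.TensorProduct.includeLeft)
      (actBy lam (Algebra.TensorProduct.includeRight.comp Algebra.TensorProduct.includeRight)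
        Algebra.TensorProduct.includeLeft)
  have hp : ∀ (T' : Type u) [CommRing T'] [Algebra K T'] (f : A ⊗[K] A →ₐ[K] T')
      (x : X.carrier →ₐ[K] T'),
      (Algebra.TensorProduct.lift x f (fun _ _ => .all ..)).comp p =
        actBy lam (f.comp Algebra.TensorProduct.includeLeft)
          (actBy lam (f.comp Algebra.TensorProduct.includeRight) x) := by
    intro T' _ _ f x
    refine (comp_actBy _ _ _ _).trans ?_
    have h1 : (Algebra.TensorProduct.lift x f (fun _ _ => .all ..)).comp
        (Algebra.TensorProduct.includeLeft : X.carrier →ₐ[K] X.carrier ⊗[K] (A ⊗[K] A)) = x := by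
      ext; simp
    have h2 : (Algebra.TensorProduct.lift x f (fun _ _ => .all ..)).comp
        (Algebra.TensorProduct.includeRight : A ⊗[K] A →ₐ[K] X.carrier ⊗[K] (A ⊗[K] A)) = f := by
      ext <;> simp
    rw [comp_actBy, ← AlgHom.comp_assoc, ← AlgHom.comp_assoc, h1, h2]
  obtain ⟨δ, h1, h2⟩ := hl.exists_point hc p (fun T' _ _ f x h => by
    rw [hp, hp, hc.actBy_pmul, hc.actBy_pmul])
  exact ⟨δ, h1, fun T' _ _ f x => (h2 T' f x).trans (hp T' f x)⟩

include hc in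
/-- The counit of the left group. -/
theorem IsLeftGalois.exists_counit :
    ∃ ε : A →ₐ[K] K,
      (∀ a, (1 ⊗ₜ ε a : X.carrier ⊗[K] K) =
        hl.ldiv Algebra.TensorProduct.includeLeft Algebra.TensorProduct.includeLeft a) ∧
      ∀ (T' : Type u) [CommRing T'] [Algebra K T'] (f : K →ₐ[K] T')
        (x : X.carrier →ₐ[K] T'), actBy lam (f.comp ε) x = x := by
  have hp : ∀ (T' : Type u) [CommRing T'] [Algebra K T'] (f : K →ₐ[K] T')
      (x : X.carrier →ₐ[K] T'), (Algebra.TensorProduct.lift x f (fun _ _ => .all ..)).comp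
        Algebra.TensorProduct.includeLeft = x := by
    intro T' _ _ f x
    ext
    simp
  obtain ⟨δ, h1, h2⟩ := hl.exists_point (T := K) hc Algebra.TensorProduct.includeLeft
    (fun T' _ _ f x h => by rw [hp, hp])
  exact ⟨δ, h1, fun T' _ _ f x => (h2 T' f x).trans (hp T' f x)⟩

include hc in
/-- The antipode of the left group. -/
theorem IsLeftGalois.exists_antipode :
    ∃ σ : A →ₐ[K] A,
      (∀ a, (1 ⊗ₜ σ a : X.carrier ⊗[K] A) =
        hl.ldiv (pmul Algebra.TensorProduct.includeLeft
          (X.isGalois.div (actBy lam Algebra.TensorProduct.includeRight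
            Algebra.TensorProduct.includeLeft) Algebra.TensorProduct.includeLeft))
          Algebra.TensorProduct.includeLeft a) ∧
      ∀ (T' : Type u) [CommRing T'] [Algebra K T'] (f : A →ₐ[K] T')
        (x : X.carrier →ₐ[K] T'), actBy lam f (actBy lam (f.comp σ) x) = x ∧
          actBy lam (f.comp σ) (actBy lam f x) = x := by
  -- The point `x * ((g x) \ x)` is `g⁻¹ x`, because `g` sends it to `(g x) * ((g x) \ x) = x`.
  let p : X.carrier →ₐ[K] X.carrier ⊗[K] A :=
    pmul Algebra.TensorProduct.includeLeft
      (X.isGalois.div (actBy lam Algebra.TensorProduct.includeRight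
        Algebra.TensorProduct.includeLeft) Algebra.TensorProduct.includeLeft)
  have hp : ∀ (T' : Type u) [CommRing T'] [Algebra K T'] (f : A →ₐ[K] T')
      (x : X.carrier →ₐ[K] T'),
      (Algebra.TensorProduct.lift x f (fun _ _ => .all ..)).comp p =
        pmul x (X.isGalois.div (actBy lam f x) x) := by
    intro T' _ _ f x
    have h1 : (Algebra.TensorProduct.lift x f (fun _ _ => .all ..)).comp
        (Algebra.TensorProduct.includeLeft : X.carrier →ₐ[K] X.carrier ⊗[K] A) = x := by
      ext; simp
    have h2 : (Algebra.TensorProduct.lift x f (fun _ _ => .all ..)).comp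
        (Algebra.TensorProduct.includeRight : A →ₐ[K] X.carrier ⊗[K] A) = f := by
      ext; simp
    refine (comp_pmul _ _ _).trans ?_
    have h3 := X.isGalois.comp_div (Algebra.TensorProduct.lift x f (fun _ _ => .all ..))
      (actBy lam Algebra.TensorProduct.includeRight Algebra.TensorProduct.includeLeft)
      Algebra.TensorProduct.includeLeft
    rw [comp_actBy, h1, h2] at h3
    rw [h1, h3]
  obtain ⟨δ, h1, h2⟩ := hl.exists_point hc p (fun T' _ _ f x h => by
    rw [hp, hp, hc.actBy_pmul, IsGalois.div_pmul_pmul])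
  have h3 : ∀ (T' : Type u) [CommRing T'] [Algebra K T'] (f : A →ₐ[K] T')
        (x : X.carrier →ₐ[K] T'), actBy lam f (actBy lam (f.comp δ) x) = x := by
    intro T' _ _ f x
    rw [h2, hp, hc.actBy_pmul, X.isGalois.pmul_div]
  -- The left inverse property follows from the right one at `f * x`, after cancelling the action of
  -- `f`.
  exact ⟨δ, h1, fun T' _ _ f x => ⟨h3 T' f x, hc.actBy_injective (h3 T' f _)⟩⟩

end LeftGroup

/-! ### The Hopf algebra of the left group -/

section LeftHopf

variable {K H : Type u} [Field K] [Differential K] [CommRing H] [Differential H]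
  [HopfAlgebra K H] [DiffHopfAlgebra K H] {X : RightTorsor K H}
  {A : Type u} [CommRing A] [Algebra K A]
  {lam : X.carrier →ₐ[K] A ⊗[K] X.carrier} (hl : IsLeftGalois lam) (hc : CommutesWithCoact lam)

namespace IsLeftGalois

/-- The coproduct of the left group, as an algebra map. -/
def comul : A →ₐ[K] A ⊗[K] A := (hl.exists_comul hc).choose

theorem actBy_comul {T : Type u} [CommRing T] [Algebra K T] (f : A ⊗[K] A →ₐ[K] T)
    (x : X.carrier →ₐ[K] T) : actBy lam (f.comp (hl.comul hc)) x =
      actBy lam (f.comp Algebra.TensorProduct.includeLeft)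
        (actBy lam (f.comp Algebra.TensorProduct.includeRight) x) :=
  (hl.exists_comul hc).choose_spec.2 T f x

/-- The counit of the left group, as an algebra map. -/
def counit : A →ₐ[K] K := (hl.exists_counit hc).choose

theorem actBy_counit {T : Type u} [CommRing T] [Algebra K T] (f : K →ₐ[K] T)
    (x : X.carrier →ₐ[K] T) : actBy lam (f.comp (hl.counit hc)) x = x :=
  (hl.exists_counit hc).choose_spec.2 T f x

/-- The antipode of the left group, as an algebra map. -/
def antipode : A →ₐ[K] A := (hl.exists_antipode hc).choose

theorem actBy_antipode {T : Type u} [CommRing T] [Algebra K T] (f : A →ₐ[K] T)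
    (x : X.carrier →ₐ[K] T) : actBy lam f (actBy lam (f.comp (hl.antipode hc)) x) = x ∧
      actBy lam (f.comp (hl.antipode hc)) (actBy lam f x) = x :=
  (hl.exists_antipode hc).choose_spec.2 T f x

/-- Each Hopf axiom is tested through `hom_ext`: algebra maps out of `A` agree when they act equally
on all points of `X`. Here both sides act by three successive translations. -/
theorem comul_coassoc :
    (Algebra.TensorProduct.assoc K K K A A A).toAlgHom.comp
        ((Algebra.TensorProduct.map (hl.comul hc) (AlgHom.id K A)).comp (hl.comul hc)) =
      (Algebra.TensorProduct.map (AlgHom.id K A) (hl.comul hc)).comp (hl.comul hc) := by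
  refine hl.hom_ext (T := A ⊗[K] (A ⊗[K] A)) fun T _ _ f x => ?_
  let g : (A ⊗[K] A) ⊗[K] A →ₐ[K] T := f.comp (Algebra.TensorProduct.assoc K K K A A A).toAlgHom
  have e1 : (g.comp (Algebra.TensorProduct.map (hl.comul hc) (AlgHom.id K A))).comp
      Algebra.TensorProduct.includeLeft =
      (g.comp Algebra.TensorProduct.includeLeft).comp (hl.comul hc) := by
    ext; simp
  have e2 : (g.comp (Algebra.TensorProduct.map (hl.comul hc) (AlgHom.id K A))).comp
      Algebra.TensorProduct.includeRight =
      (f.comp Algebra.TensorProduct.includeRight).comp Algebra.TensorProduct.includeRight := by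
    ext; simp [g, Algebra.TensorProduct.one_def]
  have e3 : (f.comp (Algebra.TensorProduct.map (AlgHom.id K A) (hl.comul hc))).comp
      Algebra.TensorProduct.includeRight =
      (f.comp Algebra.TensorProduct.includeRight).comp (hl.comul hc) := by
    ext; simp
  have e4 : (f.comp (Algebra.TensorProduct.map (AlgHom.id K A) (hl.comul hc))).comp
      Algebra.TensorProduct.includeLeft =
      (g.comp Algebra.TensorProduct.includeLeft).comp Algebra.TensorProduct.includeLeft := by
    ext; simp [g, Algebra.TensorProduct.one_def]
  have e5 : (f.comp Algebra.TensorProduct.includeRight).comp Algebra.TensorProduct.includeLeft =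
      (g.comp Algebra.TensorProduct.includeLeft).comp Algebra.TensorProduct.includeRight := by
    ext; simp [g]
  refine (hl.actBy_comul hc
    (g.comp (Algebra.TensorProduct.map (hl.comul hc) (AlgHom.id K A))) x).trans
    (Eq.trans ?_ (hl.actBy_comul hc
      (f.comp (Algebra.TensorProduct.map (AlgHom.id K A) (hl.comul hc))) x).symm)
  rw [e1, e2, e3, e4, hl.actBy_comul, hl.actBy_comul, e5]

theorem map_counit_comul :
    (Algebra.TensorProduct.map (hl.counit hc) (AlgHom.id K A)).comp (hl.comul hc) =
      (Algebra.TensorProduct.lid K A).symm := by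
  refine hl.hom_ext (T := K ⊗[K] A) fun T _ _ f x => ?_
  refine (hl.actBy_comul hc
    (f.comp (Algebra.TensorProduct.map (hl.counit hc) (AlgHom.id K A))) x).trans ?_
  have e1 : (f.comp (Algebra.TensorProduct.map (hl.counit hc) (AlgHom.id K A))).comp
      Algebra.TensorProduct.includeLeft =
      (f.comp Algebra.TensorProduct.includeLeft).comp (hl.counit hc) := by
    ext; simp
  rw [e1, hl.actBy_counit]
  congr 1
  ext; simp

theorem map_comul_counit :
    (Algebra.TensorProduct.map (AlgHom.id K A) (hl.counit hc)).comp (hl.comul hc) =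
      (Algebra.TensorProduct.rid K K A).symm := by
  refine hl.hom_ext (T := A ⊗[K] K) fun T _ _ f x => ?_
  refine (hl.actBy_comul hc
    (f.comp (Algebra.TensorProduct.map (AlgHom.id K A) (hl.counit hc))) x).trans ?_
  have e1 : (f.comp (Algebra.TensorProduct.map (AlgHom.id K A) (hl.counit hc))).comp
      Algebra.TensorProduct.includeRight =
      (f.comp Algebra.TensorProduct.includeRight).comp (hl.counit hc) := by
    ext; simp
  rw [e1, hl.actBy_counit]
  congr 1
  ext; simp

theorem antipode_comul :
    (Algebra.TensorProduct.lift (hl.antipode hc) (AlgHom.id K A) (fun _ _ => .all ..)).comp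
      (hl.comul hc) = (Algebra.ofId K A).comp (hl.counit hc) := by
  refine hl.hom_ext fun T _ _ f x => ?_
  have e : (Algebra.TensorProduct.lift (hl.antipode hc) (AlgHom.id K A) (fun _ _ => .all ..)).comp
      Algebra.TensorProduct.includeRight = AlgHom.id K A := by
    ext; simp
  refine (hl.actBy_comul hc (f.comp (Algebra.TensorProduct.lift (hl.antipode hc) (AlgHom.id K A)
    (fun _ _ => .all ..))) x).trans
    (Eq.trans ?_ (hl.actBy_counit hc (f.comp (Algebra.ofId K A)) x).symm)
  rw [AlgHom.comp_assoc, AlgHom.comp_assoc, Algebra.TensorProduct.lift_comp_includeLeft,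
    e]
  exact (hl.actBy_antipode hc f x).2

theorem comul_antipode :
    (Algebra.TensorProduct.lift (AlgHom.id K A) (hl.antipode hc) (fun _ _ => .all ..)).comp
      (hl.comul hc) = (Algebra.ofId K A).comp (hl.counit hc) := by
  refine hl.hom_ext fun T _ _ f x => ?_
  have e : (Algebra.TensorProduct.lift (AlgHom.id K A) (hl.antipode hc) (fun _ _ => .all ..)).comp
      Algebra.TensorProduct.includeRight = hl.antipode hc := by
    ext; simp
  refine (hl.actBy_comul hc (f.comp (Algebra.TensorProduct.lift (AlgHom.id K A) (hl.antipode hc)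
    (fun _ _ => .all ..))) x).trans
    (Eq.trans ?_ (hl.actBy_counit hc (f.comp (Algebra.ofId K A)) x).symm)
  rw [AlgHom.comp_assoc, AlgHom.comp_assoc, Algebra.TensorProduct.lift_comp_includeLeft,
    e]
  exact (hl.actBy_antipode hc f x).1

/-- The Hopf algebra structure of the left group. -/
@[reducible]
def hopfAlgebra : HopfAlgebra K A :=
  letI : Bialgebra K A := Bialgebra.ofAlgHom (hl.comul hc) (hl.counit hc) (hl.comul_coassoc hc)
    (hl.map_counit_comul hc) (hl.map_comul_counit hc)
  HopfAlgebra.ofAlgHom (hl.antipode hc) (hl.antipode_comul hc) (hl.comul_antipode hc)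

theorem lam_coassoc (b : X.carrier) : Algebra.TensorProduct.assoc K K K A A X.carrier
      (Algebra.TensorProduct.map (hl.comul hc) (AlgHom.id K X.carrier) (lam b)) =
    Algebra.TensorProduct.map (AlgHom.id K A) lam (lam b) := by
  let a : (A ⊗[K] A) ⊗[K] X.carrier →ₐ[K] A ⊗[K] (A ⊗[K] X.carrier) :=
    (Algebra.TensorProduct.assoc K K K A A X.carrier).toAlgHom
  have h := hl.actBy_comul hc (T := A ⊗[K] (A ⊗[K] X.carrier))
    (a.comp Algebra.TensorProduct.includeLeft) (a.comp Algebra.TensorProduct.includeRight)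
  have e1 : actBy (T := A ⊗[K] (A ⊗[K] X.carrier)) lam
      ((a.comp Algebra.TensorProduct.includeLeft).comp (hl.comul hc))
      (a.comp Algebra.TensorProduct.includeRight) =
      (a.comp (Algebra.TensorProduct.map (hl.comul hc) (AlgHom.id K X.carrier))).comp lam := by
    unfold actBy
    congr 1
    ext <;> simp
  have e2 : (Algebra.TensorProduct.includeRight : A ⊗[K] X.carrier →ₐ[K]
      A ⊗[K] (A ⊗[K] X.carrier)).comp lam =
      actBy (T := A ⊗[K] (A ⊗[K] X.carrier)) lam
        ((a.comp Algebra.TensorProduct.includeLeft).comp Algebra.TensorProduct.includeRight)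
        (a.comp Algebra.TensorProduct.includeRight) := by
    unfold actBy
    congr 1
    ext <;> simp [a, Algebra.TensorProduct.one_def]
  rw [e1, ← e2] at h
  refine (DFunLike.congr_fun h b).trans ?_
  unfold actBy
  rw [AlgHom.comp_apply]
  congr 1
  ext <;> simp [a, Algebra.TensorProduct.one_def]

theorem lam_counit (b : X.carrier) : Algebra.TensorProduct.lid K X.carrier
    (Algebra.TensorProduct.map (hl.counit hc) (AlgHom.id K X.carrier) (lam b)) = b := by
  have h := hl.actBy_counit hc (Algebra.ofId K X.carrier) (AlgHom.id K X.carrier)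
  refine Eq.trans ?_ (DFunLike.congr_fun h b)
  have e : (Algebra.TensorProduct.lid K X.carrier).toAlgHom.comp
      (Algebra.TensorProduct.map (hl.counit hc) (AlgHom.id K X.carrier)) =
      Algebra.TensorProduct.lift ((Algebra.ofId K X.carrier).comp (hl.counit hc))
        (AlgHom.id K X.carrier) (fun _ _ => .all ..) := by
    ext <;> simp [Algebra.ofId_apply, Algebra.algebraMap_eq_smul_one]
  exact DFunLike.congr_fun e (lam b)

section Deriv

variable [Differential A] [DifferentialAlgebra K A] (hd : ∀ b, lam (b′) = ((lam b)′))

omit [Algebra K A] [DifferentialAlgebra K A] in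
-- The structure maps are known only after embedding their target in `B ⊗ T`, where they are
-- quotients of `∂`-points; compatibility with `∂` is reflected by this embedding.
theorem deriv_of_one_tmul {T : Type u} [CommRing T] [Differential T] [Algebra K T]
    [DifferentialAlgebra K T] {δ : A → T} {g : A → X.carrier ⊗[K] T}
    (h : ∀ a, (1 ⊗ₜ δ a : X.carrier ⊗[K] T) = g a) (hg : ∀ a, g (a′) = ((g a)′)) (a : A) :
    δ (a′) = ((δ a)′) := by
  apply one_tmul_injective (K := K) (A := X.carrier)
  change (1 ⊗ₜ δ (a′) : X.carrier ⊗[K] T) = 1 ⊗ₜ ((δ a)′)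
  rw [h, hg, ← h]
  simp [deriv_tmul]

include hd in
theorem comul_deriv (a : A) : hl.comul hc (a′) = ((hl.comul hc a)′) := by
  refine deriv_of_one_tmul (X := X) (hl.exists_comul hc).choose_spec.1 (fun a => ?_) a
  have h1 := (DAlgHom.inl K X.carrier (A ⊗[K] A)).map_deriv
  have h2 := (DAlgHom.inr K X.carrier (A ⊗[K] A)).comp (DAlgHom.inl K A A) |>.map_deriv
  have h3 := (DAlgHom.inr K X.carrier (A ⊗[K] A)).comp (DAlgHom.inr K A A) |>.map_deriv
  exact hl.ldiv_deriv hd (actBy_deriv hd h2 (actBy_deriv hd h3 h1)) h1 a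

include hd in
theorem counit_deriv (a : A) : hl.counit hc (a′) = ((hl.counit hc a)′) := by
  refine deriv_of_one_tmul (X := X) (hl.exists_counit hc).choose_spec.1 (fun a => ?_) a
  have h1 := (DAlgHom.inl K X.carrier K).map_deriv
  exact hl.ldiv_deriv hd h1 h1 a

include hd in
theorem antipode_deriv (a : A) : hl.antipode hc (a′) = ((hl.antipode hc a)′) := by
  refine deriv_of_one_tmul (X := X) (hl.exists_antipode hc).choose_spec.1 (fun a => ?_) a
  have h1 := (DAlgHom.inl K X.carrier A).map_deriv
  have h2 := (DAlgHom.inr K X.carrier A).map_deriv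
  have h3 := actBy_deriv hd h2 h1
  exact hl.ldiv_deriv hd (pmul_deriv h1 ⟨_, X.isGalois.div_mem_points h3 h1⟩) h1 a

/-- The bi-Galois structure defined by a left Galois coaction that commutes with the right
coaction. -/
def toBiGalois : BiGalois X :=
  letI := hl.hopfAlgebra hc
  { carrier := A
    diffHopfAlgebra :=
      { deriv_algebraMap := deriv_algebraMap
        comul_deriv := hl.comul_deriv hc hd
        counit_deriv := hl.counit_deriv hc hd
        antipode_deriv := hl.antipode_deriv hc hd }
    lam := lam
    lam_deriv := hd
    coassoc := hl.lam_coassoc hc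
    counit := hl.lam_counit hc
    galois := hl
    lam_coact := hc }

end Deriv

end IsLeftGalois

end LeftHopf

/-! ### Existence of the left-acting group -/

section Twist

variable {K H : Type u} [Field K] [Differential K] [CommRing H] [Differential H]
  [HopfAlgebra K H] [DiffHopfAlgebra K H] (X : RightTorsor K H)
  {T T' : Type u} [CommRing T] [Algebra K T] [CommRing T'] [Algebra K T']

namespace RightTorsor

/-- The comorphism of the map `(r, (q, p)) ↦ (r, p * (q \ r))`. -/
def twistTheta : X.carrier ⊗[K] X.carrier →ₐ[X.carrier]
    X.carrier ⊗[K] (X.carrier ⊗[K] X.carrier) :=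
  liftAlg X.carrier (pmul (T := X.carrier ⊗[K] (X.carrier ⊗[K] X.carrier))
    (Algebra.TensorProduct.includeRight.comp Algebra.TensorProduct.includeRight)
    (X.isGalois.div (T := X.carrier ⊗[K] (X.carrier ⊗[K] X.carrier))
      (Algebra.TensorProduct.includeRight.comp Algebra.TensorProduct.includeLeft)
      Algebra.TensorProduct.includeLeft))

theorem comp_twistTheta (r q p : X.carrier →ₐ[K] T) :
    (Algebra.TensorProduct.lift r (Algebra.TensorProduct.lift q p (fun _ _ => .all ..))
      (fun _ _ => .all ..)).comp (X.twistTheta.restrictScalars K) =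
    Algebra.TensorProduct.lift r (pmul p (X.isGalois.div q r)) (fun _ _ => .all ..) := by
  let f : X.carrier ⊗[K] (X.carrier ⊗[K] X.carrier) →ₐ[K] T :=
    Algebra.TensorProduct.lift r (Algebra.TensorProduct.lift q p (fun _ _ => .all ..))
      (fun _ _ => .all ..)
  have h1 : f.comp (Algebra.TensorProduct.includeRight.comp Algebra.TensorProduct.includeRight) =
      p := by
    ext; simp [f]
  have h2 : f.comp (Algebra.TensorProduct.includeRight.comp Algebra.TensorProduct.includeLeft) =
      q := by
    ext; simp [f]
  have h3 : f.comp Algebra.TensorProduct.includeLeft = r := by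
    ext; simp [f]
  refine Algebra.TensorProduct.ext ?_ ?_
  · ext b
    simp [twistTheta, Algebra.TensorProduct.one_def, TensorProduct.smul_tmul']
  · have h4 := comp_pmul (T := X.carrier ⊗[K] (X.carrier ⊗[K] X.carrier)) f
      (Algebra.TensorProduct.includeRight.comp Algebra.TensorProduct.includeRight)
      (X.isGalois.div (T := X.carrier ⊗[K] (X.carrier ⊗[K] X.carrier))
        (Algebra.TensorProduct.includeRight.comp Algebra.TensorProduct.includeLeft)
        Algebra.TensorProduct.includeLeft)
    have h5 := X.isGalois.comp_div (T := X.carrier ⊗[K] (X.carrier ⊗[K] X.carrier)) f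
      (Algebra.TensorProduct.includeRight.comp Algebra.TensorProduct.includeLeft)
      Algebra.TensorProduct.includeLeft
    rw [h5, h1, h2, h3] at h4
    ext b
    have h6 := DFunLike.congr_fun h4 b
    refine Eq.trans ?_ (h6.trans ?_)
    · simp [twistTheta, f]
    · simp

/-- On points `(s, r, q, p)` this is `p (q \ r) (r \ s) = p (q \ s)`. -/
theorem comp_twistTheta_twistTheta
    (f : X.carrier ⊗[K] (X.carrier ⊗[K] (X.carrier ⊗[K] X.carrier)) →ₐ[K] T) :
    (f.comp (Algebra.TensorProduct.map (AlgHom.id K X.carrier)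
        (X.twistTheta.restrictScalars K))).comp (X.twistTheta.restrictScalars K) =
      (f.comp (Algebra.TensorProduct.map (AlgHom.id K X.carrier)
        Algebra.TensorProduct.includeRight)).comp (X.twistTheta.restrictScalars K) := by
  let s : X.carrier →ₐ[K] T := f.comp Algebra.TensorProduct.includeLeft
  let f' := f.comp Algebra.TensorProduct.includeRight
  let r : X.carrier →ₐ[K] T := f'.comp Algebra.TensorProduct.includeLeft
  let q : X.carrier →ₐ[K] T :=
    f'.comp (Algebra.TensorProduct.includeRight.comp Algebra.TensorProduct.includeLeft)
  let p : X.carrier →ₐ[K] T :=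
    f'.comp (Algebra.TensorProduct.includeRight.comp Algebra.TensorProduct.includeRight)
  have hf' : f' = Algebra.TensorProduct.lift r
      (Algebra.TensorProduct.lift q p (fun _ _ => .all ..)) (fun _ _ => .all ..) := by
    ext <;> simp [r, q, p]
  have h1 := X.comp_twistTheta s q p
  have h2 := X.comp_twistTheta r q p
  have h3 := X.comp_twistTheta s r (pmul p (X.isGalois.div q r))
  rw [← pmul_mul, X.isGalois.div_mul_div, ← h1, ← h2, ← hf'] at h3
  have e1 : f.comp (Algebra.TensorProduct.map (AlgHom.id K X.carrier)
      (X.twistTheta.restrictScalars K)) =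
      Algebra.TensorProduct.lift s (f'.comp (X.twistTheta.restrictScalars K))
        (fun _ _ => .all ..) := by
    ext <;> simp [s, f']
  have e2 : f.comp (Algebra.TensorProduct.map (AlgHom.id K X.carrier)
      Algebra.TensorProduct.includeRight) =
      Algebra.TensorProduct.lift s (Algebra.TensorProduct.lift q p (fun _ _ => .all ..))
        (fun _ _ => .all ..) := by
    ext <;> simp [s, q, p, f', Algebra.TensorProduct.one_def]
  rw [e1, e2, h3]

theorem twistTheta_deriv (z : X.carrier ⊗[K] X.carrier) :
    X.twistTheta (z′) = ((X.twistTheta z)′) := by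
  let B := X.carrier
  have h1 := (DAlgHom.inl K B (B ⊗[K] B)).map_deriv
  have h2 := (DAlgHom.inr K B (B ⊗[K] B)).comp (DAlgHom.inl K B B) |>.map_deriv
  have h3 := (DAlgHom.inr K B (B ⊗[K] B)).comp (DAlgHom.inr K B B) |>.map_deriv
  exact liftAlg_deriv (A := X.carrier ⊗[K] (X.carrier ⊗[K] X.carrier))
    (pmul_deriv h3 ⟨_, X.isGalois.div_mem_points h2 h1⟩) z

/-- The coordinate ring of the group of automorphisms of the torsor: the functions `F` of pairs of
points with `F (r, p * (q \ r)) = F (q, p)`. -/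
def twist : Subalgebra K (X.carrier ⊗[K] X.carrier) :=
  AlgHom.equalizer (X.twistTheta.restrictScalars K) Algebra.TensorProduct.includeRight

theorem mem_twist {z : X.carrier ⊗[K] X.carrier} :
    z ∈ X.twist ↔ X.twistTheta z = 1 ⊗ₜ z := Iff.rfl

theorem deriv_mem_twist : ∀ z ∈ X.twist, z′ ∈ X.twist := fun z hz => by
  rw [mem_twist] at hz ⊢
  rw [twistTheta_deriv, hz]
  simp [deriv_tmul]

instance : Differential X.twist := subalgebraDifferential _ X.deriv_mem_twist

instance : DifferentialAlgebra K X.twist := subalgebraDifferentialAlgebra _ X.deriv_mem_twist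

/-- Geometrically `X × (X × X)/G ≃ X × X`: a class of pairs has a unique representative with
prescribed first entry. -/
theorem twist_bijective : Function.Bijective (liftAlg X.carrier X.twist.val) := by
  let B := X.carrier
  have h := descent_bijective X.twistTheta.toLinearMap (Subalgebra.toSubmodule X.twist)
    (fun n => X.mem_twist) (fun n => ?_) (fun n => ?_)
  · have h1 : ∀ z : X.carrier ⊗[K] X.twist,
        (Subalgebra.toSubmodule X.twist).subtype.liftBaseChange X.carrier z =
          liftAlg X.carrier X.twist.val z := by
      intro z
      induction z using TensorProduct.induction_on with
      | zero => simp
      | add x y hx hy => simp only [map_add, hx, hy]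
      | tmul a b => simp
    have h2 : ⇑((Subalgebra.toSubmodule X.twist).subtype.liftBaseChange X.carrier) =
      ⇑(liftAlg X.carrier X.twist.val) := funext h1
    rw [← h2]
    exact h
  · let m : B ⊗[K] B →ₐ[K] B ⊗[K] B := Algebra.TensorProduct.lift
      Algebra.TensorProduct.includeLeft Algebra.TensorProduct.includeRight (fun _ _ => .all ..)
    have hm : m = AlgHom.id K (B ⊗[K] B) := by
      ext <;> simp [m]
    have h1 : ∀ z : B ⊗[K] (B ⊗[K] B),
        (LinearMap.id : B ⊗[K] B →ₗ[K] B ⊗[K] B).liftBaseChange B z =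
        Algebra.TensorProduct.lift (Algebra.TensorProduct.includeLeft : B →ₐ[K] B ⊗[K] B) m
          (fun _ _ => .all ..) z := by
      intro z
      rw [hm]
      induction z using TensorProduct.induction_on with
      | zero => simp
      | add x y hx hy => simp only [map_add, hx, hy]
      | tmul a b =>
        simp [Algebra.smul_def, Algebra.TensorProduct.algebraMap_apply]
    refine (h1 _).trans ?_
    -- The unit condition is the case `r = q`, where `q \ q = 1`.
    have h3 := X.comp_twistTheta (T := B ⊗[K] B) Algebra.TensorProduct.includeLeft
      Algebra.TensorProduct.includeLeft Algebra.TensorProduct.includeRight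
    rw [X.isGalois.div_self, pmul_one] at h3
    exact (DFunLike.congr_fun h3 n).trans (DFunLike.congr_fun hm n)
  · exact DFunLike.congr_fun (X.comp_twistTheta_twistTheta
      (T := B ⊗[K] (B ⊗[K] (B ⊗[K] B))) (AlgHom.id K _)) n

/-- The descent isomorphism `B ⊗ B' ≃ B ⊗ B` for the twisted algebra `B'`. -/
def twistEquiv : X.carrier ⊗[K] X.twist ≃ₐ[X.carrier] X.carrier ⊗[K] X.carrier :=
  AlgEquiv.ofBijective (liftAlg X.carrier X.twist.val) X.twist_bijective

theorem twistEquiv_tmul (b : X.carrier) (z : X.twist) :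
    X.twistEquiv (b ⊗ₜ z) = b • z.1 :=
  liftAlg_tmul _ _ _

theorem twistEquiv_deriv (z : X.carrier ⊗[K] X.twist) :
    X.twistEquiv (z′) = ((X.twistEquiv z)′) :=
  liftAlg_deriv (A := X.carrier ⊗[K] X.carrier) (c := X.twist.val) (fun _ => rfl) z

theorem twistEquiv_symm_tmul_one (b : X.carrier) : X.twistEquiv.symm (b ⊗ₜ 1) = b ⊗ₜ 1 := by
  have := X.twistEquiv.symm.commutes b
  simpa [Algebra.TensorProduct.algebraMap_apply] using this

/-- The left coaction on the torsor. -/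
def twistCoact : X.carrier →ₐ[K] X.twist ⊗[K] X.carrier :=
  ((Algebra.TensorProduct.comm K X.carrier X.twist).toAlgHom.comp
    (X.twistEquiv.symm.toAlgHom.restrictScalars K)).comp Algebra.TensorProduct.includeRight

theorem comm_twist_deriv (z : X.carrier ⊗[K] X.twist) :
    Algebra.TensorProduct.comm K X.carrier X.twist (z′) =
      (tensorDifferential (K := K) (A := X.twist) (B := X.carrier)).deriv
        (Algebra.TensorProduct.comm K X.carrier X.twist z) := by
  induction z using TensorProduct.induction_on with
  | zero => simp
  | add x y hx hy => simp only [map_add, hx, hy]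
  | tmul a b =>
    rw [deriv_tmul, map_add, Algebra.TensorProduct.comm_tmul, Algebra.TensorProduct.comm_tmul,
      Algebra.TensorProduct.comm_tmul, deriv_tmul, add_comm]

theorem twistCoact_deriv (b : X.carrier) : X.twistCoact (b′) =
    (tensorDifferential (K := K) (A := X.twist) (B := X.carrier)).deriv (X.twistCoact b) := by
  have h1 : (1 ⊗ₜ (b′) : X.carrier ⊗[K] X.carrier) = ((1 ⊗ₜ b)′) := by simp [deriv_tmul]
  have h2 := deriv_symm (e := X.twistEquiv.restrictScalars K) X.twistEquiv_deriv (1 ⊗ₜ b)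
  rw [← h1] at h2
  exact (congrArg _ h2).trans (X.comm_twist_deriv _)

/-- The coaction is defined through the inverse of `twistEquiv`, so up to exchanging factors its
Galois map is that inverse. -/
theorem twistCoact_isLeftGalois : IsLeftGalois X.twistCoact := by
  let e : X.carrier ⊗[K] X.carrier ≃ₐ[K] X.twist ⊗[K] X.carrier :=
    (Algebra.TensorProduct.comm K X.carrier X.carrier).trans
      ((X.twistEquiv.symm.restrictScalars K).trans
        (Algebra.TensorProduct.comm K X.carrier X.twist))
  have h : e.toAlgHom = Algebra.TensorProduct.lift X.twistCoact
      Algebra.TensorProduct.includeRight (fun _ _ => .all ..) := by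
    ext b
    · simp [e, twistCoact]
    · simp [e, twistEquiv_symm_tmul_one]
  have h2 : ⇑e = ⇑(Algebra.TensorProduct.lift X.twistCoact
      Algebra.TensorProduct.includeRight (fun _ _ => .all ..)) :=
    funext fun z => DFunLike.congr_fun h z
  unfold IsLeftGalois
  rw [← h2]
  exact e.bijective

/-- A pair `(q, p)` represents the automorphism of the torsor that takes `q` to `p`. -/
theorem actBy_twistCoact (q p : X.carrier →ₐ[K] T) :
    actBy X.twistCoact ((Algebra.TensorProduct.lift q p (fun _ _ => .all ..)).comp X.twist.val) q =
      p := by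
  have h1 : (Algebra.TensorProduct.lift q p (fun _ _ => .all ..)).comp
      (X.twistEquiv.toAlgHom.restrictScalars K) =
      (Algebra.TensorProduct.lift ((Algebra.TensorProduct.lift q p (fun _ _ => .all ..)).comp
        X.twist.val) q (fun _ _ => .all ..)).comp
          (Algebra.TensorProduct.comm K X.carrier X.twist).toAlgHom := by
    ext b
    · simp [twistEquiv_tmul, Algebra.smul_def]
    · simp [twistEquiv_tmul]
  ext b
  have h2 := DFunLike.congr_fun h1 (X.twistEquiv.symm (1 ⊗ₜ b))
  refine h2.symm.trans ?_
  change Algebra.TensorProduct.lift q p (fun _ _ => .all ..)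
    (X.twistEquiv (X.twistEquiv.symm (1 ⊗ₜ b))) = _
  rw [AlgEquiv.apply_symm_apply]
  simp

/-- The defining invariance with `r = q * h`: then `q \ r = h`, so `(q, p)` and `(q h, p h)`
represent the same element. -/
theorem lift_pmul_twist (q p : X.carrier →ₐ[K] T) (h : WithConv (H →ₐ[K] T)) :
    (Algebra.TensorProduct.lift (pmul q h) (pmul p h) (fun _ _ => .all ..)).comp X.twist.val =
      (Algebra.TensorProduct.lift q p (fun _ _ => .all ..)).comp X.twist.val := by
  have h1 := X.comp_twistTheta (pmul q h) q p
  rw [X.isGalois.div_pmul] at h1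
  ext z
  refine (DFunLike.congr_fun h1 z.1).symm.trans ?_
  refine (congrArg (Algebra.TensorProduct.lift (pmul q h)
    (Algebra.TensorProduct.lift q p (fun _ _ => .all ..)) (fun _ _ => .all ..)) z.2).trans ?_
  simp

/-- An element `g` is represented by `(x, g x)`, hence also by `(x h, (g x) h)`, which means `g (x
h) = (g x) h`. -/
theorem twistCoact_commutes : CommutesWithCoact X.twistCoact := by
  have h1 : ∀ (T : Type u) [CommRing T] [Algebra K T] (g : X.twist →ₐ[K] T)
      (x : X.carrier →ₐ[K] T) (h : WithConv (H →ₐ[K] T)),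
      actBy X.twistCoact g (pmul x h) = pmul (actBy X.twistCoact g x) h := by
    intro T _ _ g x h
    have h2 : g = (Algebra.TensorProduct.lift x (actBy X.twistCoact g x)
        (fun _ _ => .all ..)).comp X.twist.val :=
      X.twistCoact_isLeftGalois.actBy_cancel (x := x) (X.actBy_twistCoact _ _).symm
    have h3 := X.actBy_twistCoact (pmul x h) (pmul (actBy X.twistCoact g x) h)
    rwa [lift_pmul_twist, ← h2] at h3
  exact commutesWithCoact_of_actBy_pmul h1

instance (X : RightTorsor K H) : Nonempty (BiGalois X) :=
  ⟨X.twistCoact_isLeftGalois.toBiGalois X.twistCoact_commutes X.twistCoact_deriv⟩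

end RightTorsor

end Twist

/-! ### The classification bijections -/

/-- A relation between two types that is compatible with equivalence relations on them and
induces a one-to-one correspondence of classes defines a bijection of the quotients. -/
theorem exists_quotientEquiv {A C : Type*} (sA : Setoid A) (sC : Setoid C) (R : A → C → Prop)
    (total : ∀ a, ∃ c, R a c) (surj : ∀ c, ∃ a, R a c)
    (left : ∀ {a a' c}, R a c → (sA.r a a' ↔ R a' c))
    (right : ∀ {a c c'}, R a c → (sC.r c c' ↔ R a c')) :
    ∃ e : Quotient sA ≃ Quotient sC,
      ∀ a c, e (Quotient.mk sA a) = Quotient.mk sC c ↔ R a c := by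
  choose f hf using total
  have hf' : ∀ a a', sA.r a a' ↔ sC.r (f a) (f a') := fun a a' =>
    ⟨fun h => (right ((left (hf a)).1 h)).2 (hf a'),
      fun h => (left ((right (hf a)).1 h)).2 (hf a')⟩
  let F : Quotient sA → Quotient sC := Quotient.map f fun a a' h => (hf' a a').1 h
  have hF : Function.Bijective F := by
    constructor
    · rintro ⟨a⟩ ⟨a'⟩ h
      exact Quotient.sound ((hf' a a').2 (Quotient.exact h))
    · rintro ⟨c⟩
      obtain ⟨a, ha⟩ := surj c
      exact ⟨Quotient.mk sA a, Quotient.sound ((right (hf a)).2 ha)⟩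
  exact ⟨Equiv.ofBijective F hF, fun a c =>
    ⟨fun h => (right (hf a)).1 (Quotient.exact h), fun h => Quotient.sound ((right (hf a)).2 h)⟩⟩

section Classification

variable {K U H : Type u} [Field K] [CharZero K] [Differential K]
  [Field U] [Differential U] [Algebra K U] [DifferentialAlgebra K U]

/-- Torsors are classified by `H¹_∂(K, G)`. -/
theorem exists_torsorClass (hU : IsDiffUniversal K U) [CommRing H] [Differential H]
    [HopfAlgebra K H] [DiffHopfAlgebra K H] [Algebra.FiniteType K H] :
    ∃ e : TorsorClass K H ≃ H1 U (specFunctor K H),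
      ∀ X γ, e (TorsorClass.mk X) = H1.mk γ ↔ X.IsGivenBy γ :=
  exists_quotientEquiv (torsorSetoid K H) (cocycleSetoid U (specFunctor K H))
    (fun X γ => X.IsGivenBy γ)
    (fun X => by
      obtain ⟨x⟩ := exists_diffPoint hU X.carrier
      exact X.exists_isGivenBy x)
    (fun γ => ⟨_, torsorOfCocycle_isGivenBy γ⟩)
    (fun h => ⟨RightTorsor.isGivenBy_of_isIso h, RightTorsor.isIso_of_isGivenBy h⟩)
    (fun h => ⟨RightTorsor.isGivenBy_of_cohomologous h, RightTorsor.cohomologous_of_isGivenBy h⟩)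

/-- Twisted forms of a finite-dimensional `∂`-Lie algebra are classified by `H¹_∂(K, Aut_∂)`. -/
theorem exists_formClass (hU : IsDiffUniversal K U) (L : Type u) [LieRing L] [LieAlgebra K L]
    [DiffLieAlgebra K L] [Module.Finite K L] :
    ∃ e : FormClass K L ≃ H1 U (autFunctor K L),
      ∀ F σ, e (FormClass.mk F) = H1.mk σ ↔ F.IsGivenBy σ :=
  exists_quotientEquiv (formSetoid K L) (cocycleSetoid U (autFunctor K L))
    (fun F σ => F.IsGivenBy σ)
    (fun F => by
      obtain ⟨Ψ, hΨ⟩ := F.isForm.exists_iso hU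
      exact F.exists_isGivenBy hΨ)
    (fun σ => ⟨_, formOfCocycle_isGivenBy σ⟩)
    (fun h => ⟨LieForm.isGivenBy_of_isIso h, LieForm.isIso_of_isGivenBy h⟩)
    (fun h => ⟨LieForm.isGivenBy_of_cohomologous h, LieForm.cohomologous_of_isGivenBy h⟩)

end Classification

end DiffForms

end

theorem mainTheorem4 (K U H : Type u) [Field K] [CharZero K] [Differential K]
    [Field U] [Differential U] [Algebra K U] [DifferentialAlgebra K U]
    (hU : DiffForms.IsDiffUniversal K U)
    [CommRing H] [Differential H] [HopfAlgebra K H] [DiffForms.DiffHopfAlgebra K H]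
    [Algebra.FiniteType K H] :
    ∃ (torsorClass : DiffForms.TorsorClass K H ≃ DiffForms.H1 U (DiffForms.specFunctor K H))
      (formClass : DiffForms.FormClass K (DiffForms.HopfLie K H) ≃
        DiffForms.H1 U (DiffForms.autFunctor K (DiffForms.HopfLie K H))),
      (∀ (X : DiffForms.RightTorsor K H)
          (γ : DiffForms.Cocycle U (DiffForms.specFunctor K H)),
        torsorClass (DiffForms.TorsorClass.mk X) = DiffForms.H1.mk γ ↔ X.IsGivenBy γ) ∧
      (∀ (F : DiffForms.LieForm K (DiffForms.HopfLie K H))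
          (σ : DiffForms.Cocycle U (DiffForms.autFunctor K (DiffForms.HopfLie K H))),
        formClass (DiffForms.FormClass.mk F) = DiffForms.H1.mk σ ↔ F.IsGivenBy σ) ∧
      ∀ X : DiffForms.RightTorsor K H,
        Nonempty (DiffForms.BiGalois X) ∧
        ∀ Y : DiffForms.BiGalois X,
          ∃ hY : DiffForms.IsTwistedForm K (DiffForms.HopfLie K H)
              (DiffForms.HopfLie K Y.carrier),
            DiffForms.H1.map U (DiffForms.adNat K H)
                (torsorClass (DiffForms.TorsorClass.mk X)) =
              formClass (DiffForms.FormClass.mk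
                { carrier := DiffForms.HopfLie K Y.carrier, isForm := hY }) := by
  obtain ⟨e, he⟩ := DiffForms.exists_torsorClass (H := H) hU
  obtain ⟨e', he'⟩ := DiffForms.exists_formClass hU (DiffForms.HopfLie K H)
  refine ⟨e, e', he, he', fun X => ⟨inferInstance, fun Y => ?_⟩⟩
  obtain ⟨x⟩ := DiffForms.exists_diffPoint hU X.carrier
  obtain ⟨γ, hγ⟩ := X.exists_isGivenBy x
  have hY := Y.isTwistedForm x.map_deriv
  refine ⟨hY, ?_⟩
  -- With the class of `X` represented by `γ`, the claim is that the form `𝔤^X` is given by the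
  -- cocycle `Ad γ`.
  rw [(he X γ).2 hγ]
  exact ((he' _ _).2 (Y.isGivenBy hγ hY _ rfl)).symm
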